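/- Let $P=\mathbb F_2[x_1,\dots,x_5]$ with $|x_i|=1$, with the usual action of the mod $2$ Steenrod squares ($Sq^0x_i=x_i$, $Sq^1x_i=x_i^2$, $Sq^kx_i=0$ for $k\ge 2$, and the Cartan formula). Let $P_n$ be the space of homogeneous polynomials of degree $n$, and let $H_n=\sum_{i\ge 0,\ 2^i\le n}Sq^{2^i}(P_{n-2^i})\subseteq P_n$ be the space of hit polynomials. For a monomial $X=x_1^{u_1}\cdots x_5^{u_5}$ let $\omega(X)=(\omega_1(X),\omega_2(X),\dots)$ be its weight vector, where $\omega_k(X)$ is the number of $j$ for which the coefficient of $2^{k-1}$ in the binary expansion of $u_j$ is $1$. Weight vectors and exponent vectors are ordered left lexicographically. For monomials $X,Y$ of the same degree, with exponent vectors $u(X), u(Y)$, write $X<Y$ if $\omega(X)<\omega(Y)$, or $\omega(X)=\omega(Y)$ and $u(X)<u(Y)$. A monomial $X$ of degree $n$ is inadmissible if $X-\sum_{Y\in S}Y\in H_n$ for some finite (possibly empty) set $S$ of monomials of degree $n$, all smaller than $X$; otherwise it is admissible. For a weight vector $\omega$ of degree $\sum_k 2^{k-1}\omega_k=n$ let $P_n^{\le\omega}$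 (resp. $P_n^{<\omega}$) be the span of the monomials $X\in P_n$ with $\omega(X)\le\omega$ (resp. $\omega(X)<\omega$), and put $$(Q_n^{\otimes 5})^{\omega}=P_n^{\le\omega}\big/\big((H_n\cap P_n^{\le\omega})+P_n^{<\omega}\big).$$ Let $(Q_n^{\otimes 5})^{\omega^{>0}}\subseteq (Q_n^{\otimes 5})^{\omega}$ be the subspace of the classes of those polynomials in $P_n^{\le\omega}$ that are sums of monomials all of whose five exponents are positive. **Theorem.** Let $\omega_{(1)}=(1,1,1,1,1)$, $\omega_{(2)}=(3,2,2,2)$, $\omega_{(3)}=(3,4,3,1)$ (weight vectors of degree $31$, continued by zeros). Then $$\dim_{\mathbb F_2}(Q_{31}^{\otimes 5})^{\omega_{(1)}^{>0}}=1,\qquad \dim_{\mathbb F_2}(Q_{31}^{\otimes 5})^{\omega_{(2)}^{>0}}=215,\qquad \dim_{\mathbb F_2}(Q_{31}^{\otimes 5})^{\omega_{(3)}^{>0}}=70.$$ Moreover, for each $j\in\{1,2,3\}$ the set of the admissible monomials of degree $31$ in $P$ that have all five exponents positive and weight vector $\omega_{(j)}$ is precisely the set $B_j$ listed below, and the classes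 of the distinct elements of $B_j$ form a basis of $(Q_{31}^{\otimes 5})^{\omega_{(j)}^{>0}}$. The sets $B_j$ are, by exponent vectors $(u_1,\dots,u_5)$: - $B_1$: $(1,2,4,8,16)$. - $B_2$ (215 monomials): $(1,2,1,12,15),\ (1,2,1,15,12),\ (1,2,15,1,12),\ (1,2,1,13,14),\ (1,2,13,1,14),\ (1,2,13,14,1),\ (1,14,1,1,14),\ (1,14,1,14,1),\ (1,1,14,1,14),\ (1,1,14,14,1),\ (1,1,2,12,15),\ (1,1,2,15,12),\ (1,1,2,13,14),\ (1,3,14,1,12),\ (1,3,12,1,14),\ (1,3,12,14,1),\ (1,15,2,1,12),\ (1,1,1,14,14),\ (1,1,3,14,12),\ (1,1,15,2,12),\ (1,1,3,12,14),\ (1,3,1,14,12),\ (1,3,1,12,14),\ (1,3,13,2,12),\ (1,3,5,10,12),\ (1,15,1,2,12),\ (3,1,14,1,12),\ (3,1,12,1,14),\ (3,1,12,14,1),\ (3,1,1,14,12),\ (3,1,1,12,14),\ (3,1,13,2,12),\ (3,1,5,10,12),\ (3,13,1,2,12),\ (3,5,1,10,12),\ (3,13,2,1,12),\ (3,5,10,1,12),\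 (15,1,2,1,12),\ (15,1,1,2,12),\ (1,2,4,9,15),\ (1,2,4,15,9),\ (1,2,5,8,15),\ (1,2,5,15,8),\ (1,2,12,1,15),\ (1,2,12,15,1),\ (1,2,15,4,9),\ (1,2,15,5,8),\ (1,2,15,12,1),\ (1,3,4,8,15),\ (1,3,4,15,8),\ (1,3,14,12,1),\ (1,3,15,4,8),\ (1,15,2,4,9),\ (1,15,2,5,8),\ (1,15,2,12,1),\ (1,15,3,4,8),\ (3,1,4,8,15),\ (3,1,4,15,8),\ (3,1,14,12,1),\ (3,1,15,4,8),\ (3,5,10,12,1),\ (3,13,2,12,1),\ (3,15,1,4,8),\ (15,1,2,4,9),\ (15,1,2,5,8),\ (15,1,2,12,1),\ (15,1,3,4,8),\ (15,3,1,4,8),\ (1,2,1,14,13),\ (1,2,13,2,13),\ (1,2,3,12,13),\ (1,2,3,13,12),\ (1,2,13,3,12),\ (1,2,4,11,13),\ (1,2,5,10,13),\ (1,2,5,11,12),\ (1,2,7,9,12),\ (1,2,7,8,13),\ (1,6,1,10,13),\ (1,6,1,11,12),\ (1,6,11,1,12),\ (1,6,3,9,12),\ (1,6,3,8,13),\ (1,6,7,8,9),\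 (1,6,7,9,8),\ (1,14,1,2,13),\ (1,14,1,3,12),\ (1,14,3,1,12),\ (1,1,14,2,13),\ (1,1,14,3,12),\ (1,1,2,14,13),\ (1,1,6,10,13),\ (1,1,6,11,12),\ (1,3,12,2,13),\ (1,3,2,12,13),\ (1,3,2,13,12),\ (1,3,12,3,12),\ (1,3,4,10,13),\ (1,3,4,11,12),\ (1,3,6,9,12),\ (1,3,6,8,13),\ (1,7,10,1,12),\ (1,7,2,9,12),\ (1,7,2,8,13),\ (1,7,6,8,9),\ (1,7,6,9,8),\ (1,1,7,10,12),\ (1,3,3,12,12),\ (1,3,7,8,12),\ (1,7,1,10,12),\ (1,7,3,8,12),\ (1,7,7,8,8),\ (3,1,12,2,13),\ (3,1,2,12,13),\ (3,1,2,13,12),\ (3,1,12,3,12),\ (3,1,4,10,13),\ (3,1,4,11,12),\ (3,1,6,9,12),\ (3,1,6,8,13),\ (3,1,3,12,12),\ (3,1,7,8,12),\ (3,3,1,12,12),\ (3,4,1,10,13),\ (3,7,1,8,12),\ (3,4,1,11,12),\ (3,3,12,1,12),\ (3,4,11,1,12),\ (3,7,8,1,12),\ (3,5,2,9,12),\ (3,5,2,8,13),\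 (3,5,6,8,9),\ (3,5,6,9,8),\ (3,5,3,8,12),\ (3,5,7,8,8),\ (3,3,5,8,12),\ (3,7,5,8,8),\ (3,3,4,9,12),\ (3,4,3,9,12),\ (3,3,4,8,13),\ (7,1,10,1,12),\ (7,1,2,9,12),\ (7,1,2,8,13),\ (7,1,6,8,9),\ (7,1,6,9,8),\ (7,1,1,10,12),\ (7,1,3,8,12),\ (7,1,7,8,8),\ (7,3,1,8,12),\ (7,7,1,8,8),\ (7,3,8,1,12),\ (7,7,8,1,8),\ (7,3,5,8,8),\ (1,7,10,5,8),\ (1,2,12,3,13),\ (1,7,10,4,9),\ (1,2,5,9,14),\ (1,2,5,14,9),\ (1,3,6,13,8),\ (1,7,2,13,8),\ (1,2,7,13,8),\ (1,7,2,12,9),\ (1,2,7,12,9),\ (1,3,6,12,9),\ (1,7,11,4,8),\ (1,3,4,9,14),\ (1,3,4,14,9),\ (1,3,14,4,9),\ (1,3,7,12,8),\ (1,7,3,12,8),\ (1,3,5,8,14),\ (1,3,5,14,8),\ (1,3,14,5,8),\ (3,5,10,4,9),\ (3,5,10,5,8),\ (3,5,2,12,9),\ (3,13,2,4,9),\ (3,5,11,4,8),\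 (3,1,6,13,8),\ (3,1,6,12,9),\ (3,5,2,13,8),\ (3,13,2,5,8),\ (3,3,12,4,9),\ (3,3,4,12,9),\ (3,5,3,12,8),\ (3,3,5,12,8),\ (3,3,12,5,8),\ (3,13,3,4,8),\ (3,3,13,4,8),\ (3,3,4,13,8),\ (3,7,9,4,8),\ (3,7,4,9,8),\ (3,7,4,8,9),\ (3,1,4,9,14),\ (3,1,4,14,9),\ (3,1,14,4,9),\ (3,1,7,12,8),\ (3,7,1,12,8),\ (3,1,14,5,8),\ (3,1,5,8,14),\ (3,1,5,14,8),\ (7,1,10,5,8),\ (7,9,2,5,8),\ (7,9,2,4,9),\ (7,1,10,4,9),\ (7,1,2,13,8),\ (7,1,2,12,9),\ (7,1,11,4,8),\ (7,11,1,4,8),\ (7,3,9,4,8),\ (7,9,3,4,8),\ (7,3,4,9,8),\ (7,3,4,8,9),\ (7,1,3,12,8),\ (7,3,1,12,8)$. - $B_3$ (70 monomials): $(1,3,6,6,15),\ (1,3,6,15,6),\ (1,3,15,6,6),\ (1,15,3,6,6),\ (3,1,6,6,15),\ (3,1,6,15,6),\ (3,1,15,6,6),\ (3,15,1,6,6),\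 (15,1,3,6,6),\ (15,3,1,6,6),\ (3,5,2,6,15),\ (3,5,2,15,6),\ (3,5,6,2,15),\ (3,5,6,15,2),\ (3,5,15,2,6),\ (3,5,15,6,2),\ (3,15,5,2,6),\ (3,15,5,6,2),\ (15,3,5,2,6),\ (15,3,5,6,2),\ (1,3,6,7,14),\ (1,3,7,6,14),\ (1,3,7,14,6),\ (1,7,3,6,14),\ (1,7,3,14,6),\ (3,1,6,7,14),\ (3,1,7,6,14),\ (3,1,7,14,6),\ (3,7,1,6,14),\ (3,7,1,14,6),\ (7,1,3,6,14),\ (7,1,3,14,6),\ (7,3,1,6,14),\ (7,3,1,14,6),\ (3,5,2,7,14),\ (3,5,7,2,14),\ (3,5,7,14,2),\ (3,7,5,2,14),\ (3,7,5,14,2),\ (7,3,5,2,14),\ (7,3,5,14,2),\ (3,7,13,2,6),\ (3,7,13,6,2),\ (7,3,13,2,6),\ (7,3,13,6,2),\ (1,7,11,6,6),\ (7,1,11,6,6),\ (7,11,1,6,6),\ (7,11,5,2,6),\ (7,11,5,6,2),\ (3,3,5,6,14),\ (3,3,5,14,6),\ (3,5,3,6,14),\ (3,5,3,14,6),\ (3,5,6,3,14),\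 (3,5,6,14,3),\ (3,3,13,6,6),\ (3,13,3,6,6),\ (3,5,6,6,11),\ (3,5,11,6,6),\ (3,5,6,7,10),\ (3,5,7,6,10),\ (3,5,7,10,6),\ (3,7,5,6,10),\ (3,7,5,10,6),\ (7,3,5,6,10),\ (7,3,5,10,6),\ (3,7,9,6,6),\ (7,3,9,6,6),\ (7,9,3,6,6)$. -/

import Mathlib

namespace HitProblem

/-- The polynomial algebra `𝔽₂[x₁, …, x_t]`, the mod 2 cohomology of `(ℤ/2)^t`. -/
abbrev Poly (t : ℕ) : Type := MvPolynomial (Fin t) (ZMod 2)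

/-- The total Steenrod square `f ↦ ∑ₖ Sqᵏ(f) ξᵏ`: by the Cartan formula it is the homomorphism of
algebras with `xᵢ ↦ xᵢ + xᵢ² ξ`. -/
noncomputable def totalSq (t : ℕ) : Poly t →ₐ[ZMod 2] Polynomial (Poly t) :=
  MvPolynomial.aeval fun i =>
    Polynomial.C (MvPolynomial.X i) + Polynomial.C (MvPolynomial.X i ^ 2) * Polynomial.X

/-- The Steenrod square `Sqᵏ` on the polynomial algebra. -/
noncomputable def Sq (t k : ℕ) : Poly t →ₗ[ZMod 2] Poly t :=
  ((Polynomial.lcoeff (Poly t) k).restrictScalars (ZMod 2)).comp (totalSq t).toLinearMap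

/-- The Cartan formula. -/
theorem Sq_mul (t k : ℕ) (f g : Poly t) :
    Sq t k (f * g) = ∑ p ∈ Finset.HasAntidiagonal.antidiagonal k, Sq t p.1 f * Sq t p.2 g := by
  simp [Sq, Polynomial.coeff_mul]

/-- The values on the generators: `Sq⁰ xᵢ = xᵢ`, `Sq¹ xᵢ = xᵢ²`, and `Sqᵏ xᵢ = 0` for `k ≥ 2`. -/
theorem Sq_X (t k : ℕ) (i : Fin t) :
    Sq t k (MvPolynomial.X i) =
      if k = 0 then MvPolynomial.X i else if k = 1 then MvPolynomial.X i ^ 2 else 0 := by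
  rcases k with _ | _ | k <;>
    simp [Sq, totalSq, Polynomial.coeff_X, Polynomial.coeff_C, -map_pow]

/-- The hit elements of degree `n`: the sum over `i` of the images of
`Sq^(2^i)` from degree `n - 2^i` (no contribution if `2^i > n`). -/
noncomputable def hit (t n : ℕ) : Submodule (ZMod 2) (Poly t) :=
  ⨆ (i : ℕ) (m : ℕ) (_ : m + 2 ^ i = n),
    (MvPolynomial.homogeneousSubmodule (Fin t) (ZMod 2) m).map (Sq t (2 ^ i))

/-- The monomial `x₁^(u₁) ⋯ x_t^(u_t)`. -/
noncomputable def mono {t : ℕ} (u : Fin t →₀ ℕ) : Poly t := MvPolynomial.monomial u 1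

/-- The weight vector of the monomial with exponents `u`; the entry `ω_(j+1)`, at the index `j`, is
the number of exponents whose `j`-th binary digit is `1`. -/
def weight {t : ℕ} (u : Fin t →₀ ℕ) : ℕ → ℕ := fun j => ∑ i, u i / 2 ^ j % 2

/-- The span of the monomials of degree `n` and weight vector at most `ω`
(left lexicographical order). -/
noncomputable def polyLe (t n : ℕ) (ω : ℕ → ℕ) : Submodule (ZMod 2) (Poly t) :=
  Submodule.span (ZMod 2)
    {f | ∃ u : Fin t →₀ ℕ, u.degree = n ∧ toLex (weight u) ≤ toLex ω ∧ f = mono u}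

/-- The span of the monomials of degree `n` and weight vector less than `ω`. -/
noncomputable def polyLt (t n : ℕ) (ω : ℕ → ℕ) : Submodule (ZMod 2) (Poly t) :=
  Submodule.span (ZMod 2)
    {f | ∃ u : Fin t →₀ ℕ, u.degree = n ∧ toLex (weight u) < toLex ω ∧ f = mono u}

/-- The span of the monomials of degree `n` in which every variable occurs. -/
noncomputable def polyPos (t n : ℕ) : Submodule (ZMod 2) (Poly t) :=
  Submodule.span (ZMod 2)
    {f | ∃ u : Fin t →₀ ℕ, u.degree = n ∧ (∀ i, 0 < u i) ∧ f = mono u}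

/-- The elements of `polyLe` that are equivalent to zero with respect to `ω`. -/
noncomputable def weightHit (t n : ℕ) (ω : ℕ → ℕ) : Submodule (ZMod 2) (polyLe t n ω) :=
  (hit t n ⊓ polyLe t n ω ⊔ polyLt t n ω).submoduleOf (polyLe t n ω)

/-- The quotient `(Q_n)^ω` of the weight filtration. -/
abbrev QWeight (t n : ℕ) (ω : ℕ → ℕ) : Type := polyLe t n ω ⧸ weightHit t n ω

/-- The class in `(Q_n)^ω` of an element of `polyLe`. -/
noncomputable def weightClass (t n : ℕ) (ω : ℕ → ℕ) : polyLe t n ω →ₗ[ZMod 2] QWeight t n ω :=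
  (weightHit t n ω).mkQ

/-- The positive-variable part of `(Q_n)^ω`: the classes of the polynomials in `polyLe` that are sums
of monomials in which every variable occurs. -/
noncomputable def QWeightPos (t n : ℕ) (ω : ℕ → ℕ) : Submodule (ZMod 2) (QWeight t n ω) :=
  ((polyPos t n).submoduleOf (polyLe t n ω)).map (weightClass t n ω)

/-- The order on monomials of the same degree: first by weight vectors, then by exponent vectors,
both in the left lexicographical order. -/
def MonoLT {t : ℕ} (u v : Fin t →₀ ℕ) : Prop :=
  toLex (weight u) < toLex (weight v) ∨ (weight u = weight v ∧ toLex (⇑u) < toLex (⇑v))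

/-- A monomial is inadmissible if modulo hit elements it is a sum of smaller monomials
of the same degree. -/
def Inadmissible {t : ℕ} (u : Fin t →₀ ℕ) : Prop :=
  ∃ S : Finset (Fin t →₀ ℕ), (∀ v ∈ S, v.degree = u.degree ∧ MonoLT v u) ∧
    mono u - ∑ v ∈ S, mono v ∈ hit t u.degree

/-- A monomial is admissible if it is not inadmissible. -/
def Admissible {t : ℕ} (u : Fin t →₀ ℕ) : Prop := ¬ Inadmissible u

/-- The weight vectors `(1,1,1,1,1)`, `(3,2,2,2)` and `(3,4,3,1)`, continued by zeros. -/
def omega (j : Fin 3) : ℕ → ℕ :=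
  fun k => (![[1, 1, 1, 1, 1], [3, 2, 2, 2], [3, 4, 3, 1]] j).getD k 0

/-- The exponent vector of the monomial that spans the part of weight `(1,1,1,1,1)`. -/
def exponents1 : List (Fin 5 → ℕ) := [![1, 2, 4, 8, 16]]

/-- The exponent vectors of the 215 basis monomials of weight `(3,2,2,2)`. -/
def exponents2 : List (Fin 5 → ℕ) :=
  [
    ![1, 2, 1, 12, 15], ![1, 2, 1, 15, 12], ![1, 2, 15, 1, 12], ![1, 2, 1, 13, 14], ![1, 2, 13, 1, 14],
    ![1, 2, 13, 14, 1], ![1, 14, 1, 1, 14], ![1, 14, 1, 14, 1], ![1, 1, 14, 1, 14], ![1, 1, 14, 14, 1],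
    ![1, 1, 2, 12, 15], ![1, 1, 2, 15, 12], ![1, 1, 2, 13, 14], ![1, 3, 14, 1, 12], ![1, 3, 12, 1, 14],
    ![1, 3, 12, 14, 1], ![1, 15, 2, 1, 12], ![1, 1, 1, 14, 14], ![1, 1, 3, 14, 12], ![1, 1, 15, 2, 12],
    ![1, 1, 3, 12, 14], ![1, 3, 1, 14, 12], ![1, 3, 1, 12, 14], ![1, 3, 13, 2, 12], ![1, 3, 5, 10, 12],
    ![1, 15, 1, 2, 12], ![3, 1, 14, 1, 12], ![3, 1, 12, 1, 14], ![3, 1, 12, 14, 1], ![3, 1, 1, 14, 12],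
    ![3, 1, 1, 12, 14], ![3, 1, 13, 2, 12], ![3, 1, 5, 10, 12], ![3, 13, 1, 2, 12], ![3, 5, 1, 10, 12],
    ![3, 13, 2, 1, 12], ![3, 5, 10, 1, 12], ![15, 1, 2, 1, 12], ![15, 1, 1, 2, 12], ![1, 2, 4, 9, 15],
    ![1, 2, 4, 15, 9], ![1, 2, 5, 8, 15], ![1, 2, 5, 15, 8], ![1, 2, 12, 1, 15], ![1, 2, 12, 15, 1],
    ![1, 2, 15, 4, 9], ![1, 2, 15, 5, 8], ![1, 2, 15, 12, 1], ![1, 3, 4, 8, 15], ![1, 3, 4, 15, 8],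
    ![1, 3, 14, 12, 1], ![1, 3, 15, 4, 8], ![1, 15, 2, 4, 9], ![1, 15, 2, 5, 8], ![1, 15, 2, 12, 1],
    ![1, 15, 3, 4, 8], ![3, 1, 4, 8, 15], ![3, 1, 4, 15, 8], ![3, 1, 14, 12, 1], ![3, 1, 15, 4, 8],
    ![3, 5, 10, 12, 1], ![3, 13, 2, 12, 1], ![3, 15, 1, 4, 8], ![15, 1, 2, 4, 9], ![15, 1, 2, 5, 8],
    ![15, 1, 2, 12, 1], ![15, 1, 3, 4, 8], ![15, 3, 1, 4, 8], ![1, 2, 1, 14, 13], ![1, 2, 13, 2, 13],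
    ![1, 2, 3, 12, 13], ![1, 2, 3, 13, 12], ![1, 2, 13, 3, 12], ![1, 2, 4, 11, 13], ![1, 2, 5, 10, 13],
    ![1, 2, 5, 11, 12], ![1, 2, 7, 9, 12], ![1, 2, 7, 8, 13], ![1, 6, 1, 10, 13], ![1, 6, 1, 11, 12],
    ![1, 6, 11, 1, 12], ![1, 6, 3, 9, 12], ![1, 6, 3, 8, 13], ![1, 6, 7, 8, 9], ![1, 6, 7, 9, 8],
    ![1, 14, 1, 2, 13], ![1, 14, 1, 3, 12], ![1, 14, 3, 1, 12], ![1, 1, 14, 2, 13], ![1, 1, 14, 3, 12],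
    ![1, 1, 2, 14, 13], ![1, 1, 6, 10, 13], ![1, 1, 6, 11, 12], ![1, 3, 12, 2, 13], ![1, 3, 2, 12, 13],
    ![1, 3, 2, 13, 12], ![1, 3, 12, 3, 12], ![1, 3, 4, 10, 13], ![1, 3, 4, 11, 12], ![1, 3, 6, 9, 12],
    ![1, 3, 6, 8, 13], ![1, 7, 10, 1, 12], ![1, 7, 2, 9, 12], ![1, 7, 2, 8, 13], ![1, 7, 6, 8, 9],
    ![1, 7, 6, 9, 8], ![1, 1, 7, 10, 12], ![1, 3, 3, 12, 12], ![1, 3, 7, 8, 12], ![1, 7, 1, 10, 12],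
    ![1, 7, 3, 8, 12], ![1, 7, 7, 8, 8], ![3, 1, 12, 2, 13], ![3, 1, 2, 12, 13], ![3, 1, 2, 13, 12],
    ![3, 1, 12, 3, 12], ![3, 1, 4, 10, 13], ![3, 1, 4, 11, 12], ![3, 1, 6, 9, 12], ![3, 1, 6, 8, 13],
    ![3, 1, 3, 12, 12], ![3, 1, 7, 8, 12], ![3, 3, 1, 12, 12], ![3, 4, 1, 10, 13], ![3, 7, 1, 8, 12],
    ![3, 4, 1, 11, 12], ![3, 3, 12, 1, 12], ![3, 4, 11, 1, 12], ![3, 7, 8, 1, 12], ![3, 5, 2, 9, 12],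
    ![3, 5, 2, 8, 13], ![3, 5, 6, 8, 9], ![3, 5, 6, 9, 8], ![3, 5, 3, 8, 12], ![3, 5, 7, 8, 8],
    ![3, 3, 5, 8, 12], ![3, 7, 5, 8, 8], ![3, 3, 4, 9, 12], ![3, 4, 3, 9, 12], ![3, 3, 4, 8, 13],
    ![7, 1, 10, 1, 12], ![7, 1, 2, 9, 12], ![7, 1, 2, 8, 13], ![7, 1, 6, 8, 9], ![7, 1, 6, 9, 8],
    ![7, 1, 1, 10, 12], ![7, 1, 3, 8, 12], ![7, 1, 7, 8, 8], ![7, 3, 1, 8, 12], ![7, 7, 1, 8, 8],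
    ![7, 3, 8, 1, 12], ![7, 7, 8, 1, 8], ![7, 3, 5, 8, 8], ![1, 7, 10, 5, 8], ![1, 2, 12, 3, 13],
    ![1, 7, 10, 4, 9], ![1, 2, 5, 9, 14], ![1, 2, 5, 14, 9], ![1, 3, 6, 13, 8], ![1, 7, 2, 13, 8],
    ![1, 2, 7, 13, 8], ![1, 7, 2, 12, 9], ![1, 2, 7, 12, 9], ![1, 3, 6, 12, 9], ![1, 7, 11, 4, 8],
    ![1, 3, 4, 9, 14], ![1, 3, 4, 14, 9], ![1, 3, 14, 4, 9], ![1, 3, 7, 12, 8], ![1, 7, 3, 12, 8],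
    ![1, 3, 5, 8, 14], ![1, 3, 5, 14, 8], ![1, 3, 14, 5, 8], ![3, 5, 10, 4, 9], ![3, 5, 10, 5, 8],
    ![3, 5, 2, 12, 9], ![3, 13, 2, 4, 9], ![3, 5, 11, 4, 8], ![3, 1, 6, 13, 8], ![3, 1, 6, 12, 9],
    ![3, 5, 2, 13, 8], ![3, 13, 2, 5, 8], ![3, 3, 12, 4, 9], ![3, 3, 4, 12, 9], ![3, 5, 3, 12, 8],
    ![3, 3, 5, 12, 8], ![3, 3, 12, 5, 8], ![3, 13, 3, 4, 8], ![3, 3, 13, 4, 8], ![3, 3, 4, 13, 8],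
    ![3, 7, 9, 4, 8], ![3, 7, 4, 9, 8], ![3, 7, 4, 8, 9], ![3, 1, 4, 9, 14], ![3, 1, 4, 14, 9],
    ![3, 1, 14, 4, 9], ![3, 1, 7, 12, 8], ![3, 7, 1, 12, 8], ![3, 1, 14, 5, 8], ![3, 1, 5, 8, 14],
    ![3, 1, 5, 14, 8], ![7, 1, 10, 5, 8], ![7, 9, 2, 5, 8], ![7, 9, 2, 4, 9], ![7, 1, 10, 4, 9],
    ![7, 1, 2, 13, 8], ![7, 1, 2, 12, 9], ![7, 1, 11, 4, 8], ![7, 11, 1, 4, 8], ![7, 3, 9, 4, 8],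
    ![7, 9, 3, 4, 8], ![7, 3, 4, 9, 8], ![7, 3, 4, 8, 9], ![7, 1, 3, 12, 8], ![7, 3, 1, 12, 8]]

/-- The exponent vectors of the 70 basis monomials of weight `(3,4,3,1)`. -/
def exponents3 : List (Fin 5 → ℕ) :=
  [
    ![1, 3, 6, 6, 15], ![1, 3, 6, 15, 6], ![1, 3, 15, 6, 6], ![1, 15, 3, 6, 6], ![3, 1, 6, 6, 15],
    ![3, 1, 6, 15, 6], ![3, 1, 15, 6, 6], ![3, 15, 1, 6, 6], ![15, 1, 3, 6, 6], ![15, 3, 1, 6, 6],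
    ![3, 5, 2, 6, 15], ![3, 5, 2, 15, 6], ![3, 5, 6, 2, 15], ![3, 5, 6, 15, 2], ![3, 5, 15, 2, 6],
    ![3, 5, 15, 6, 2], ![3, 15, 5, 2, 6], ![3, 15, 5, 6, 2], ![15, 3, 5, 2, 6], ![15, 3, 5, 6, 2],
    ![1, 3, 6, 7, 14], ![1, 3, 7, 6, 14], ![1, 3, 7, 14, 6], ![1, 7, 3, 6, 14], ![1, 7, 3, 14, 6],
    ![3, 1, 6, 7, 14], ![3, 1, 7, 6, 14], ![3, 1, 7, 14, 6], ![3, 7, 1, 6, 14], ![3, 7, 1, 14, 6],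
    ![7, 1, 3, 6, 14], ![7, 1, 3, 14, 6], ![7, 3, 1, 6, 14], ![7, 3, 1, 14, 6], ![3, 5, 2, 7, 14],
    ![3, 5, 7, 2, 14], ![3, 5, 7, 14, 2], ![3, 7, 5, 2, 14], ![3, 7, 5, 14, 2], ![7, 3, 5, 2, 14],
    ![7, 3, 5, 14, 2], ![3, 7, 13, 2, 6], ![3, 7, 13, 6, 2], ![7, 3, 13, 2, 6], ![7, 3, 13, 6, 2],
    ![1, 7, 11, 6, 6], ![7, 1, 11, 6, 6], ![7, 11, 1, 6, 6], ![7, 11, 5, 2, 6], ![7, 11, 5, 6, 2],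
    ![3, 3, 5, 6, 14], ![3, 3, 5, 14, 6], ![3, 5, 3, 6, 14], ![3, 5, 3, 14, 6], ![3, 5, 6, 3, 14],
    ![3, 5, 6, 14, 3], ![3, 3, 13, 6, 6], ![3, 13, 3, 6, 6], ![3, 5, 6, 6, 11], ![3, 5, 11, 6, 6],
    ![3, 5, 6, 7, 10], ![3, 5, 7, 6, 10], ![3, 5, 7, 10, 6], ![3, 7, 5, 6, 10], ![3, 7, 5, 10, 6],
    ![7, 3, 5, 6, 10], ![7, 3, 5, 10, 6], ![3, 7, 9, 6, 6], ![7, 3, 9, 6, 6], ![7, 9, 3, 6, 6]]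

/-- The explicit basis monomials of the weight vector `omega j`, by their exponents. -/
def basisMonomials (j : Fin 3) : Set (Fin 5 →₀ ℕ) :=
  {u | ⇑u ∈ ![exponents1, exponents2, exponents3] j}

end HitProblem

namespace HitProblem

open MvPolynomial

/-! ### Steenrod squares on monomials -/

/-! Two bounds meet. From above, every monomial with positive exponents and weight vector ω_(j)
outside B_j is inadmissible. From below, the classes of the monomials in B_j are linearly
independent modulo the hit polynomials and the monomials of smaller weight vector. The projection
`posPart` commutes with the Steenrod squares, so a relation that makes a positive monomial
inadmissible may be restricted to its positive terms. Descent along the monomial order then shows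
that B_j spans (`mono_mem_spanMod`), and independence excludes inadmissible elements of B_j
(`admissible_of_linearIndependent`).

Upper bound. A monomial is strictly inadmissible at level d if it is a sum of smaller ones modulo
the images of Sq^(2^i) with i < d. For exponents below 2^d this survives multiplication by a 2^d-th
power, because these squares are linear over 2^d-th powers
(`StrictlyInadmissible.add_two_pow_smul`). It also survives f ↦ x f² for squarefree x, with d raised
by one, because the error terms of the Cartan formula have smaller ω_1
(`StrictlyInadmissible.prepend`). Hence a strictly inadmissible block of consecutive binary digits
makes the whole monomial inadmissible. Finite tables of such blocks, of two, three or four digits,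
each certified by an explicit hit equation, suffice: when monomials are built digit by digit from
the top and those with a listed block are discarded, the only positive ones left are those of B_j
(`exists_mem_survivors`).

Lower bound. Take a sum φ of coefficients, at monomials of weight vector at least ω_(j), that
vanishes on the hit polynomials because the dual squares annihilate it. A linear substitution A over
𝔽₂ commutes with the squares (`Sq_linSubst`) and produces no monomial of larger weight vector
(`coeff_linSubst_mono_eq_zero`), so φ ∘ A kills the hit polynomials and the smaller weight vectors
as well. One φ and 1, 215 or 70 matrices A give a square matrix of values on B_j, whose
nonsingularity is checked by Gaussian elimination. The values are computable because, between
monomials of equal weight vector, a coefficient of a substituted monomial is a product over the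
binary places (`coeff_linSubst_mono`). All the matrices A are handled at once, as the bits of
natural numbers. -/

theorem natCast_choose_zmod_two (n k : ℕ) :
    (n.choose k : ZMod 2) = if Nat.land k n = k then 1 else 0 := by
  change _ = if k &&& n = k then 1 else 0
  induction n using Nat.strong_induction_on generalizing k with
  | _ n ih =>
    rcases Nat.eq_zero_or_pos n with rfl | hn
    · cases k <;> simp
    · have h := Choose.choose_modEq_choose_mod_mul_choose_div_nat (p := 2) (n := n) (k := k)
      have h2 : (n.choose k : ZMod 2) =
          (((n % 2).choose (k % 2) * (n / 2).choose (k / 2) : ℕ) : ZMod 2) :=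
        (ZMod.natCast_eq_natCast_iff _ _ _).2 h
      rw [h2, Nat.cast_mul, ih (n / 2) (by omega)]
      have key : k &&& n = k ↔ ((k % 2 = 1 → n % 2 = 1) ∧ (k / 2 &&& n / 2 = k / 2)) := by
        have e1 : (k &&& n) / 2 = k / 2 &&& n / 2 := Nat.and_div_two
        have e2 : (k &&& n) % 2 = if k % 2 = 1 ∧ n % 2 = 1 then 1 else 0 := by
          have := Nat.and_mod_two_pow (a := k) (b := n) (n := 1)
          simp only [pow_one] at this
          rw [this]
          rcases Nat.mod_two_eq_zero_or_one k with h | h <;>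
          rcases Nat.mod_two_eq_zero_or_one n with h' | h' <;> simp [h, h']
        rw [← e1]
        constructor
        · intro h; rw [h] at e2 ⊢
          refine ⟨fun hk => ?_, rfl⟩
          by_contra hne
          simp [hk, hne] at e2
        · rintro ⟨h, h'⟩
          have : (k &&& n) % 2 = k % 2 := by
            rw [e2]; split_ifs with hh
            · exact hh.1.symm
            · have : k % 2 ≠ 1 := fun h1 => hh ⟨h1, h h1⟩
              omega
          omega
      by_cases hq : k / 2 &&& n / 2 = k / 2
      · rcases Nat.mod_two_eq_zero_or_one k with h | h <;>
        rcases Nat.mod_two_eq_zero_or_one n with h' | h' <;> simp [h, h', key, hq]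
      · simp [key, hq]

theorem Sq_one (t k : ℕ) : Sq t k (1 : Poly t) = if k = 0 then 1 else 0 := by
  simp [Sq, Polynomial.coeff_one]

theorem Sq_X_pow (t k u : ℕ) (i : Fin t) :
    Sq t k (X i ^ u) = if Nat.land k u = k then X i ^ (u + k) else 0 := by
  have h : Sq t k (X i ^ u) = (u.choose k : Poly t) * X i ^ (u + k) := by
    simp only [Sq, totalSq, LinearMap.comp_apply, AlgHom.toLinearMap_apply, map_pow,
      MvPolynomial.aeval_X, LinearMap.restrictScalars_apply, Polynomial.lcoeff_apply]
    -- In the binomial expansion of (x²ξ + x)^u only the summand m = k contributes to ξ^k.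
    rw [add_comm, add_pow, Polynomial.finsetSum_coeff]
    have : ∀ m ∈ Finset.range (u + 1), (((Polynomial.C (X i : Poly t) ^ 2 * Polynomial.X) ^ m *
        Polynomial.C (X i) ^ (u - m) * ((u.choose m : ℕ) : Polynomial (Poly t))).coeff k) =
        if k = m then (u.choose k : Poly t) * X i ^ (u + k) else 0 := by
      intro m hm
      have e : ((Polynomial.C (X i : Poly t) ^ 2 * Polynomial.X) ^ m *
          Polynomial.C (X i) ^ (u - m) * ((u.choose m : ℕ) : Polynomial (Poly t))) =
          Polynomial.C ((u.choose m : Poly t) * X i ^ (u + m)) * Polynomial.X ^ m := by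
        have : u + m = 2 * m + (u - m) := by simp at hm; omega
        rw [this]
        simp only [map_mul, map_pow, map_natCast, pow_add, pow_mul, mul_pow]
        ring
      rw [e, Polynomial.coeff_C_mul_X_pow]
      split_ifs with hk
      · rw [hk]
      · rfl
    rw [Finset.sum_congr rfl this, Finset.sum_ite_eq]
    split_ifs with hk
    · rfl
    · rw [Nat.choose_eq_zero_of_lt (by simpa using hk)]; simp
  rw [h, ← map_natCast (C : ZMod 2 →+* Poly t), natCast_choose_zmod_two]
  split_ifs <;> simp

/-- The exponent vectors (with multiplicity) of the monomials of `Sqᵏ` of a monomial. -/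
def sqTerms : ℕ → List ℕ → List (List ℕ)
  | k, [] => bif Nat.beq k 0 then [[]] else []
  | k, u :: us => (List.range (k + 1)).flatMap fun a =>
      bif Nat.beq (Nat.land a u) a then (sqTerms (k - a) us).map (Nat.add u a :: ·) else []

theorem sqTerms_nil_zero : sqTerms 0 [] = [[]] := rfl

theorem sqTerms_nil_succ (k : ℕ) : sqTerms (k + 1) [] = [] := rfl

theorem mem_sqTerms_nil {k : ℕ} {y : List ℕ} : y ∈ sqTerms k [] ↔ k = 0 ∧ y = [] := by
  rcases k with _ | k
  · simp [sqTerms_nil_zero]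
  · simp [sqTerms_nil_succ]

theorem mem_sqTerms_cons {k u : ℕ} {us y : List ℕ} : y ∈ sqTerms k (u :: us) ↔
    ∃ a ≤ k, Nat.land a u = a ∧ ∃ z ∈ sqTerms (k - a) us, y = (u + a) :: z := by
  simp only [sqTerms, List.mem_flatMap, List.mem_range, Nat.lt_succ_iff]
  refine exists_congr fun a => and_congr_right fun _ => ?_
  by_cases h : Nat.land a u = a
  · rw [Nat.beq_eq.mpr h]
    simp only [h, cond_true, List.mem_map, true_and, eq_comm (a := y)]
    rfl
  · rw [Bool.eq_false_iff.mpr fun hb => h (Nat.eq_of_beq_eq_true hb)]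
    simp only [h, cond_false, List.not_mem_nil, false_and]

theorem land_le_of_land_eq {a u : ℕ} (h : Nat.land a u = a) : a ≤ u := by
  rw [← h]; exact Nat.and_le_right

/-- The monomial with the given exponents in the variables `v 0, v 1, …`. -/
noncomputable def varProd {t : ℕ} : (ℕ → Fin t) → List ℕ → Poly t
  | _, [] => 1
  | v, u :: us => X (v 0) ^ u * varProd (fun i => v (i + 1)) us

theorem sum_map_flatMap {α β M : Type*} [AddCommMonoid M] (l : List α) (g : α → List β)
    (f : β → M) : ((l.flatMap g).map f).sum = (l.map fun a => ((g a).map f).sum).sum := by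
  induction l with
  | nil => simp
  | cons a l ih => simp [ih]

theorem Sq_varProd {t : ℕ} (l : List ℕ) : ∀ (k : ℕ) (v : ℕ → Fin t),
    Sq t k (varProd v l) = ((sqTerms k l).map (varProd v)).sum := by
  induction l with
  | nil =>
    intro k v
    rcases k with _ | k <;> simp [varProd, sqTerms_nil_zero, sqTerms_nil_succ, Sq_one]
  | cons u us ih =>
    intro k v
    rw [varProd, Sq_mul, Finset.Nat.sum_antidiagonal_eq_sum_range_succ
      (fun a b => Sq t a (X (v 0) ^ u) * Sq t b (varProd (fun i => v (i + 1)) us)), sqTerms,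
      sum_map_flatMap, Finset.sum_range]
    rw [← List.sum_ofFn, List.ofFn_eq_map, ← List.map_coe_finRange_eq_range, List.map_map]
    congr 1
    refine List.map_congr_left fun a _ => ?_
    simp only [Function.comp]
    rw [Sq_X_pow, ih]
    by_cases h : Nat.land a u = a
    · have hb : Nat.beq (Nat.land a u) a = true := Nat.beq_eq.mpr h
      rw [hb, if_pos h, cond_true, List.map_map, ← List.sum_map_mul_left]
      rfl
    · have hb : Nat.beq (Nat.land a u) a = false :=
        Bool.eq_false_iff.mpr fun hb => h (Nat.eq_of_beq_eq_true hb)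
      rw [hb, if_neg h]; simp

/-- The exponent vector with the entries of a list. -/
noncomputable def expo (l : List ℕ) : Fin 5 →₀ ℕ :=
  Finsupp.equivFunOnFinite.symm fun i => l.getD i 0

@[simp] theorem expo_apply (l : List ℕ) (i : Fin 5) : expo l i = l.getD i 0 := rfl

theorem exists_eq_of_length_eq_five {l : List ℕ} (h : l.length = 5) :
    ∃ a b c d e, l = [a, b, c, d, e] := by
  match l, h with
  | [a, b, c, d, e], _ => exact ⟨a, b, c, d, e, rfl⟩

theorem mono_expo {l : List ℕ} (h : l.length = 5) :
    mono (expo l) = varProd (t := 5) (fun i => Fin.ofNat 5 i) l := by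
  obtain ⟨a, b, c, d, e, rfl⟩ := exists_eq_of_length_eq_five h
  simp [mono, varProd, MvPolynomial.monomial_eq, Finsupp.prod_fintype, Fin.prod_univ_five]
  simp only [mul_assoc]
  rfl

theorem length_of_mem_sqTerms {l y : List ℕ} {k : ℕ} (h : y ∈ sqTerms k l) :
    y.length = l.length := by
  induction l generalizing k y with
  | nil => rw [(mem_sqTerms_nil.1 h).2]
  | cons u us ih =>
    obtain ⟨a, _, _, z, hz, rfl⟩ := mem_sqTerms_cons.1 h
    simp [ih hz]

theorem Sq_mono_expo {l : List ℕ} (h : l.length = 5) (k : ℕ) :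
    Sq 5 k (mono (expo l)) = ((sqTerms k l).map fun y => mono (expo y)).sum := by
  rw [mono_expo h, Sq_varProd]
  congr 1
  refine List.map_congr_left fun y hy => ?_
  rw [mono_expo ((length_of_mem_sqTerms hy).trans h)]

theorem exists_expo (u : Fin 5 →₀ ℕ) : ∃ l : List ℕ, l.length = 5 ∧ expo l = u :=
  ⟨[u 0, u 1, u 2, u 3, u 4], rfl, by ext i; fin_cases i <;> rfl⟩

theorem degree_expo {l : List ℕ} (h : l.length = 5) : (expo l).degree = l.sum := by
  obtain ⟨a, b, c, d, e, rfl⟩ := exists_eq_of_length_eq_five h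
  simp [Finsupp.degree_eq_sum, Fin.sum_univ_five]
  ring

theorem sum_of_mem_sqTerms {l y : List ℕ} {k : ℕ} (h : y ∈ sqTerms k l) :
    y.sum = l.sum + k := by
  induction l generalizing k y with
  | nil =>
    obtain ⟨rfl, rfl⟩ := mem_sqTerms_nil.1 h
    rfl
  | cons u us ih =>
    obtain ⟨a, ha, _, z, hz, rfl⟩ := mem_sqTerms_cons.1 h
    have := ih hz
    simp only [List.sum_cons]
    omega

/-- On a squarefree monomial each unit of k turns an odd exponent 1 into 2, so ω_1 drops by exactly
k. This is what makes the error terms in `StrictlyInadmissible.prepend` smaller. -/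
theorem parity_of_mem_sqTerms {l y : List ℕ} {k : ℕ} (hl : ∀ a ∈ l, a ≤ 1)
    (h : y ∈ sqTerms k l) : (y.map (· % 2)).sum + k = (l.map (· % 2)).sum := by
  induction l generalizing k y with
  | nil =>
    obtain ⟨rfl, rfl⟩ := mem_sqTerms_nil.1 h
    rfl
  | cons u us ih =>
    obtain ⟨a, ha, hau, z, hz, rfl⟩ := mem_sqTerms_cons.1 h
    have := ih (fun a ha => hl a (by simp [ha])) hz
    have hu : u ≤ 1 := hl u (by simp)
    have hau' := land_le_of_land_eq hau
    simp only [List.map_cons, List.sum_cons]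
    have : (u + a) % 2 + a = u % 2 := by
      interval_cases u <;> interval_cases a <;> rfl
    omega

/-- The amount a added to an exponent u has its binary digits among those of u, hence a ≤ u. So the
squares neither introduce nor remove a variable; `Sq_posPart` depends on this. -/
theorem zero_iff_of_mem_sqTerms {l y : List ℕ} {k : ℕ} (h : y ∈ sqTerms k l) (i : ℕ) :
    y.getD i 0 = 0 ↔ l.getD i 0 = 0 := by
  induction l generalizing k y i with
  | nil => rw [(mem_sqTerms_nil.1 h).2]
  | cons u us ih =>
    obtain ⟨a, ha, hau, z, hz, rfl⟩ := mem_sqTerms_cons.1 h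
    have := land_le_of_land_eq hau
    cases i with
    | zero => change u + a = 0 ↔ u = 0; omega
    | succ i => simpa using ih hz i

/-! ### Inadmissible monomials from strictly inadmissible ones -/

theorem Sq_zero_apply {t : ℕ} (f : Poly t) : Sq t 0 f = f := by
  induction f using MvPolynomial.induction_on with
  | C a => simp [Sq, totalSq, ← MvPolynomial.algebraMap_eq, Polynomial.coeff_one,
      Algebra.algebraMap_eq_smul_one]
  | add p q hp hq => rw [map_add, hp, hq]
  | mul_X p i hp => simp [Sq_mul, hp, Sq_X]

/-- The total square is a ring homomorphism, and in characteristic 2 the square of a polynomial in ξ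
is obtained by squaring the coefficients and doubling the degrees. -/
theorem totalSq_sq_coeff {t : ℕ} (f : Poly t) (k : ℕ) :
    Sq t k (f ^ 2) = if 2 ∣ k then Sq t (k / 2) f ^ 2 else 0 := by
  simp only [Sq, LinearMap.comp_apply, AlgHom.toLinearMap_apply, map_pow,
    LinearMap.restrictScalars_apply, Polynomial.lcoeff_apply]
  rw [← Polynomial.map_frobenius_expand (p := 2), Polynomial.coeff_map,
    Polynomial.coeff_expand two_pos]
  split_ifs <;> simp [frobenius_def]

theorem Sq_pow_two_pow {t d j : ℕ} (f : Poly t) (h0 : 0 < j) (h : j < 2 ^ d) :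
    Sq t j (f ^ 2 ^ d) = 0 := by
  induction d generalizing j with
  | zero => omega
  | succ d ih =>
    rw [pow_succ, pow_mul, totalSq_sq_coeff]
    split_ifs with hj
    · rw [ih (by omega) (by rw [pow_succ] at h; omega)]; simp
    · rfl

/-- In the Cartan formula every positive square of degree below 2^d kills a 2^d-th power. This
linearity over 2^d-th powers is what lets digits be appended above a relation. -/
theorem Sq_mul_pow_two_pow {t d k : ℕ} (f g : Poly t) (h : k < 2 ^ d) :
    Sq t k (f * g ^ 2 ^ d) = Sq t k f * g ^ 2 ^ d := by
  rw [Sq_mul, Finset.sum_eq_single (k, 0)]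
  · rw [Sq_zero_apply]
  · rintro ⟨a, b⟩ hab hne
    rw [Finset.HasAntidiagonal.mem_antidiagonal] at hab
    have hb : b ≠ 0 := by rintro rfl; exact hne (by simp_all)
    simp only at hab ⊢
    rw [Sq_pow_two_pow g (by omega) (by omega), mul_zero]
  · intro h; simp at h

theorem mono_mul {t : ℕ} (u v : Fin t →₀ ℕ) : mono u * mono v = mono (u + v) := by
  simp [mono]

theorem mono_pow {t : ℕ} (u : Fin t →₀ ℕ) (n : ℕ) : mono u ^ n = mono (n • u) := by
  simp [mono, MvPolynomial.monomial_pow]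

/-- The hit elements of degree `n` that come from the squares `Sq^(2^i)` with `i < d`. -/
noncomputable def hitBelow (t d n : ℕ) : Submodule (ZMod 2) (Poly t) :=
  Submodule.span (ZMod 2)
    {f | ∃ (i : ℕ) (h : Fin t →₀ ℕ), i < d ∧ h.degree + 2 ^ i = n ∧ f = Sq t (2 ^ i) (mono h)}

theorem Sq_mono_mem_hit {t n i : ℕ} {h : Fin t →₀ ℕ} (hn : h.degree + 2 ^ i = n) :
    Sq t (2 ^ i) (mono h) ∈ hit t n := by
  refine Submodule.mem_iSup_of_mem i (Submodule.mem_iSup_of_mem h.degree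
    (Submodule.mem_iSup_of_mem hn (Submodule.mem_map_of_mem ?_)))
  exact MvPolynomial.isHomogeneous_monomial _ rfl

theorem hitBelow_le_hit (t d n : ℕ) : hitBelow t d n ≤ hit t n := by
  refine Submodule.span_le.2 ?_
  rintro _ ⟨i, h, _, hn, rfl⟩
  exact Sq_mono_mem_hit hn

/-- The span of the monomials of the same degree that are smaller than a given one. -/
noncomputable def smallerSpan {t : ℕ} (u : Fin t →₀ ℕ) : Submodule (ZMod 2) (Poly t) :=
  Submodule.span (ZMod 2) {f | ∃ v : Fin t →₀ ℕ, v.degree = u.degree ∧ MonoLT v u ∧ f = mono v}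

/-- A monomial that is a sum of smaller ones modulo the images of the squares `Sq^(2^i)`
with `i < d`. -/
def StrictlyInadmissible {t : ℕ} (d : ℕ) (u : Fin t →₀ ℕ) : Prop :=
  mono u ∈ hitBelow t d u.degree ⊔ smallerSpan u

theorem zmod_two_eq_one {a : ZMod 2} (h : a ≠ 0) : a = 1 := by
  revert a; decide

theorem poly_eq_sum_mono {t : ℕ} (f : Poly t) : f = ∑ v ∈ f.support, mono v := by
  conv_lhs => rw [f.as_sum]
  refine Finset.sum_congr rfl fun v hv => ?_
  have : f.coeff v = 1 := zmod_two_eq_one (MvPolynomial.mem_support_iff.1 hv)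
  rw [this, mono]

theorem support_subset_of_mem_span {t : ℕ} {S : Set (Fin t →₀ ℕ)} {f : Poly t} :
    f ∈ Submodule.span (ZMod 2) (mono '' S) ↔ ∀ v ∈ f.support, v ∈ S := by
  have : Submodule.span (ZMod 2) (mono '' S) = MvPolynomial.restrictSupport (ZMod 2) S :=
    (MvPolynomial.restrictSupport_eq_span (ZMod 2) S).symm
  rw [this]
  exact Iff.rfl

/-- Over 𝔽₂ a polynomial is the sum of the monomials in its support, so the support of the part in
the span serves as the finite set of smaller monomials. -/
theorem inadmissible_of_mem {t : ℕ} {u : Fin t →₀ ℕ}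
    (h : mono u ∈ hit t u.degree ⊔ smallerSpan u) : Inadmissible u := by
  obtain ⟨g, hg, f, hf, he⟩ := Submodule.mem_sup.1 h
  refine ⟨f.support, ?_, ?_⟩
  · have : {f | ∃ v : Fin t →₀ ℕ, v.degree = u.degree ∧ MonoLT v u ∧ f = mono v} =
        mono '' {v | v.degree = u.degree ∧ MonoLT v u} := by
      ext f; simp [and_assoc, eq_comm]
    rw [smallerSpan, this, support_subset_of_mem_span] at hf
    exact hf
  · rw [← poly_eq_sum_mono f, ← he, add_sub_cancel_right]
    exact hg

theorem StrictlyInadmissible.inadmissible {t d : ℕ} {u : Fin t →₀ ℕ}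
    (h : StrictlyInadmissible d u) : Inadmissible u :=
  inadmissible_of_mem (sup_le_sup_right (hitBelow_le_hit t d _) _ h)

theorem toLex_lt_iff {ι : Type*} [LinearOrder ι] {f g : ι → ℕ} :
    toLex f < toLex g ↔ ∃ i, (∀ j < i, f j = g j) ∧ f i < g i := Iff.rfl

theorem weight_eq_zero_of_lt {t d j : ℕ} {u : Fin t →₀ ℕ} (h : ∀ i, u i < 2 ^ d) (hj : d ≤ j) :
    weight u j = 0 := by
  refine Finset.sum_eq_zero fun i _ => ?_
  rw [Nat.div_eq_of_lt ((h i).trans_le (Nat.pow_le_pow_right two_pos hj)), Nat.zero_mod]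

theorem lt_of_weight_eq_zero {t d : ℕ} {u : Fin t →₀ ℕ} (h : ∀ j, d ≤ j → weight u j = 0)
    (i : Fin t) : u i < 2 ^ d := by
  refine Nat.lt_pow_two_of_testBit _ fun j hj => ?_
  have := (Finset.sum_eq_zero_iff.1 (h j hj)) i (Finset.mem_univ i)
  rw [Nat.testBit_eq_decide_div_mod_eq]
  simp [this]

theorem weight_add_two_pow_smul {t d : ℕ} (u z : Fin t →₀ ℕ) {j : ℕ} (hj : j < d) :
    weight (u + 2 ^ d • z) j = weight u j := by
  refine Finset.sum_congr rfl fun i _ => ?_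
  obtain ⟨k, rfl⟩ : ∃ k, d = j + 1 + k := ⟨d - (j + 1), by omega⟩
  simp only [Finsupp.add_apply, Finsupp.smul_apply, smul_eq_mul]
  rw [show 2 ^ (j + 1 + k) * z i = 2 ^ j * (2 * (2 ^ k * z i)) by ring,
    Nat.add_mul_div_left _ _ (by positivity), Nat.add_mul_mod_self_left]

theorem weight_add_two_pow_smul_of_le {t d : ℕ} {u : Fin t →₀ ℕ} (z : Fin t →₀ ℕ)
    (hu : ∀ i, u i < 2 ^ d) {j : ℕ} (hj : d ≤ j) :
    weight (u + 2 ^ d • z) j = weight z (j - d) := by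
  refine Finset.sum_congr rfl fun i _ => ?_
  obtain ⟨k, rfl⟩ : ∃ k, j = d + k := ⟨j - d, by omega⟩
  simp only [Finsupp.add_apply, Finsupp.smul_apply, smul_eq_mul]
  rw [pow_add, ← Nat.div_div_eq_div_mul, Nat.add_mul_div_left _ _ (by positivity),
    Nat.div_eq_of_lt (hu i)]
  simp

/-- If the weight vectors first differ at the place i, then i < d, because w has no digit from the
place d on and its entry at i exceeds that of v; places below d are not affected by the appended
digits. If the weight vectors agree, then v also has exponents below 2^d, and the same digits are
placed above both. -/
theorem MonoLT.add_two_pow_smul {t d : ℕ} {v w : Fin t →₀ ℕ} (h : MonoLT v w)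
    (hw : ∀ i, w i < 2 ^ d) (z : Fin t →₀ ℕ) : MonoLT (v + 2 ^ d • z) (w + 2 ^ d • z) := by
  rcases h with h | ⟨h1, h2⟩
  · left
    obtain ⟨i, hi, hlt⟩ := toLex_lt_iff.1 h
    have hid : i < d := by
      by_contra hge
      rw [weight_eq_zero_of_lt hw (not_lt.1 hge)] at hlt
      omega
    refine toLex_lt_iff.2 ⟨i, fun j hj => ?_, ?_⟩
    · rw [weight_add_two_pow_smul _ _ (hj.trans hid), weight_add_two_pow_smul _ _ (hj.trans hid),
        hi j hj]
    · rwa [weight_add_two_pow_smul _ _ hid, weight_add_two_pow_smul _ _ hid]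
  · right
    have hv : ∀ i, v i < 2 ^ d := lt_of_weight_eq_zero fun j hj => by
      rw [h1, weight_eq_zero_of_lt hw hj]
    refine ⟨funext fun j => ?_, ?_⟩
    · rcases lt_or_ge j d with hj | hj
      · rw [weight_add_two_pow_smul _ _ hj, weight_add_two_pow_smul _ _ hj, h1]
      · rw [weight_add_two_pow_smul_of_le _ hv hj, weight_add_two_pow_smul_of_le _ hw hj]
    · obtain ⟨i, hi, hlt⟩ := toLex_lt_iff.1 h2
      exact toLex_lt_iff.2 ⟨i, fun j hj => by simp [hi j hj], by simpa using hlt⟩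

/-- Appending digits above a strictly inadmissible monomial. -/
theorem StrictlyInadmissible.add_two_pow_smul {t d : ℕ} {w : Fin t →₀ ℕ}
    (h : StrictlyInadmissible d w) (hw : ∀ i, w i < 2 ^ d) (z : Fin t →₀ ℕ) :
    StrictlyInadmissible d (w + 2 ^ d • z) := by
  -- Multiplication by the 2^d-th power takes generators of either summand to generators of the same
  -- kind.
  have hm : (hitBelow t d w.degree ⊔ smallerSpan w).map
      (LinearMap.mulRight (ZMod 2) (mono z ^ 2 ^ d)) ≤
      hitBelow t d (w + 2 ^ d • z).degree ⊔ smallerSpan (w + 2 ^ d • z) := by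
    rw [Submodule.map_sup]
    refine sup_le_sup ?_ ?_ <;> refine Submodule.map_span_le _ _ _ |>.2 ?_
    · rintro _ ⟨i, h, hi, hn, rfl⟩
      refine Submodule.subset_span ⟨i, h + 2 ^ d • z, hi, ?_, ?_⟩
      · simp only [map_add]; omega
      · rw [LinearMap.mulRight_apply, ← Sq_mul_pow_two_pow _ _ (Nat.pow_lt_pow_right (by norm_num) hi),
          mono_pow, mono_mul]
    · rintro _ ⟨v, hd, hv, rfl⟩
      refine Submodule.subset_span ⟨v + 2 ^ d • z, ?_, hv.add_two_pow_smul hw z, ?_⟩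
      · simp only [map_add, hd]
      · rw [LinearMap.mulRight_apply, mono_pow, mono_mul]
  have := hm (Submodule.mem_map_of_mem h)
  rwa [LinearMap.mulRight_apply, mono_pow, mono_mul] at this

theorem weight_zero_eq {t : ℕ} (u : Fin t →₀ ℕ) : weight u 0 = ∑ i, u i % 2 := by
  simp [weight]

theorem weight_add_two_smul_zero {t : ℕ} (x v : Fin t →₀ ℕ) :
    weight (x + 2 • v) 0 = weight x 0 := by
  simpa using weight_add_two_pow_smul (d := 1) x v one_pos

theorem weight_add_two_smul_succ {t : ℕ} {x : Fin t →₀ ℕ} (hx : ∀ i, x i ≤ 1) (v : Fin t →₀ ℕ)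
    (j : ℕ) : weight (x + 2 • v) (j + 1) = weight v j := by
  simpa using weight_add_two_pow_smul_of_le (d := 1) (u := x) v (fun i => by have := hx i; omega)
    (j := j + 1) (by omega)

theorem MonoLT.prepend {t : ℕ} {v w x : Fin t →₀ ℕ} (h : MonoLT v w) (hx : ∀ i, x i ≤ 1) :
    MonoLT (x + 2 • v) (x + 2 • w) := by
  rcases h with h | ⟨h1, h2⟩
  · left
    obtain ⟨i, hi, hlt⟩ := toLex_lt_iff.1 h
    refine toLex_lt_iff.2 ⟨i + 1, fun j hj => ?_, ?_⟩
    · rcases j with _ | j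
      · rw [weight_add_two_smul_zero, weight_add_two_smul_zero]
      · rw [weight_add_two_smul_succ hx, weight_add_two_smul_succ hx, hi j (by omega)]
    · rwa [weight_add_two_smul_succ hx, weight_add_two_smul_succ hx]
  · right
    refine ⟨funext fun j => ?_, ?_⟩
    · rcases j with _ | j
      · rw [weight_add_two_smul_zero, weight_add_two_smul_zero]
      · rw [weight_add_two_smul_succ hx, weight_add_two_smul_succ hx, h1]
    · obtain ⟨i, hi, hlt⟩ := toLex_lt_iff.1 h2
      exact toLex_lt_iff.2 ⟨i, fun j hj => by simp [hi j hj], by simpa using hlt⟩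

/-- A square contributes only to digits above the lowest, so every term has the same ω_1 as y, and
the order is already decided at that place. -/
theorem mono_mul_sq_mem_smallerSpan {t : ℕ} {y u : Fin t →₀ ℕ} {g : Poly t} {m : ℕ}
    (hg : g.IsHomogeneous m) (hd : y.degree + 2 * m = u.degree)
    (hw : weight y 0 < weight u 0) : mono y * g ^ 2 ∈ smallerSpan u := by
  rw [g.as_sum, sum_pow_char, Finset.mul_sum]
  refine Submodule.sum_mem _ fun v hv => ?_
  have h1 : g.coeff v = 1 := zmod_two_eq_one (MvPolynomial.mem_support_iff.1 hv)
  rw [h1]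
  change mono y * mono v ^ 2 ∈ _
  rw [mono_pow, mono_mul]
  refine Submodule.subset_span ⟨_, ?_, Or.inl (toLex_lt_iff.2 ⟨0, by simp, ?_⟩), rfl⟩
  · have : v.degree = m := by
      by_contra hne
      exact MvPolynomial.mem_support_iff.1 hv (hg.coeff_eq_zero hne)
    simp only [map_add, map_nsmul, smul_eq_mul]
    omega
  · rwa [weight_add_two_smul_zero]

theorem weight_expo_zero {l : List ℕ} (h : l.length = 5) :
    weight (expo l) 0 = (l.map (· % 2)).sum := by
  obtain ⟨a, b, c, d, e, rfl⟩ := exists_eq_of_length_eq_five h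
  simp [weight, Fin.sum_univ_five]
  ring

theorem isHomogeneous_mono {t : ℕ} (u : Fin t →₀ ℕ) : (mono u).IsHomogeneous u.degree :=
  MvPolynomial.isHomogeneous_monomial _ rfl

theorem isHomogeneous_Sq_mono (k : ℕ) (u : Fin 5 →₀ ℕ) :
    (Sq 5 k (mono u)).IsHomogeneous (u.degree + k) := by
  obtain ⟨l, hl, rfl⟩ := exists_expo u
  rw [Sq_mono_expo hl]
  refine (MvPolynomial.mem_homogeneousSubmodule _ _).1 (list_sum_mem fun f hf => ?_)
  obtain ⟨y, hy, rfl⟩ := List.mem_map.1 hf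
  have hd : (expo y).degree = (expo l).degree + k := by
    rw [degree_expo ((length_of_mem_sqTerms hy).trans hl), degree_expo hl, sum_of_mem_sqTerms hy]
  rw [← hd]
  exact isHomogeneous_mono _

/-- Prepending a digit below a strictly inadmissible monomial. -/
theorem StrictlyInadmissible.prepend {d : ℕ} {w x : Fin 5 →₀ ℕ} (h : StrictlyInadmissible d w)
    (hx : ∀ i, x i ≤ 1) : StrictlyInadmissible (d + 1) (x + 2 • w) := by
  -- Over 𝔽₂ the map `expand 2` is squaring; in this form it is visibly linear, so the two spans can
  -- be pushed forward along f ↦ x f².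
  have hm : (hitBelow 5 d w.degree ⊔ smallerSpan w).map
      ((LinearMap.mulLeft (ZMod 2) (mono x)).comp (MvPolynomial.expand 2).toLinearMap) ≤
      hitBelow 5 (d + 1) (x + 2 • w).degree ⊔ smallerSpan (x + 2 • w) := by
    rw [Submodule.map_sup]
    refine sup_le ?_ (le_sup_of_le_right ?_) <;> refine Submodule.map_span_le _ _ _ |>.2 ?_
    · rintro _ ⟨i, v, hi, hn, rfl⟩
      rw [LinearMap.comp_apply, AlgHom.toLinearMap_apply, LinearMap.mulLeft_apply,
        MvPolynomial.expand_zmod]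
      have hmem : Sq 5 (2 ^ (i + 1)) (mono (x + 2 • v)) ∈
          hitBelow 5 (d + 1) (x + 2 • w).degree := by
        refine Submodule.subset_span ⟨i + 1, _, by omega, ?_, rfl⟩
        simp only [map_add, map_nsmul, smul_eq_mul, ← hn, pow_succ]
        ring
      -- In the Cartan formula for Sq^(2^(i+1)) of x v² the summand with a = 0 is x (Sq^(2^i) v)²,
      -- the wanted element. The summands with a > 0 either vanish, for odd b, or have a smaller
      -- ω_1.
      rw [← mono_mul, ← mono_pow, Sq_mul, ← Finset.add_sum_erase _ _
        (Finset.HasAntidiagonal.mem_antidiagonal.2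
          (show ((0, 2 ^ (i + 1)) : ℕ × ℕ).1 + (0, 2 ^ (i + 1)).2 = 2 ^ (i + 1) from zero_add _)), Sq_zero_apply,
        totalSq_sq_coeff, if_pos (dvd_pow_self 2 (by omega)),
        show 2 ^ (i + 1) / 2 = 2 ^ i by rw [pow_succ]; omega] at hmem
      refine (Submodule.add_mem_iff_left _ ?_).1 (Submodule.mem_sup_left hmem)
      refine Submodule.mem_sup_right (Submodule.sum_mem _ ?_)
      rintro ⟨a, b⟩ hab
      obtain ⟨hne, hab⟩ := Finset.mem_erase.1 hab
      rw [Finset.HasAntidiagonal.mem_antidiagonal] at hab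
      have ha : a ≠ 0 := by rintro rfl; exact hne (by simp_all)
      simp only at hab ⊢
      rw [totalSq_sq_coeff]
      split_ifs with hb
      · obtain ⟨l, hl, rfl⟩ := exists_expo x
        rw [Sq_mono_expo hl, ← List.sum_map_mul_right]
        refine list_sum_mem fun f hf => ?_
        obtain ⟨y, hy, rfl⟩ := List.mem_map.1 hf
        have hyl := (length_of_mem_sqTerms hy).trans hl
        refine mono_mul_sq_mem_smallerSpan (isHomogeneous_Sq_mono _ v) ?_ ?_
        · simp only [map_add, map_nsmul, smul_eq_mul, degree_expo hl, degree_expo hyl,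
            sum_of_mem_sqTerms hy, ← hn]
          rw [pow_succ] at hab
          omega
        · rw [weight_add_two_smul_zero, weight_expo_zero hl, weight_expo_zero hyl,
            ← parity_of_mem_sqTerms _ hy]
          · omega
          · intro a ha
            obtain ⟨p, q, r, s, t, rfl⟩ := exists_eq_of_length_eq_five hl
            have h0 := hx 0; have h1 := hx 1; have h2 := hx 2; have h3 := hx 3; have h4 := hx 4
            simp at h0 h1 h2 h3 h4 ha
            omega
      · rw [mul_zero]; exact Submodule.zero_mem _
    · rintro _ ⟨v, hd, hv, rfl⟩
      rw [LinearMap.comp_apply, AlgHom.toLinearMap_apply, LinearMap.mulLeft_apply,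
        MvPolynomial.expand_zmod, mono_pow, mono_mul]
      refine Submodule.subset_span ⟨_, ?_, hv.prepend hx, rfl⟩
      simp only [map_add, map_nsmul, hd]
  have := hm (Submodule.mem_map_of_mem h)
  rwa [LinearMap.comp_apply, AlgHom.toLinearMap_apply, LinearMap.mulLeft_apply,
    MvPolynomial.expand_zmod, mono_pow, mono_mul] at this

/-! ### Certificates for strict inadmissibility in a form suited to evaluation -/

/-- Application to an evaluated number. -/
def withValue {α : Type} (n : ℕ) (f : ℕ → α) : α :=
  Nat.rec (f 0) (fun k _ => f (Nat.succ k)) n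

theorem withValue_eq {α : Type} (n : ℕ) (f : ℕ → α) : withValue n f = f n := by
  cases n <;> rfl

/-- A version of `sqTerms` for evaluation. -/
def sqTermsFast : List ℕ → ℕ → List (List ℕ)
  | [], k => bif Nat.beq k 0 then [[]] else []
  | [u], k => bif Nat.beq (Nat.land k u) k then [[Nat.add u k]] else []
  | u :: v :: us, k => bif Nat.beq k 0 then [u :: v :: us] else
      (List.range (Nat.succ k)).flatMap fun a =>
        bif Nat.beq (Nat.land a u) a then withValue (Nat.sub k a) fun b =>
          withValue (Nat.add u a) fun w => (sqTermsFast (v :: us) b).map (w :: ·) else []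

theorem sqTerms_zero (l : List ℕ) : sqTerms 0 l = [l] := by
  induction l with
  | nil => rfl
  | cons u us ih =>
    have h : Nat.beq (Nat.land 0 u) 0 = true := Nat.beq_eq.mpr (Nat.zero_and u)
    simp only [sqTerms, zero_add, List.range_one, List.flatMap_cons, List.flatMap_nil, h, cond_true,
      Nat.sub_zero, ih]
    rfl

theorem sqTerms_singleton (k u : ℕ) :
    sqTerms k [u] = bif Nat.beq (Nat.land k u) k then [[Nat.add u k]] else [] := by
  rw [sqTerms, List.range_succ, List.flatMap_append]
  have : ((List.range k).flatMap fun a => bif Nat.beq (Nat.land a u) a then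
      (sqTerms (k - a) []).map (Nat.add u a :: ·) else []) = [] := by
    refine List.flatMap_eq_nil_iff.2 fun a ha => ?_
    obtain ⟨b, hb⟩ : ∃ b, k - a = b + 1 := ⟨k - a - 1, by simp at ha; omega⟩
    rw [hb, sqTerms_nil_succ]
    cases Nat.beq (Nat.land a u) a <;> rfl
  rw [this]
  simp only [List.flatMap_cons, List.flatMap_nil, Nat.sub_self, sqTerms_nil_zero]
  cases Nat.beq (Nat.land k u) k <;> rfl

theorem sqTermsFast_eq (l : List ℕ) : ∀ k, sqTermsFast l k = sqTerms k l := by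
  induction l with
  | nil => intro k; rfl
  | cons u us ih =>
    intro k
    cases us with
    | nil => rw [sqTerms_singleton]; rfl
    | cons v us =>
      rcases k with _ | k
      · rw [sqTerms_zero]; rfl
      · change ((List.range (k + 1 + 1)).flatMap _) = _
        simp only [withValue_eq, ih]
        rfl

/-- Application to the evaluated hexadecimal digits. -/
def withHexDigits {α : Type} (n : ℕ) (f : List ℕ → α) : α :=
  withValue (Nat.mod (Nat.div n 65536) 16) fun a => withValue (Nat.mod (Nat.div n 4096) 16) fun b =>
    withValue (Nat.mod (Nat.div n 256) 16) fun c => withValue (Nat.mod (Nat.div n 16) 16) fun d =>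
      withValue (Nat.mod n 16) fun e => f [a, b, c, d, e]

/-- The total of a list of numbers. -/
def listSum : List ℕ → ℕ
  | [] => 0
  | a :: l => Nat.add a (listSum l)

/-- The binary digits of a number less than `32`, as digits in base `8` in the reverse order. -/
def spreadDigits (a : ℕ) : ℕ :=
  Nat.mod (Nat.div 0x249209248248049241208248048009248209048208041240208048008001249009208240048241008208040008248009008200040240008008000000
    (Nat.pow 32768 a)) 32768

/-- A number that encodes a monomial together with its weight vector, compatibly with the order. -/
def orderKey : List ℕ → ℕ
  | [a, b, c, d, e] =>
      Nat.add (Nat.mul 33554432 (Nat.add (spreadDigits a) (Nat.add (spreadDigits b)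
        (Nat.add (spreadDigits c) (Nat.add (spreadDigits d) (spreadDigits e))))))
      (Nat.add (Nat.mul 1048576 a) (Nat.add (Nat.mul 32768 b)
        (Nat.add (Nat.mul 1024 c) (Nat.add (Nat.mul 32 d) e))))
  | _ => 0

/-- Adds an element to a set, modulo 2. -/
def toggle (x : ℕ) : List ℕ → List ℕ
  | [] => [x]
  | y :: l => bif Nat.beq x y then l else y :: toggle x l

/-- The elements that are at least `w` and occur an odd number of times. -/
def oddPart (w : ℕ) : List ℕ → List ℕ
  | [] => []
  | x :: l => withValue x fun y => bif Nat.blt y w then oddPart w l else toggle y (oddPart w l)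

/-- Whether a set consists of one given number. -/
def isSingleton (w : ℕ) : List ℕ → Bool
  | [y] => Nat.beq y w
  | _ => false

/-- A number `e h₁ h₂ h₃ h₄ h₅` in hexadecimal digits stands for `Sq^(2^e)` of the monomial with
exponents `h`. The terms that are not smaller than `w` have to add up to `w`. -/
def checkRelation (d : ℕ) (c : ℕ × List ℕ) : Bool :=
  withHexDigits c.1 fun w => Nat.blt (listSum w) 32 &&
  ((c.2.all fun g => Nat.blt (Nat.div g 1048576) d &&
    withHexDigits g fun h =>
      Nat.beq (Nat.add (listSum h) (Nat.pow 2 (Nat.div g 1048576))) (listSum w)) &&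
  withValue (orderKey w) fun k => isSingleton k (oddPart k ((c.2.flatMap fun g =>
    withHexDigits g fun h => sqTermsFast h (Nat.pow 2 (Nat.div g 1048576))).map orderKey)))

theorem withHexDigits_eq {α : Type} (n : ℕ) (f : List ℕ → α) : withHexDigits n f =
    f [n / 65536 % 16, n / 4096 % 16, n / 256 % 16, n / 16 % 16, n % 16] := by
  simp only [withHexDigits, withValue_eq]
  rfl

/-- The hexadecimal digits of a number. -/
def hexDigits (n : ℕ) : List ℕ :=
  [n / 65536 % 16, n / 4096 % 16, n / 256 % 16, n / 16 % 16, n % 16]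

theorem listSum_eq (l : List ℕ) : listSum l = l.sum := by
  induction l with
  | nil => rfl
  | cons a l ih => rw [List.sum_cons, ← ih]; rfl

/-- The constant in `spreadDigits` is a table of 32 entries of 15 bits each. An entry has octal
digits 0 and 1, so a sum of five entries has octal digits at most 5: it never carries and displays
the weight vector. -/
theorem spreadDigits_eq {a : ℕ} (h : a < 32) : spreadDigits a =
    a / 1 % 2 * 4096 + a / 2 % 2 * 512 + a / 4 % 2 * 64 + a / 8 % 2 * 8 + a / 16 % 2 := by
  have : ∀ a : Fin 32, spreadDigits a = a.1 / 1 % 2 * 4096 + a.1 / 2 % 2 * 512 + a.1 / 4 % 2 * 64 +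
      a.1 / 8 % 2 * 8 + a.1 / 16 % 2 := by decide +kernel
  exact this ⟨a, h⟩

theorem weight_expo (a b c d e j : ℕ) : weight (expo [a, b, c, d, e]) j =
    a / 2 ^ j % 2 + b / 2 ^ j % 2 + c / 2 ^ j % 2 + d / 2 ^ j % 2 + e / 2 ^ j % 2 := by
  simp [weight, Fin.sum_univ_five]

theorem orderKey_eq {a b c d e : ℕ} (h : ∀ x ∈ [a, b, c, d, e], x < 32) :
    orderKey [a, b, c, d, e] = 33554432 * (
      weight (expo [a, b, c, d, e]) 0 * 4096 + weight (expo [a, b, c, d, e]) 1 * 512 +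
      weight (expo [a, b, c, d, e]) 2 * 64 + weight (expo [a, b, c, d, e]) 3 * 8 +
      weight (expo [a, b, c, d, e]) 4) +
      (1048576 * a + 32768 * b + 1024 * c + 32 * d + e) := by
  have : orderKey [a, b, c, d, e] = 33554432 * (spreadDigits a + (spreadDigits b +
      (spreadDigits c + (spreadDigits d + spreadDigits e)))) +
      (1048576 * a + (32768 * b + (1024 * c + (32 * d + e)))) := rfl
  simp only [List.mem_cons, List.not_mem_nil, or_false, forall_eq_or_imp, forall_eq] at h
  obtain ⟨ha, hb, hc, hd, he⟩ := h
  rw [this, spreadDigits_eq ha, spreadDigits_eq hb, spreadDigits_eq hc, spreadDigits_eq hd,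
    spreadDigits_eq he]
  simp only [weight_expo, pow_zero, pow_one, Nat.reducePow]
  ring

theorem weight_le (u : Fin 5 →₀ ℕ) (j : ℕ) : weight u j ≤ 5 :=
  calc weight u j ≤ ∑ _i : Fin 5, 1 := Finset.sum_le_sum fun i _ => by omega
    _ = 5 := by simp

/-- The key is a positional numeral, with the weights in octal above the exponents in base 32. As
weights are at most 5 and exponents at most 31, comparing keys compares first the weight vectors and
then the exponents, lexicographically. -/
theorem monoLT_of_orderKey_lt {y w : List ℕ} (hy : y.length = 5) (hw : w.length = 5)
    (hy' : ∀ x ∈ y, x < 32) (hw' : ∀ x ∈ w, x < 32) (h : orderKey y < orderKey w) :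
    MonoLT (expo y) (expo w) := by
  obtain ⟨a, b, c, d, e, rfl⟩ := exists_eq_of_length_eq_five hy
  obtain ⟨a', b', c', d', e', rfl⟩ := exists_eq_of_length_eq_five hw
  rw [orderKey_eq hy', orderKey_eq hw'] at h
  have hz : ∀ {l : List ℕ}, (∀ x ∈ l, x < 32) → ∀ j, 5 ≤ j → weight (expo l) j = 0 := by
    intro l hl j hj
    refine weight_eq_zero_of_lt (d := 5) (fun i => ?_) hj
    rw [expo_apply]
    rcases lt_or_ge i.1 l.length with hi | hi
    · rw [List.getD_eq_getElem _ _ hi]; exact hl _ (List.getElem_mem hi)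
    · rw [List.getD_eq_default _ _ hi]; norm_num
  have hzy := hz hy'
  have hzw := hz hw'
  simp only [List.mem_cons, List.not_mem_nil, or_false, forall_eq_or_imp, forall_eq] at hy' hw'
  obtain ⟨ha, hb, hc, hd, he⟩ := hy'
  obtain ⟨ha', hb', hc', hd', he'⟩ := hw'
  have l1 := weight_le (expo [a, b, c, d, e])
  have l2 := weight_le (expo [a', b', c', d', e'])
  set s := weight (expo [a, b, c, d, e]) with hs
  set s' := weight (expo [a', b', c', d', e']) with hs'
  have p0 := l1 0; have p1 := l1 1; have p2 := l1 2; have p3 := l1 3; have p4 := l1 4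
  have q0 := l2 0; have q1 := l2 1; have q2 := l2 2; have q3 := l2 3; have q4 := l2 4
  have key : s 0 < s' 0 ∨ s 0 = s' 0 ∧ (s 1 < s' 1 ∨ s 1 = s' 1 ∧ (s 2 < s' 2 ∨ s 2 = s' 2 ∧
      (s 3 < s' 3 ∨ s 3 = s' 3 ∧ (s 4 < s' 4 ∨ s 4 = s' 4 ∧ (a < a' ∨ a = a' ∧ (b < b' ∨ b = b' ∧
      (c < c' ∨ c = c' ∧ (d < d' ∨ d = d' ∧ e < e')))))))) := by
    rcases lt_trichotomy (s 0) (s' 0) with h0 | h0 | h0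
    · exact Or.inl h0
    · refine Or.inr ⟨h0, ?_⟩
      rcases lt_trichotomy (s 1) (s' 1) with h1 | h1 | h1
      · exact Or.inl h1
      · refine Or.inr ⟨h1, ?_⟩
        rcases lt_trichotomy (s 2) (s' 2) with h2 | h2 | h2
        · exact Or.inl h2
        · refine Or.inr ⟨h2, ?_⟩
          rcases lt_trichotomy (s 3) (s' 3) with h3 | h3 | h3
          · exact Or.inl h3
          · refine Or.inr ⟨h3, ?_⟩
            rcases lt_trichotomy (s 4) (s' 4) with h4 | h4 | h4
            · exact Or.inl h4
            · refine Or.inr ⟨h4, ?_⟩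
              rw [h0, h1, h2, h3, h4] at h
              clear_value s s'
              omega
            · omega
          · omega
        · omega
      · omega
    · omega
  have hlex : ∀ n, (∀ j < n, s j = s' j) → s n < s' n →
      MonoLT (expo [a, b, c, d, e]) (expo [a', b', c', d', e']) :=
    fun n h1 h2 => Or.inl (toLex_lt_iff.2 ⟨n, h1, h2⟩)
  rcases key with h0 | ⟨h0, h1 | ⟨h1, h2 | ⟨h2, h3 | ⟨h3, h4 | ⟨h4, h5⟩⟩⟩⟩⟩
  · exact hlex 0 (by simp) h0
  · exact hlex 1 (fun j hj => by interval_cases j; exact h0) h1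
  · exact hlex 2 (fun j hj => by interval_cases j <;> assumption) h2
  · exact hlex 3 (fun j hj => by interval_cases j <;> assumption) h3
  · exact hlex 4 (fun j hj => by interval_cases j <;> assumption) h4
  · refine Or.inr ⟨funext fun j => ?_, ?_⟩
    · rcases lt_or_ge j 5 with hj | hj
      · interval_cases j <;> assumption
      · change s j = s' j
        rw [hzy j hj, hzw j hj]
    · rcases h5 with h5 | ⟨rfl, h5 | ⟨rfl, h5 | ⟨rfl, h5 | ⟨rfl, h5⟩⟩⟩⟩
      · exact toLex_lt_iff.2 ⟨0, by simp, h5⟩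
      · exact toLex_lt_iff.2 ⟨1, fun j hj => by fin_cases j <;> first | rfl | simp at hj, h5⟩
      · exact toLex_lt_iff.2 ⟨2, fun j hj => by fin_cases j <;> first | rfl | simp at hj, h5⟩
      · exact toLex_lt_iff.2 ⟨3, fun j hj => by fin_cases j <;> first | rfl | simp at hj, h5⟩
      · exact toLex_lt_iff.2 ⟨4, fun j hj => by fin_cases j <;> first | rfl | simp at hj, h5⟩

/-- The monomial encoded by `orderKey`. -/
def keyDigits (k : ℕ) : List ℕ :=
  [k / 1048576 % 32, k / 32768 % 32, k / 1024 % 32, k / 32 % 32, k % 32]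

theorem keyDigits_orderKey {y : List ℕ} (hy : y.length = 5) (h : ∀ x ∈ y, x < 32) :
    keyDigits (orderKey y) = y := by
  obtain ⟨a, b, c, d, e, rfl⟩ := exists_eq_of_length_eq_five hy
  rw [orderKey_eq h]
  simp only [List.mem_cons, List.not_mem_nil, or_false, forall_eq_or_imp, forall_eq] at h
  generalize (weight (expo [a, b, c, d, e]) 0 * 4096 + _ + _ + _ + _) = s
  simp only [keyDigits, List.cons.injEq, and_true]
  omega

theorem sum_map_toggle {M : Type*} [AddCommGroup M] [Module (ZMod 2) M] (f : ℕ → M) (x : ℕ)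
    (l : List ℕ) : ((toggle x l).map f).sum = f x + (l.map f).sum := by
  induction l with
  | nil => simp [toggle]
  | cons y l ih =>
    rw [toggle]
    cases h : Nat.beq x y
    · rw [cond_false, List.map_cons, List.sum_cons, ih, List.map_cons, List.sum_cons]
      abel
    · rw [cond_true, Nat.eq_of_beq_eq_true h, List.map_cons, List.sum_cons, ← add_assoc]
      have : f y + f y = 0 := by rw [← two_smul (ZMod 2) (f y)]; exact zero_smul _ _
      rw [this, zero_add]

/-- The discarded values below w contribute elements of S, and equal values among the others cancel
in pairs in characteristic 2. -/
theorem sum_map_oddPart_mem {M : Type*} [AddCommGroup M] [Module (ZMod 2) M] (f : ℕ → M) (w : ℕ)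
    (S : Submodule (ZMod 2) M) (l : List ℕ) (hS : ∀ x ∈ l, x < w → f x ∈ S) :
    (l.map f).sum - ((oddPart w l).map f).sum ∈ S := by
  induction l with
  | nil => simp [oddPart]
  | cons x l ih =>
    have ih := ih fun y hy => hS y (by simp [hy])
    rw [oddPart, withValue_eq]
    cases h : Nat.blt x w
    · rw [cond_false, sum_map_toggle, List.map_cons, List.sum_cons, add_sub_add_left_eq_sub]
      exact ih
    · rw [cond_true, List.map_cons, List.sum_cons, add_sub_assoc]
      exact S.add_mem (hS x (by simp) (Nat.blt_eq.mp h)) ih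

theorem le_sum_of_mem {l : List ℕ} {x : ℕ} (h : x ∈ l) : x ≤ l.sum := List.le_sum_of_mem h

/-- The listed images of Sq^(2^e), e < d, add up to w plus smaller monomials: after cancellation w
is the only term that is not smaller than w. The degree is below 32, hence so are all exponents, and
`orderKey` determines the terms. -/
theorem strictlyInadmissible_of_checkRelation {d : ℕ} {c : ℕ × List ℕ}
    (h : checkRelation d c = true) : StrictlyInadmissible d (expo (hexDigits c.1)) := by
  rw [checkRelation, withHexDigits_eq] at h
  change (Nat.blt (listSum (hexDigits c.1)) 32 && _) = true at h
  simp only [withHexDigits_eq, withValue_eq, Bool.and_eq_true, List.all_eq_true, listSum_eq] at h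
  obtain ⟨h32, hg, hs⟩ := h
  set w := hexDigits c.1 with hw
  change isSingleton (orderKey w) (oddPart (orderKey w) ((c.2.flatMap fun g =>
    sqTermsFast (hexDigits g) (2 ^ (g / 1048576))).map orderKey)) = true at hs
  replace hg : ∀ g ∈ c.2, g / 1048576 < d ∧ (hexDigits g).sum + 2 ^ (g / 1048576) = w.sum :=
    fun g hgc => ⟨Nat.blt_eq.mp (hg g hgc).1, Nat.eq_of_beq_eq_true (hg g hgc).2⟩
  replace h32 : w.sum < 32 := Nat.blt_eq.mp h32
  set L := c.2.flatMap fun g => sqTermsFast (hexDigits g) (2 ^ (g / 1048576)) with hL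
  have hLmem : ∀ y ∈ L, y.length = 5 ∧ y.sum = w.sum := by
    intro y hy
    obtain ⟨g, hgc, hy⟩ := List.mem_flatMap.1 hy
    rw [sqTermsFast_eq] at hy
    exact ⟨(length_of_mem_sqTerms hy).trans rfl, by rw [sum_of_mem_sqTerms hy, (hg g hgc).2]⟩
  have hlt : ∀ {y : List ℕ}, y.sum = w.sum → ∀ x ∈ y, x < 32 :=
    fun hy x hx => (le_sum_of_mem hx).trans_lt (hy ▸ h32)
  have hdec : ∀ y ∈ L, keyDigits (orderKey y) = y := fun y hy =>
    keyDigits_orderKey (hLmem y hy).1 (hlt (hLmem y hy).2)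
  set f : ℕ → Poly 5 := fun k => mono (expo (keyDigits k)) with hf
  have hsum : ((L.map orderKey).map f).sum ∈ hitBelow 5 d (expo w).degree := by
    have e : (L.map orderKey).map f = L.map fun y => mono (expo y) := by
      rw [List.map_map]
      exact List.map_congr_left fun y hy => by simp only [hf, Function.comp, hdec y hy]
    rw [e, hL, sum_map_flatMap]
    refine list_sum_mem fun p hp => ?_
    obtain ⟨g, hgc, rfl⟩ := List.mem_map.1 hp
    rw [sqTermsFast_eq, ← Sq_mono_expo rfl]
    refine Submodule.subset_span ⟨_, expo (hexDigits g), (hg g hgc).1, ?_, rfl⟩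
    rw [degree_expo rfl, degree_expo rfl, (hg g hgc).2]
  have hsm : ((L.map orderKey).map f).sum -
      ((oddPart (orderKey w) (L.map orderKey)).map f).sum ∈ smallerSpan (expo w) := by
    refine sum_map_oddPart_mem f _ _ _ fun x hx hxw => ?_
    obtain ⟨y, hy, rfl⟩ := List.mem_map.1 hx
    simp only [hf, hdec y hy]
    refine Submodule.subset_span ⟨expo y, ?_, ?_, rfl⟩
    · rw [degree_expo (hLmem y hy).1, degree_expo rfl, (hLmem y hy).2]
    · exact monoLT_of_orderKey_lt (hLmem y hy).1 rfl (hlt (hLmem y hy).2) (hlt rfl) hxw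
  have hone : ((oddPart (orderKey w) (L.map orderKey)).map f).sum = mono (expo w) := by
    match hm : oddPart (orderKey w) (L.map orderKey), hs with
    | [y], hs =>
      have : y = orderKey w := Nat.eq_of_beq_eq_true hs
      rw [List.map_singleton, List.sum_singleton, this, hf]
      simp only [keyDigits_orderKey (y := w) rfl (hlt rfl)]
  rw [hone] at hsm
  unfold StrictlyInadmissible
  rw [show mono (expo w) = ((L.map orderKey).map f).sum -
    (((L.map orderKey).map f).sum - mono (expo w)) by abel]
  exact Submodule.sub_mem _ (Submodule.mem_sup_left hsum) (Submodule.mem_sup_right hsm)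

/-! ### Tables of hit equations for blocks of two, three and four binary digits -/

/-- Strictly inadmissible monomials with exponents less than `4`, with their relations. -/
def relationsTwo : List (ℕ × List ℕ) :=
  [(0x00021, [0x000011]), (0x00201, [0x000101]), (0x00210, [0x000110]), (0x02001, [0x001001]),
    (0x02010, [0x001010]), (0x02100, [0x001100]), (0x20001, [0x010001]), (0x20010, [0x010010]),
    (0x20100, [0x010100]), (0x21000, [0x011000]), (0x02333, [0x001333]), (0x03233, [0x003133]),
    (0x03323, [0x003313]), (0x03332, [0x003331]), (0x20333, [0x010333]), (0x23033, [0x013033]),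
    (0x23303, [0x013303]), (0x23330, [0x013330]), (0x30233, [0x030133]), (0x30323, [0x030313]),
    (0x30332, [0x030331]), (0x32033, [0x031033]), (0x32303, [0x031303]), (0x32330, [0x031330]),
    (0x33023, [0x033013]), (0x33032, [0x033031]), (0x33203, [0x033103]), (0x33230, [0x033130]),
    (0x33302, [0x033301]), (0x33320, [0x033310]), (0x21233, [0x011233]), (0x21323, [0x011323]),
    (0x21332, [0x011332]), (0x22133, [0x012133]), (0x22313, [0x012313]), (0x22331, [0x012331]),
    (0x23123, [0x013123]), (0x23132, [0x013132]), (0x23213, [0x013213]), (0x23231, [0x013231]),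
    (0x23312, [0x013312]), (0x23321, [0x013321]), (0x32123, [0x031123]), (0x32132, [0x031132]),
    (0x32213, [0x031213]), (0x32231, [0x031231]), (0x32312, [0x031312]), (0x32321, [0x031321]),
    (0x33212, [0x033112]), (0x33221, [0x033121]), (0x21133, [0x011133]), (0x21313, [0x011313]),
    (0x21331, [0x011331]), (0x23113, [0x013113]), (0x23131, [0x013131]), (0x23311, [0x013311]),
    (0x32113, [0x031113]), (0x32131, [0x031131]), (0x32311, [0x031311]), (0x33211, [0x033111]),
    (0x02111, [0x001111]), (0x20111, [0x010111]), (0x21011, [0x011011]), (0x21101, [0x011101]),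
    (0x21110, [0x011110]), (0x02113, [0x001113]), (0x02131, [0x001131]), (0x02311, [0x001311]),
    (0x03211, [0x003111]), (0x20113, [0x010113]), (0x20131, [0x010131]), (0x20311, [0x010311]),
    (0x21013, [0x011013]), (0x21031, [0x011031]), (0x21103, [0x011103]), (0x21130, [0x011130]),
    (0x21301, [0x011301]), (0x21310, [0x011310]), (0x23011, [0x013011]), (0x23101, [0x013101]),
    (0x23110, [0x013110]), (0x30211, [0x030111]), (0x32011, [0x031011]), (0x32101, [0x031101]),
    (0x32110, [0x031110]), (0x21112, [0x011112]), (0x21121, [0x011121]), (0x21211, [0x011211]),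
    (0x22111, [0x012111]), (0x12211, [0x111111, 0x021111]), (0x00213, [0x000113]), (0x00231,
    [0x000131]), (0x00321, [0x000311]), (0x02013, [0x001013]), (0x02031, [0x001031]), (0x02103,
    [0x001103]), (0x02130, [0x001130]), (0x02301, [0x001301]), (0x02310, [0x001310]), (0x03021,
    [0x003011]), (0x03201, [0x003101]), (0x03210, [0x003110]), (0x20013, [0x010013]), (0x20031,
    [0x010031]), (0x20103, [0x010103]), (0x20130, [0x010130]), (0x20301, [0x010301]), (0x20310,
    [0x010310]), (0x21003, [0x011003]), (0x21030, [0x011030]), (0x21300, [0x011300]), (0x23001,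
    [0x013001]), (0x23010, [0x013010]), (0x23100, [0x013100]), (0x30021, [0x030011]), (0x30201,
    [0x030101]), (0x30210, [0x030110]), (0x32001, [0x031001]), (0x32010, [0x031010]), (0x32100,
    [0x031100]), (0x02112, [0x001112]), (0x02121, [0x001121]), (0x02211, [0x001211]), (0x20112,
    [0x010112]), (0x20121, [0x010121]), (0x20211, [0x010211]), (0x21012, [0x011012]), (0x21021,
    [0x011021]), (0x21102, [0x011102]), (0x21120, [0x011120]), (0x21201, [0x011201]), (0x21210,
    [0x011210]), (0x22011, [0x012011]), (0x22101, [0x012101]), (0x22110, [0x012110]), (0x01221,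
    [0x101111, 0x002111]), (0x10221, [0x110111, 0x020111]), (0x12021, [0x111011, 0x021011]),
    (0x12201, [0x111101, 0x021101]), (0x12210, [0x111110, 0x021110])]

/-- Strictly inadmissible monomials with exponents less than `8`, with their relations. -/
def relationsThree : List (ℕ × List ℕ) :=
  [(0x00034, [0x000033, 0x100023]), (0x00304, [0x000303, 0x100203]), (0x00340, [0x000330,
    0x100230]), (0x03004, [0x003003, 0x102003]), (0x03040, [0x003030, 0x102030]), (0x03400,
    [0x003300, 0x102300]), (0x30004, [0x030003, 0x120003]), (0x30040, [0x030030, 0x120030]),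
    (0x30400, [0x030300, 0x120300]), (0x34000, [0x033000, 0x123000]), (0x12677, [0x012577,
    0x122377, 0x041377, 0x014377]), (0x12767, [0x012757, 0x122737, 0x041737, 0x014737]), (0x12776,
    [0x012775, 0x122773, 0x041773, 0x014773]), (0x16277, [0x015277, 0x123277, 0x043177, 0x013477]),
    (0x16367, [0x015367, 0x123367, 0x043357, 0x013567]), (0x16376, [0x015376, 0x123376, 0x043375,
    0x013576]), (0x16637, [0x015637, 0x123637, 0x043537, 0x013657]), (0x16673, [0x015673, 0x123673,
    0x043573, 0x013675]), (0x16727, [0x015727, 0x123727, 0x043717, 0x013747]), (0x16736, [0x015736,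
    0x123736, 0x043735, 0x013756]), (0x16763, [0x015763, 0x123763, 0x043753, 0x013765]), (0x16772,
    [0x015772, 0x123772, 0x043771, 0x013774]), (0x17267, [0x017257, 0x127237, 0x047137, 0x017437]),
    (0x17276, [0x017275, 0x127273, 0x047173, 0x017473]), (0x17627, [0x017527, 0x127327, 0x047317,
    0x017347]), (0x17636, [0x017536, 0x127336, 0x047335, 0x017356]), (0x17663, [0x017563, 0x127363,
    0x047353, 0x017365]), (0x17672, [0x017572, 0x127372, 0x047371, 0x017374]), (0x17726, [0x017725,
    0x127723, 0x047713, 0x017743]), (0x17762, [0x017752, 0x127732, 0x047731, 0x017734]), (0x71267,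
    [0x071257, 0x172237, 0x074137, 0x071437]), (0x71276, [0x071275, 0x172273, 0x074173, 0x071473]),
    (0x71627, [0x071527, 0x172327, 0x074317, 0x071347]), (0x71636, [0x071536, 0x172336, 0x074335,
    0x071356]), (0x71663, [0x071563, 0x172363, 0x074353, 0x071365]), (0x71672, [0x071572, 0x172372,
    0x074371, 0x071374]), (0x71726, [0x071725, 0x172723, 0x074713, 0x071743]), (0x71762, [0x071752,
    0x172732, 0x074731, 0x071734]), (0x77126, [0x077125, 0x177223, 0x077413, 0x077143]), (0x77162,
    [0x077152, 0x177232, 0x077431, 0x077134]), (0x00347, [0x000337, 0x100237]), (0x00374,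
    [0x000373, 0x100273]), (0x00734, [0x000733, 0x100723]), (0x03047, [0x003037, 0x102037]),
    (0x03074, [0x003073, 0x102073]), (0x03407, [0x003307, 0x102307]), (0x03470, [0x003370,
    0x102370]), (0x03704, [0x003703, 0x102703]), (0x03740, [0x003730, 0x102730]), (0x07034,
    [0x007033, 0x107023]), (0x07304, [0x007303, 0x107203]), (0x07340, [0x007330, 0x107230]),
    (0x30047, [0x030037, 0x120037]), (0x30074, [0x030073, 0x120073]), (0x30407, [0x030307,
    0x120307]), (0x30470, [0x030370, 0x120370]), (0x30704, [0x030703, 0x120703]), (0x30740,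
    [0x030730, 0x120730]), (0x34007, [0x033007, 0x123007]), (0x34070, [0x033070, 0x123070]),
    (0x34700, [0x033700, 0x123700]), (0x37004, [0x037003, 0x127003]), (0x37040, [0x037030,
    0x127030]), (0x37400, [0x037300, 0x127300]), (0x70034, [0x070033, 0x170023]), (0x70304,
    [0x070303, 0x170203]), (0x70340, [0x070330, 0x170230]), (0x73004, [0x073003, 0x172003]),
    (0x73040, [0x073030, 0x172030]), (0x73400, [0x073300, 0x172300]), (0x03434, [0x003334,
    0x102334]), (0x01634, [0x101623, 0x001543, 0x001534, 0x102343, 0x102334, 0x004333, 0x102433,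
    0x001453, 0x001435, 0x001354, 0x001345]), (0x03416, [0x105223, 0x203223, 0x003415, 0x003343,
    0x102343]), (0x30434, [0x030334, 0x120334]), (0x10634, [0x110623, 0x010543, 0x010534, 0x120343,
    0x120334, 0x040333, 0x120433, 0x010453, 0x010435, 0x010354, 0x010345]), (0x34034, [0x033034,
    0x123034]), (0x34304, [0x033304, 0x123304]), (0x34340, [0x033340, 0x123340]), (0x16034,
    [0x116023, 0x015043, 0x015034, 0x123043, 0x123034, 0x043033, 0x124033, 0x014053, 0x014035,
    0x013054, 0x013045]), (0x16304, [0x116203, 0x015403, 0x015304, 0x123403, 0x123304, 0x043303,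
    0x124303, 0x014503, 0x014305, 0x013504, 0x013405]), (0x16340, [0x116230, 0x015430, 0x015340,
    0x123430, 0x123340, 0x043330, 0x124330, 0x014530, 0x014350, 0x013540, 0x013450]), (0x30416,
    [0x150223, 0x230223, 0x030415, 0x030343, 0x120343]), (0x34016, [0x152023, 0x232023, 0x034015,
    0x033043, 0x123043]), (0x34106, [0x152203, 0x232203, 0x034105, 0x033403, 0x123403]), (0x34160,
    [0x152230, 0x232230, 0x034150, 0x033430, 0x123430])]

/-- Strictly inadmissible monomials with exponents less than `16`, with their relations. -/
def relationsFour : List (ℕ × List ℕ) :=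
  [(0x3d762, [0x13b762, 0x137b62, 0x257762, 0x1377a2, 0x097752, 0x1a7732, 0x0c7731, 0x097734]),
    (0x3d726, [0x13b726, 0x137b26, 0x257726, 0x13772a, 0x097725, 0x1a7723, 0x0c7713, 0x097743]),
    (0x3d672, [0x13b672, 0x137a72, 0x257672, 0x1376b2, 0x097572, 0x1a7372, 0x0c7371, 0x097374]),
    (0x35e72, [0x035d72, 0x136b72, 0x256772, 0x13a772, 0x236774, 0x1367b2, 0x095772, 0x1a3772,
    0x0c3771, 0x093774, 0x03c771, 0x0357d2, 0x035778]), (0x3d636, [0x13b636, 0x137a36, 0x257636,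
    0x13763a, 0x097536, 0x1a7336, 0x097356, 0x13b366, 0x257366, 0x1373a6, 0x13736a, 0x0c7335]),
    (0x35e36, [0x035d36, 0x136b36, 0x256736, 0x13a736, 0x236756, 0x13673a, 0x095736, 0x1a3736,
    0x093756, 0x133b66, 0x253766, 0x1337a6, 0x13376a, 0x0c3735, 0x03c735, 0x035796, 0x03573c]),
    (0x356b6, [0x235676, 0x133a76, 0x039576, 0x13a376, 0x256376, 0x095376, 0x1a3376, 0x093576,
    0x253676, 0x1336b6, 0x0355b6, 0x1363b6, 0x13367a, 0x0c3375, 0x03c375, 0x13637a, 0x03557a,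
    0x0353d6, 0x03537c]), (0x3d276, [0x13b276, 0x1372b6, 0x257276, 0x13727a, 0x097275, 0x1a7273,
    0x0c7173, 0x097473]), (0x35a76, [0x235676, 0x039675, 0x13a673, 0x256673, 0x136a73, 0x035a75,
    0x133a76, 0x095673, 0x1a3673, 0x093675, 0x253676, 0x1336b6, 0x13367a, 0x0c3573, 0x03c573,
    0x035c73, 0x1366b3, 0x0356d3, 0x0356b5]), (0x31e76, [0x031d76, 0x132b76, 0x252776, 0x1327b6,
    0x234776, 0x13277a, 0x092775, 0x1a2773, 0x0c1773, 0x094773, 0x038775, 0x0317d6, 0x03177c]),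
    (0x13e76, [0x013d76, 0x123b76, 0x243776, 0x1237b6, 0x225776, 0x12377a, 0x083775, 0x029775,
    0x12a773, 0x049773, 0x01c773, 0x0137d6, 0x01377c]), (0x3d663, [0x13b663, 0x137a63, 0x257663,
    0x1376a3, 0x097563, 0x1a7363, 0x097365, 0x13b366, 0x257366, 0x1373a6, 0x13736a, 0x0c7353]),
    (0x35e63, [0x235766, 0x039765, 0x035d63, 0x13a763, 0x136b63, 0x256763, 0x095763, 0x1a3763,
    0x093765, 0x133b66, 0x253766, 0x1337a6, 0x13376a, 0x0c3753, 0x03c753, 0x035b65, 0x1367a3,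
    0x0357c3, 0x0357a5]), (0x3d627, [0x13b627, 0x137a27, 0x257627, 0x13762b, 0x097527, 0x1a7327,
    0x0c7317, 0x097347]), (0x35e27, [0x035d27, 0x136b27, 0x256727, 0x13a727, 0x236747, 0x13672b,
    0x095727, 0x1a3727, 0x0c3717, 0x093747, 0x03c717, 0x035787, 0x03572d]), (0x356a7, [0x235667,
    0x133a67, 0x039567, 0x13a367, 0x256367, 0x095367, 0x1a3367, 0x093567, 0x253667, 0x1336a7,
    0x0355a7, 0x1363a7, 0x13366b, 0x0c3357, 0x03c357, 0x13636b, 0x03556b, 0x0353c7, 0x03536d]),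
    (0x3d267, [0x13b267, 0x1372a7, 0x257267, 0x13726b, 0x097257, 0x1a7237, 0x0c7137, 0x097437]),
    (0x35a67, [0x235667, 0x039657, 0x13a637, 0x256637, 0x136a37, 0x035a57, 0x133a67, 0x095637,
    0x1a3637, 0x093657, 0x253667, 0x1336a7, 0x13366b, 0x0c3537, 0x03c537, 0x035c37, 0x13663b,
    0x03565b, 0x03563d]), (0x352e7, [0x0352d7, 0x1362b7, 0x256277, 0x13a277, 0x236477, 0x13627b,
    0x095277, 0x1a3277, 0x0c3177, 0x093477, 0x03c177, 0x035877, 0x03527d]), (0x31e67, [0x031d67,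
    0x132b67, 0x252767, 0x1327a7, 0x234767, 0x13276b, 0x092757, 0x1a2737, 0x0c1737, 0x094737,
    0x038757, 0x0317c7, 0x03176d]), (0x316e7, [0x0316d7, 0x1326b7, 0x252677, 0x132a77, 0x234677,
    0x13267b, 0x092577, 0x1a2377, 0x0c1377, 0x094377, 0x038577, 0x031c77, 0x03167d]), (0x13e67,
    [0x013d67, 0x123b67, 0x243767, 0x1237a7, 0x225767, 0x12376b, 0x083757, 0x029757, 0x12a737,
    0x049737, 0x01c737, 0x0137c7, 0x01376d]), (0x136e7, [0x0136d7, 0x1236b7, 0x243677, 0x123a77,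
    0x225677, 0x12367b, 0x083577, 0x029577, 0x12a377, 0x049377, 0x01c377, 0x013c77, 0x01367d]),
    (0x35968, [0x153768, 0x233768, 0x033b58, 0x123b58, 0x033798, 0x123798]), (0x351e8, [0x2338a3,
    0x3334a3, 0x1534e3, 0x2334e3, 0x1352e5, 0x1351e6, 0x0551e5, 0x1361e5, 0x2341e5, 0x0338d3,
    0x1238d3, 0x1631e5, 0x2431e5, 0x1231e9]), (0x3592c, [0x239546, 0x335546, 0x23392a, 0x15392a,
    0x153786, 0x233786, 0x033b85, 0x123b85, 0x033789, 0x123789]), (0x3518e, [0x23383a, 0x33343a,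
    0x13345e, 0x23343e, 0x15523e, 0x13516e, 0x05515e, 0x13615e, 0x23415e, 0x03383d, 0x12383d,
    0x16315e, 0x24315e, 0x12319e]), (0xf3418, [0x1f3218, 0x1f3128, 0x0f5118, 0x1f6116, 0x2f4116,
    0x1f211a]), (0x7b418, [0x25e116, 0x17e116, 0x17b218, 0x07d118, 0x17b128]), (0x73c18, [0x2b4345,
    0x374345, 0x256385, 0x176385, 0x253685, 0x173685, 0x075585, 0x173586, 0x253586, 0x2b4516,
    0x374516, 0x256916, 0x176916, 0x178329, 0x078519, 0x256619, 0x176619, 0x173a18, 0x075918,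
    0x173928, 0x173829, 0x075819, 0x17381a, 0x17291a, 0x172389]), (0x73858, [0x2b3445, 0x373445,
    0x2b4435, 0x374435, 0x176853, 0x276833, 0x173883, 0x275843, 0x079833, 0x173838, 0x275834,
    0x0b5833, 0x265853, 0x1a5833, 0x095835, 0x255836, 0x2b4156, 0x374156, 0x256196, 0x176196,
    0x178239, 0x078159, 0x256169, 0x176169, 0x173298, 0x075198, 0x1731a8, 0x173289, 0x075189,
    0x17318a, 0x172839, 0x17219a]), (0x3f418, [0x13f218, 0x13f128, 0x05f118, 0x16f116, 0x24f116,
    0x12f11a]), (0x37c18, [0x23752a, 0x337526, 0x237926, 0x15b526, 0x23b328, 0x15b328, 0x23b616,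
    0x337616, 0x157a16, 0x15761a, 0x13d346, 0x13b546, 0x23b346, 0x13b348, 0x237548, 0x237485,
    0x03b385, 0x23c345, 0x03b349, 0x237449, 0x235c16, 0x23561c, 0x12b385, 0x12b349, 0x03791a,
    0x12791a]), (0x37858, [0x15d236, 0x23b238, 0x23b436, 0x23b256, 0x237458, 0x237485, 0x337445,
    0x03b835, 0x23c435, 0x03b439, 0x1571a6, 0x2371a6, 0x03b196, 0x23c156, 0x13916a, 0x23716a,
    0x03b15a, 0x2351c6, 0x13716c, 0x23516c, 0x13718a, 0x12b835, 0x12b439, 0x12b196, 0x12b15a]),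
    (0x35e18, [0x153a83, 0x333a43, 0x133e45, 0x233e43, 0x155e23, 0x133e18, 0x153e16, 0x055e15,
    0x136e15, 0x234e15, 0x165e13, 0x245e13, 0x129e13, 0x033d83, 0x123d83]), (0x35878, [0x153678,
    0x233678, 0x033978, 0x123978, 0x0335b8, 0x1235b8]), (0x3583c, [0x239456, 0x335456, 0x23383a,
    0x15383a, 0x153876, 0x233876, 0x153678, 0x233678, 0x033978, 0x123978, 0x0338b5, 0x1238b5,
    0x033879, 0x123879, 0x0335b8, 0x1235b8]), (0x3581e, [0x15338a, 0x33334a, 0x15334e, 0x23334e,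
    0x13561e, 0x13552e, 0x05551e, 0x13651e, 0x23451e, 0x16351e, 0x24351e, 0x12391e, 0x03338d,
    0x12338d]), (0x77881, [0x2b7441, 0x377441, 0x2b7414, 0x377414, 0x2b7144, 0x377144, 0x17b821,
    0x17b812, 0x07d811, 0x17e611, 0x25e611, 0x17b281, 0x17b182, 0x07d181, 0x17e161, 0x25e161,
    0x17b218, 0x17b128, 0x07d118, 0x17e116, 0x25e116]), (0xf3481, [0x1f3281, 0x1f3182, 0x0f5181,
    0x1f6161, 0x2f4161, 0x1f21a1]), (0x7b481, [0x25e161, 0x17e161, 0x17b281, 0x07d181, 0x17b182]),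
    (0x73c81, [0x2b4741, 0x374741, 0x2b4714, 0x374714, 0x178b21, 0x178b12, 0x078d11, 0x176e11,
    0x256e11, 0x256781, 0x176781, 0x256718, 0x176718, 0x173a81, 0x075981, 0x173982, 0x173a18,
    0x075918, 0x173928, 0x172b81, 0x172b18]), (0x738c1, [0x2b4471, 0x374471, 0x2b4174, 0x374174,
    0x1782b1, 0x1781b2, 0x0781d1, 0x1761e1, 0x2561e1, 0x256871, 0x176871, 0x256178, 0x176178,
    0x1738a1, 0x075891, 0x173892, 0x173298, 0x075198, 0x1731a8, 0x1728b1, 0x1721b8]), (0x73849,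
    [0x2b4417, 0x374417, 0x2b4147, 0x374147, 0x17821b, 0x17812b, 0x07811d, 0x17611e, 0x25611e,
    0x256817, 0x176817, 0x256187, 0x176187, 0x173829, 0x075819, 0x17381a, 0x173289, 0x075189,
    0x17318a, 0x17281b, 0x17218b]), (0x3f481, [0x13f281, 0x13f182, 0x05f181, 0x16f161, 0x24f161,
    0x12f1a1]), (0x37c81, [0x15d722, 0x23b922, 0x23b742, 0x23b724, 0x237944, 0x237c41, 0x03bb41,
    0x12bb41, 0x237c14, 0x03bb14, 0x12bb14, 0x23c741, 0x03b781, 0x12b781, 0x23c714, 0x03b718,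
    0x12b718]), (0x378c1, [0x15d272, 0x23b292, 0x23b472, 0x23b274, 0x237494, 0x2374c1, 0x03b4b1,
    0x23c471, 0x03b871, 0x12b871, 0x12b4b1, 0x2371c4, 0x03b1b4, 0x12b1b4, 0x23c174, 0x03b178,
    0x12b178]), (0x37849, [0x15d227, 0x23b229, 0x23b427, 0x23b247, 0x237449, 0x23741c, 0x03b41b,
    0x23c417, 0x03b817, 0x12b817, 0x12b41b, 0x23714c, 0x03b14b, 0x23c147, 0x03b187, 0x12b187,
    0x12b14b]), (0x33cc1, [0x23ab21, 0x33a721, 0x23ab12, 0x33a712, 0x15d272, 0x23b292, 0x23b472,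
    0x23b274, 0x237854, 0x337454, 0x15b436, 0x23b436, 0x15b256, 0x23b256, 0x23b238, 0x15b238,
    0x153aa1, 0x233aa1, 0x15ba21, 0x23ba21, 0x237c41, 0x157a61, 0x237a61, 0x235c61, 0x15ba12,
    0x23ba12, 0x237c14, 0x157a16, 0x237a16, 0x153a1a, 0x233a1a, 0x235c16, 0x23d641, 0x15b382,
    0x23b382, 0x03d581, 0x23e541, 0x13e921, 0x23e721, 0x13e741, 0x23561c, 0x13761c, 0x23761a,
    0x13961a, 0x1393a4, 0x1375a4, 0x23b364, 0x337364, 0x239564, 0x237584, 0x137964, 0x139962,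
    0x237962, 0x137982, 0x23d344, 0x13d346, 0x13b546, 0x23b346, 0x23b328, 0x23b526, 0x15b526,
    0x15b328, 0x257348, 0x15e712, 0x23e712, 0x23e514, 0x23d614, 0x03d518, 0x197328, 0x257528,
    0x13b528, 0x137928, 0x237548, 0x157368, 0x137388, 0x1351aa, 0x2331aa, 0x1331ca, 0x2351c6,
    0x1571a6, 0x2371a6, 0x13716c, 0x23716a, 0x13916a, 0x23516c, 0x1331ac, 0x03db21, 0x03db12,
    0x15a3a1, 0x23a3a1, 0x23c561, 0x03b961, 0x03b916, 0x23c516, 0x03b51a, 0x25741a, 0x19721a,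
    0x25721c, 0x05b419, 0x16b219, 0x05b11c, 0x16b11a, 0x06d119, 0x15b229, 0x05d129, 0x15b12a,
    0x13718a, 0x23714c, 0x13b14a, 0x13e129, 0x03d149, 0x13b249, 0x23b445, 0x03b835, 0x23c435,
    0x03b385, 0x23c345, 0x03b439, 0x03b349, 0x03b196, 0x23c156, 0x03b15a, 0x13a3c1, 0x1373c4,
    0x1393c2, 0x1375c2, 0x0593c1, 0x1693a1, 0x1675a1, 0x0575c1, 0x2356c1, 0x1376c1, 0x16e117,
    0x24e117, 0x12e11b, 0x12db21, 0x12db12, 0x12b961, 0x12b916, 0x2374c1, 0x03b4b1, 0x23c471,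
    0x03b871, 0x12b871, 0x12b835, 0x12b51a, 0x12b4b1, 0x12b439, 0x1873a1, 0x2473c1, 0x12b3c1,
    0x12b385, 0x12b349, 0x2371c4, 0x03b1b4, 0x12b1b4, 0x12b196, 0x23c174, 0x03b178, 0x12b178,
    0x12b15a, 0x0379a1, 0x1279a1, 0x037398, 0x127398]), (0x71ac1, [0x2b4561, 0x374561, 0x1729a1,
    0x0719c1, 0x271b44, 0x371744, 0x278471, 0x374471, 0x274871, 0x278174, 0x374174, 0x274178,
    0x2d4316, 0x1b8316, 0x278516, 0x17831a, 0x27431c, 0x1b431a, 0x2b4345, 0x374345, 0x178329,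
    0x27451a, 0x078519, 0x2b4417, 0x374417, 0x178617, 0x258617, 0x2b4453, 0x374453, 0x2b4165,
    0x374165, 0x178293, 0x078195, 0x178176, 0x258176, 0x2b4741, 0x374741, 0x2b4714, 0x374714,
    0x178b21, 0x178b12, 0x078d11, 0x176e11, 0x256e11, 0x256961, 0x176961, 0x176781, 0x256781,
    0x256916, 0x176916, 0x176718, 0x256718, 0x256871, 0x176871, 0x2b4354, 0x374354, 0x178392,
    0x078591, 0x176691, 0x256691, 0x2744b1, 0x1782b1, 0x2741b4, 0x1781b2, 0x0781d1, 0x1761e1,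
    0x2561e1, 0x2b4147, 0x374147, 0x256187, 0x176187, 0x176169, 0x256169, 0x17821b, 0x17812b,
    0x07811d, 0x17611e, 0x25611e, 0x178833, 0x268535, 0x178635, 0x098535, 0x178338, 0x178536,
    0x078555, 0x178365, 0x294365, 0x192369, 0x292565, 0x252965, 0x1923a5, 0x2523c5, 0x271784,
    0x172b81, 0x171b82, 0x071d81, 0x171e61, 0x251e61, 0x271748, 0x172b18, 0x171b28, 0x071d18,
    0x171e16, 0x251e16, 0x17291a, 0x07191c, 0x1728b1, 0x0718d1, 0x172893, 0x071895, 0x17281b,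
    0x07181d, 0x172398, 0x071598, 0x172389, 0x071589, 0x1721b8, 0x0711d8, 0x1721a9, 0x0711c9,
    0x17218b, 0x07118d]), (0x35e81, [0x153a38, 0x333a34, 0x153e34, 0x233e34, 0x135e61, 0x135e52,
    0x055e51, 0x136e51, 0x234e51, 0x163e51, 0x243e51, 0x123e91, 0x033d38, 0x123d38]), (0x358e1,
    [0x1533a8, 0x3333a4, 0x1335e4, 0x2333e4, 0x1553e2, 0x1356e1, 0x0555e1, 0x1365e1, 0x2345e1,
    0x1653e1, 0x2453e1, 0x1293e1, 0x0333d8, 0x1233d8]), (0x35869, [0x239447, 0x335447, 0x233867,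
    0x153867, 0x033897, 0x123897, 0x03385b, 0x12385b]), (0x3582d, [0x239447, 0x335447, 0x23382b,
    0x15382b, 0x153687, 0x233687, 0x033987, 0x123987, 0x03358b, 0x12358b]), (0x17ac1, [0x293636,
    0x353636, 0x239636, 0x335636, 0x233b28, 0x333728, 0x23338a, 0x333386, 0x23328b, 0x333287,
    0x23356a, 0x333566, 0x233966, 0x2333c6, 0x2333a8, 0x1553a6, 0x133c56, 0x133c38, 0x13385a,
    0x13383c, 0x15b292, 0x23b292, 0x15b274, 0x23b274, 0x15b463, 0x15b265, 0x23b463, 0x23b265,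
    0x04731f, 0x03831f, 0x03741f, 0x03732f, 0x15732c, 0x23732c, 0x15734a, 0x23734a, 0x152b29,
    0x232b29, 0x154b27, 0x234b27, 0x15372c, 0x23372c, 0x15374a, 0x23374a, 0x1359a2, 0x2339a2,
    0x1339a4, 0x1537a4, 0x2337a4, 0x2335c4, 0x2332c7, 0x2332a9, 0x1552a7, 0x2334a7, 0x1531aa,
    0x2331aa, 0x2351c6, 0x1571a6, 0x2371a6, 0x23516c, 0x13716c, 0x23716a, 0x13916a, 0x03b1a5,
    0x23c165, 0x03b169, 0x13365c, 0x13429b, 0x23229b, 0x13249b, 0x23345c, 0x03349b, 0x1523a9,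
    0x2323a9, 0x0333c9, 0x1341ab, 0x2321ab, 0x1321ad, 0x13229d, 0x03419d, 0x1512ab, 0x2312ab,
    0x03149d, 0x13219e, 0x13129e, 0x05119e, 0x1311ae, 0x0311cd, 0x1321cb, 0x0331cb, 0x2314c7,
    0x1318a7, 0x1316c7, 0x2316a7, 0x131c67, 0x231a67, 0x152a39, 0x232a39, 0x131a69, 0x031c59,
    0x1316a9, 0x0315c9, 0x234596, 0x334556, 0x231c56, 0x2315c6, 0x138936, 0x254936, 0x192936,
    0x131a96, 0x1319a6, 0x051996, 0x252956, 0x23455a, 0x034599, 0x152697, 0x232697, 0x15293a,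
    0x13394a, 0x23392a, 0x13592a, 0x152967, 0x232967, 0x034959, 0x03395a, 0x133a3a, 0x13392c,
    0x03393c, 0x13293c, 0x23255c, 0x03196b, 0x23156c, 0x03159c, 0x03169b, 0x01d21d, 0x11d11d,
    0x01d11e, 0x152787, 0x232787, 0x132d47, 0x131a87, 0x031b87, 0x241787, 0x03178b, 0x23174c,
    0x033c39, 0x033b49, 0x132b49, 0x131b4a, 0x031d49, 0x131e29, 0x151e27, 0x051d47, 0x051b49,
    0x161b29, 0x161d27, 0x181b27, 0x281747, 0x157386, 0x237386, 0x239546, 0x13b483, 0x23b283,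
    0x13d283, 0x13b285, 0x25714a, 0x19712a, 0x25712c, 0x12e11b, 0x24e117, 0x16e117, 0x05b11c,
    0x16b11a, 0x15b21a, 0x05d11a, 0x05e119, 0x05d129, 0x16b129, 0x05b149, 0x03b385, 0x23c345,
    0x03b349, 0x15b247, 0x13b447, 0x13d247, 0x13d229, 0x13e219, 0x03d419, 0x13b41a, 0x135a1a,
    0x233a1a, 0x133c1a, 0x235c16, 0x139a16, 0x139926, 0x059916, 0x13a916, 0x23c516, 0x03b31c,
    0x13a51a, 0x13a31c, 0x25631c, 0x19631a, 0x25651a, 0x23c453, 0x03b853, 0x03b493, 0x23b454,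
    0x15b328, 0x23b328, 0x237548, 0x12b853, 0x22d453, 0x12b493, 0x22b455, 0x22d561, 0x12b961,
    0x24b561, 0x12b5a1, 0x2176c1, 0x01b5c1, 0x2175c2, 0x23d344, 0x13b564, 0x23b364, 0x15d362,
    0x15b382, 0x16b561, 0x05b581, 0x05d561, 0x15b661, 0x13d472, 0x03b358, 0x23c354, 0x257861,
    0x1378a1, 0x2374c1, 0x03b394, 0x13b4a1, 0x13b492, 0x03d491, 0x13e471, 0x05d471, 0x05b491,
    0x16b471, 0x24b471, 0x12b871, 0x22d471, 0x12b4b1, 0x2174e1, 0x01b4d1, 0x2174d2, 0x217469,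
    0x01b459, 0x21745a, 0x11b21e, 0x21741e, 0x21752c, 0x12b31c, 0x01b51c, 0x01d31c, 0x11e31a,
    0x11b61a, 0x01d51a, 0x11d32a, 0x21754a, 0x11b34a, 0x21734c, 0x01d12d, 0x21742d, 0x11b22d,
    0x21724d, 0x2371c4, 0x03b1b4, 0x23c174, 0x03b178, 0x12b178, 0x22d174, 0x12b1b4, 0x2172d4,
    0x01b1d4, 0x2171e4, 0x11b12e, 0x21714e, 0x153aa1, 0x233aa1, 0x235c61, 0x139a61, 0x259661,
    0x197661, 0x22d516, 0x12b916, 0x247916, 0x167916, 0x137748, 0x139728, 0x157728, 0x15e361,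
    0x13e381, 0x257681, 0x13b681, 0x03d581, 0x23d542, 0x13d922, 0x15d722, 0x13b942, 0x23b742,
    0x13b744, 0x13b924, 0x057918, 0x137a18, 0x237c14, 0x13ba14, 0x23d614, 0x03d518, 0x23e514,
    0x13e714, 0x05d714, 0x05b914, 0x16b912, 0x16d712, 0x24d712, 0x12db12, 0x22d714, 0x01d718,
    0x21e714, 0x11eb12, 0x01dd12, 0x11bd22, 0x217d24, 0x11b728, 0x117b28, 0x317744, 0x11bb42,
    0x137a81, 0x237c41, 0x03bb41, 0x23c741, 0x03b781, 0x12b781, 0x11b782, 0x01d781, 0x21e741,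
    0x01db41, 0x12bb41, 0x227d41, 0x117b82, 0x017d81, 0x117e61, 0x215e61, 0x11be12, 0x217e14,
    0x117e16, 0x215e16, 0x133ac1, 0x0539c1, 0x2167c1, 0x2157c2, 0x0197c1, 0x1639a1, 0x1297a1,
    0x2457a1, 0x1657a1, 0x1357c2, 0x0557c1, 0x1396a1, 0x2356c1, 0x0359c1, 0x1367c1, 0x1387a1,
    0x2547a1, 0x1927a1, 0x2527c1, 0x054b91, 0x162b91, 0x051bc1, 0x161ba1, 0x061d91, 0x152b92,
    0x051d92, 0x151ba2, 0x133a58, 0x23552c, 0x13691a, 0x03591c, 0x133a1c, 0x233c54, 0x033b94,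
    0x132b94, 0x232d54, 0x131e92, 0x231e54, 0x031d58, 0x231d64, 0x131ba4, 0x217658, 0x217568,
    0x01b558, 0x12b358, 0x01d358, 0x21e354, 0x21d364, 0x01d394, 0x12b394, 0x217685, 0x217586,
    0x01b585, 0x12b385, 0x22d345, 0x12b349, 0x12b169, 0x22d165, 0x12b1a5, 0x143ba1, 0x123da1,
    0x123bc1, 0x12395a, 0x12393c, 0x033b1c, 0x034b1b, 0x234c17, 0x038b17, 0x128b17, 0x224d17,
    0x142b1b, 0x122d1b, 0x122b1d, 0x24174b, 0x12178b, 0x22174d, 0x121b4b, 0x2317c4, 0x1317a8,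
    0x161796, 0x051798, 0x033897, 0x132798, 0x033798, 0x033789, 0x032997, 0x227594, 0x017994,
    0x227549, 0x017949, 0x12791a, 0x01791c, 0x017598, 0x017589, 0x2271c5, 0x0171c9, 0x015da1,
    0x123c39, 0x015c39, 0x015bc1, 0x123b94, 0x015b94, 0x123b49, 0x015b49, 0x123b1c, 0x015b1c,
    0x01595a, 0x01593c, 0x123897, 0x015897, 0x123798, 0x015798, 0x123789, 0x015789, 0x12349b,
    0x01549b, 0x1233c9, 0x0153c9, 0x1231cb, 0x0151cb, 0x014b1d, 0x122997, 0x014997, 0x223d54,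
    0x013d58, 0x013d49, 0x013d1c, 0x013c59, 0x0135c9, 0x01349d, 0x0131cd, 0x161e71, 0x241e71,
    0x121eb1, 0x011ed1, 0x241796, 0x121b96, 0x221d56, 0x011d5a, 0x011d4b, 0x12179a, 0x01179c,
    0x12169b, 0x01169d, 0x12196b, 0x22156d, 0x0115ad, 0x16117e, 0x24117e, 0x1211be, 0x0111de]),
    (0x78358, [0x263558, 0x093558, 0x173658, 0x173568, 0x075558, 0x176358, 0x256358]), (0x34f18,
    [0x132f18, 0x131f28, 0x051f18, 0x161f16, 0x241f16, 0x121f1a]), (0x34798, [0x233b82, 0x333782,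
    0x1539a2, 0x2339a2, 0x2337c2, 0x1537c2, 0x2337a4, 0x1537a4, 0x162b91, 0x054b91, 0x134ba1,
    0x132da1, 0x052d91, 0x132d92, 0x134b92, 0x131ea1, 0x051e91, 0x131e92, 0x033bc1, 0x123bc1,
    0x033b94, 0x123b94, 0x033798, 0x123798, 0x161e71, 0x241e71, 0x121eb1]), (0x3c358, [0x157368,
    0x237368, 0x03b358, 0x12b358, 0x037398, 0x127398]), (0x34b58, [0x152a39, 0x232a39, 0x234758,
    0x158736, 0x238736, 0x234785, 0x334745, 0x234c35, 0x038b35, 0x234956, 0x128b35, 0x038739,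
    0x128739]), (0x343d8, [0x2323b8, 0x1523b8, 0x1522b9, 0x2322b9, 0x234875, 0x334475, 0x15239a,
    0x23239a, 0x234596, 0x152976, 0x232976, 0x234578, 0x238376, 0x156576, 0x156378, 0x138396,
    0x136596, 0x136398, 0x0383b5, 0x2343c5, 0x151a76, 0x231a76, 0x1283b5, 0x038379, 0x128379,
    0x0319b6, 0x1219b6, 0x03197a, 0x12197a]), (0x3c31c, [0x23a31a, 0x15a31a, 0x157a16, 0x237a16,
    0x157926, 0x237926, 0x23c516, 0x03b916, 0x12b916, 0x03791a, 0x12791a]), (0x34978, [0x152778,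
    0x232778, 0x031b78, 0x121b78, 0x0317b8, 0x1217b8]), (0x341f8, [0x1321f8, 0x1312f8, 0x0511f8,
    0x1611f6, 0x2411f6, 0x1211fa]), (0x3c13c, [0x23a13a, 0x15a13a, 0x157296, 0x237296, 0x1571a6,
    0x2371a6, 0x23c156, 0x03b196, 0x12b196, 0x03719a, 0x12719a]), (0x3493c, [0x238556, 0x334556,
    0x152796, 0x232796, 0x13295a, 0x23293a, 0x13493a, 0x13293c, 0x1517a6, 0x2317a6, 0x031b96,
    0x121b96, 0x03179a, 0x12179a]), (0x3c11e, [0x13a11e, 0x13921e, 0x05911e, 0x13912e, 0x16711e,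
    0x24711e, 0x12b11e]), (0x3491e, [0x13291e, 0x131a1e, 0x05191e, 0x13192e, 0x16171e, 0x24171e,
    0x121b1e]), (0x3419e, [0x13219e, 0x13129e, 0x05119e, 0x1311ae, 0x16117e, 0x24117e, 0x1211be]),
    (0x1e358, [0x11e356, 0x02d555, 0x11d555, 0x11e365, 0x21e345, 0x11e635, 0x21e435, 0x11e239,
    0x11d663, 0x11d366, 0x11b656]), (0x16b58, [0x21a745, 0x316745, 0x214e35, 0x116e35, 0x025d55,
    0x115d55, 0x116b65, 0x214b65, 0x116b56, 0x214b56, 0x115e36, 0x113e65, 0x113d66]), (0x163d8,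
    [0x025599, 0x115599, 0x21a475, 0x316475, 0x116679, 0x214679, 0x1168b3, 0x2146d3, 0x1166d3,
    0x0255d5, 0x1155d5, 0x1163e5, 0x2143e5, 0x1163d6, 0x2143d6, 0x1163a9, 0x11639a, 0x1162b9,
    0x1156e3, 0x1136d6, 0x1135e6]), (0x78349, [0x178329, 0x256619, 0x176619, 0x078519, 0x17831a]),
    (0x34f81, [0x132f81, 0x131f82, 0x051f81, 0x161f61, 0x241f61, 0x121fa1]), (0x34789, [0x233b28,
    0x333728, 0x15392a, 0x23392a, 0x15374a, 0x23374a, 0x23372c, 0x15372c, 0x152b29, 0x232b29,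
    0x152b1a, 0x232b1a, 0x034d19, 0x132e19, 0x131e29, 0x051e19, 0x131e1a, 0x033b49, 0x123b49,
    0x033b1c, 0x123b1c, 0x033789, 0x123789, 0x161e17, 0x241e17, 0x121e1b]), (0x3c3c1, [0x23b382,
    0x337382, 0x1573c2, 0x2373c2, 0x1573a4, 0x2373a4, 0x03b3c1, 0x12b3c1, 0x03b394, 0x12b394,
    0x037398, 0x127398]), (0x3c349, [0x23b346, 0x337346, 0x23734a, 0x157386, 0x03b349, 0x12b349]),
    (0x34bc1, [0x152ab1, 0x232ab1, 0x158772, 0x238772, 0x234974, 0x234794, 0x234c71, 0x038b71,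
    0x128b71, 0x2347c1, 0x0387b1, 0x1287b1]), (0x34b49, [0x232b29, 0x152b29, 0x152b1a, 0x232b1a,
    0x034d19, 0x132e19, 0x131e29, 0x051e19, 0x131e1a, 0x161e17, 0x241e17, 0x121e1b]), (0x343c9,
    [0x2323a9, 0x1523a9, 0x234497, 0x334457, 0x23445b, 0x23229b, 0x15229b, 0x138369, 0x138567,
    0x238367, 0x234569, 0x152967, 0x232967, 0x138387, 0x234587, 0x13438b, 0x23238b, 0x13258b,
    0x238457, 0x03835b, 0x23435c, 0x151a67, 0x231a67, 0x13238d, 0x038397, 0x128397, 0x12835b,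
    0x0319a7, 0x1219a7, 0x03196b, 0x12196b]), (0x3438d, [0x233867, 0x333467, 0x23346b, 0x23328b,
    0x333287, 0x2332c7, 0x2332a9, 0x1552a7, 0x13483b, 0x23283b, 0x13283d, 0x13463d, 0x13436d,
    0x03455d, 0x13453e, 0x05453d, 0x16433d, 0x05435d, 0x15235e, 0x13183e, 0x15163e, 0x05155e,
    0x15136e, 0x13138e, 0x24433d, 0x12833d, 0x13285b, 0x03385b, 0x12385b, 0x0331cb, 0x1231cb,
    0x16135e, 0x24135e, 0x12139e]), (0x3c1e1, [0x13a1e1, 0x1392e1, 0x0591e1, 0x1391e2, 0x1671e1,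
    0x2471e1, 0x12b1e1]), (0x349e1, [0x1329e1, 0x131ae1, 0x0519e1, 0x1319e2, 0x1617e1, 0x2417e1,
    0x121be1]), (0x34969, [0x152769, 0x232769, 0x15176a, 0x23176a, 0x031b69, 0x121b69, 0x0317a9,
    0x1217a9]), (0x341e9, [0x1321e9, 0x1312e9, 0x0511e9, 0x1311ea, 0x1611e7, 0x2411e7, 0x1211eb]),
    (0x3c12d, [0x23b247, 0x337247, 0x23724b, 0x23a12b, 0x15a12b, 0x157287, 0x03b14b, 0x12b14b]),
    (0x3492d, [0x238547, 0x334547, 0x23292b, 0x15292b, 0x152787, 0x232787, 0x031b87, 0x121b87,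
    0x03178b, 0x12178b]), (0x3418f, [0x13218f, 0x13128f, 0x05118f, 0x16116f, 0x24116f, 0x1211af]),
    (0x1e3c1, [0x02d591, 0x11d591, 0x11e3a1, 0x11e392, 0x11e671, 0x21e471, 0x11e2b1]), (0x1e349,
    [0x02d519, 0x11d519, 0x11e329, 0x11e31a, 0x11e617, 0x21e417, 0x11e21b]), (0x16bc1, [0x025d91,
    0x115d91, 0x116ba1, 0x116e71, 0x214e71, 0x116b92]), (0x16b49, [0x025d19, 0x115d19, 0x116b29,
    0x116e17, 0x214e17, 0x116b1a]), (0x163c9, [0x025599, 0x115599, 0x1163a9, 0x21a457, 0x316457,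
    0x116697, 0x214697, 0x11683b, 0x21463d, 0x11663d, 0x02555d, 0x11555d, 0x11636d, 0x21436d,
    0x11635e, 0x21435e, 0x11639a, 0x11629b, 0x11536e, 0x11366d, 0x11365e]), (0x348f1, [0x1328f1,
    0x1318f2, 0x0518f1, 0x1616f1, 0x2416f1, 0x121af1]), (0x34879, [0x238457, 0x334457, 0x232877,
    0x152877, 0x0318b7, 0x1218b7, 0x03187b, 0x12187b]), (0x3483d, [0x238457, 0x334457, 0x23283b,
    0x15283b, 0x152697, 0x232697, 0x1516a7, 0x2316a7, 0x031a97, 0x121a97, 0x03169b, 0x12169b]),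
    (0x3481f, [0x13281f, 0x13182f, 0x05181f, 0x16161f, 0x24161f, 0x121a1f])]

theorem relationsTwo_check : relationsTwo.all (checkRelation 2) = true := by decide +kernel

theorem relationsThree_check : relationsThree.all (checkRelation 3) = true := by decide +kernel

theorem relationsFour_check : relationsFour.all (checkRelation 4) = true := by decide +kernel

/-! ### The monomials without a strictly inadmissible segment -/

/-- Whether the monomial whose exponents are reduced modulo `m` occurs in a list of relations. -/
def hasSegment (rels : List (ℕ × List ℕ)) (m : ℕ) : List ℕ → Bool
  | [a, b, c, d, e] => withValue (Nat.add (Nat.mul 65536 (Nat.mod a m)) (Nat.add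
      (Nat.mul 4096 (Nat.mod b m)) (Nat.add (Nat.mul 256 (Nat.mod c m)) (Nat.add
      (Nat.mul 16 (Nat.mod d m)) (Nat.mod e m))))) fun k => rels.any fun r => Nat.beq r.1 k
  | _ => false

/-- Whether the lowest digits form one of the listed strictly inadmissible monomials. -/
def hasRelation (l : List ℕ) : Bool :=
  hasSegment relationsTwo 4 l || (hasSegment relationsThree 8 l || hasSegment relationsFour 16 l)

/-- The lists of `n` binary digits with sum `k`. -/
def binaryLists : ℕ → ℕ → List (List ℕ)
  | 0, 0 => [[]]
  | 0, _ + 1 => []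
  | n + 1, 0 => (binaryLists n 0).map (0 :: ·)
  | n + 1, k + 1 => (binaryLists n k).map (1 :: ·) ++ (binaryLists n (k + 1)).map (0 :: ·)

/-- Application to the evaluated list of the `xᵢ + 2 yᵢ`. -/
def withPrepended {α : Type} : List ℕ → List ℕ → (List ℕ → α) → α
  | a :: x, b :: y, f => withValue (Nat.add a (Nat.mul 2 b)) fun c =>
      withPrepended x y fun l => f (c :: l)
  | _, _, f => f []

/-- The monomials of a given weight vector in which no segment is known to be strictly
inadmissible. -/
def survivors : List ℕ → List (List ℕ)
  | [] => [[0, 0, 0, 0, 0]]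
  | k :: ws => (survivors ws).flatMap fun y => (binaryLists 5 k).flatMap fun x =>
      withPrepended x y fun l => bif hasRelation l then [] else [l]

/-- Whether a list has an entry zero or is one of the given exponent vectors. -/
def hasZeroOrMem (B : List (Fin 5 → ℕ)) (l : List ℕ) : Bool :=
  l.any (Nat.beq 0) || B.any fun f => decide (l = [f 0, f 1, f 2, f 3, f 4])

/-- Survivors with a zero exponent are tolerated, since only positive monomials outside the list
have to be proved inadmissible. -/
theorem survivors_check_one :
    (survivors [1, 1, 1, 1, 1]).all (hasZeroOrMem exponents1) = true := by decide +kernel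

theorem survivors_check_two :
    (survivors [3, 2, 2, 2]).all (hasZeroOrMem exponents2) = true := by decide +kernel

theorem survivors_check_three :
    (survivors [3, 4, 3, 1]).all (hasZeroOrMem exponents3) = true := by decide +kernel

theorem expo_eq_add {l : List ℕ} (m : ℕ) :
    expo l = expo (l.map (· % m)) + m • expo (l.map (· / m)) := by
  ext i
  simp only [expo_apply, Finsupp.add_apply, Finsupp.smul_apply, smul_eq_mul]
  rcases lt_or_ge i.1 l.length with hi | hi
  · rw [List.getD_eq_getElem _ _ hi, List.getD_eq_getElem _ _ (by simpa using hi),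
      List.getD_eq_getElem _ _ (by simpa using hi), List.getElem_map, List.getElem_map,
      Nat.mod_add_div]
  · rw [List.getD_eq_default _ _ hi, List.getD_eq_default _ _ (by simpa using hi),
      List.getD_eq_default _ _ (by simpa using hi), mul_zero, add_zero]

/-- Reduction modulo 2^d leaves the lowest d digits, which form a listed monomial; the other digits
are appended above it. The bound d ≤ 4 keeps the reduced exponents below 16, so that the hexadecimal
code determines them. -/
theorem strictlyInadmissible_of_hasSegment {rels : List (ℕ × List ℕ)} {d : ℕ} (hd : d ≤ 4)
    (hr : rels.all (checkRelation d) = true) {l : List ℕ}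
    (h : hasSegment rels (2 ^ d) l = true) : StrictlyInadmissible d (expo l) := by
  match l, h with
  | [a, b, c, x, y], h =>
    rw [hasSegment, withValue_eq, List.any_eq_true] at h
    obtain ⟨r, hrm, hk⟩ := h
    have hk : r.1 = 65536 * (a % 2 ^ d) + (4096 * (b % 2 ^ d) + (256 * (c % 2 ^ d) +
      (16 * (x % 2 ^ d) + y % 2 ^ d))) := Nat.eq_of_beq_eq_true hk
    have hlt : ∀ n : ℕ, n % 2 ^ d < 16 := fun n =>
      (Nat.mod_lt _ (by positivity)).trans_le (Nat.pow_le_pow_right two_pos hd)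
    have hh : hexDigits r.1 = [a, b, c, x, y].map (· % 2 ^ d) := by
      have h1 := hlt a; have h2 := hlt b; have h3 := hlt c; have h4 := hlt x; have h5 := hlt y
      simp only [hexDigits, List.map_cons, List.map_nil, hk, List.cons.injEq, and_true]
      generalize a % 2 ^ d = a at *
      generalize b % 2 ^ d = b at *
      generalize c % 2 ^ d = c at *
      generalize x % 2 ^ d = x at *
      generalize y % 2 ^ d = y at *
      omega
    have := strictlyInadmissible_of_checkRelation (List.all_eq_true.1 hr r hrm)
    rw [hh] at this
    rw [expo_eq_add (2 ^ d)]
    refine this.add_two_pow_smul (fun i => ?_) _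
    fin_cases i <;> exact Nat.mod_lt _ (by positivity)

theorem exists_strictlyInadmissible_of_hasRelation {l : List ℕ} (h : hasRelation l = true) :
    ∃ d, StrictlyInadmissible d (expo l) := by
  simp only [hasRelation, Bool.or_eq_true] at h
  rcases h with h | h | h
  · exact ⟨2, strictlyInadmissible_of_hasSegment (by norm_num) relationsTwo_check h⟩
  · exact ⟨3, strictlyInadmissible_of_hasSegment (by norm_num) relationsThree_check h⟩
  · exact ⟨4, strictlyInadmissible_of_hasSegment (by norm_num) relationsFour_check h⟩

theorem mem_binaryLists {l : List ℕ} (h : ∀ a ∈ l, a ≤ 1) : l ∈ binaryLists l.length l.sum := by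
  induction l with
  | nil => simp [binaryLists]
  | cons a l ih =>
    have ih := ih fun b hb => h b (by simp [hb])
    have ha : a ≤ 1 := h a (by simp)
    rw [List.length_cons, List.sum_cons]
    interval_cases a
    · rw [zero_add]
      cases hs : l.sum with
      | zero => rw [hs] at ih; simpa [binaryLists] using ih
      | succ k => rw [hs] at ih; simpa [binaryLists] using ih
    · rw [add_comm 1]
      exact List.mem_append_left _ (List.mem_map_of_mem ih)

/-- The list starts with the lowest place, so the induction builds the monomial from its highest
digits downwards. Each stage tests only the blocks at the bottom: a block higher up was met at an
earlier stage, and prepending digits keeps the monomial strictly inadmissible. -/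
theorem exists_mem_survivors (ws : List ℕ) (u : Fin 5 →₀ ℕ)
    (h : weight u = fun k => ws.getD k 0) :
    (∃ l ∈ survivors ws, l.length = 5 ∧ expo l = u) ∨ ∃ d, StrictlyInadmissible d u := by
  induction ws generalizing u with
  | nil =>
    refine Or.inl ⟨_, List.mem_singleton_self _, rfl, ?_⟩
    ext i
    have := lt_of_weight_eq_zero (d := 0) (u := u) (fun j _ => by simp [h]) i
    rw [pow_zero, Nat.lt_one_iff] at this
    rw [this]
    fin_cases i <;> rfl
  | cons k ws ih =>
    obtain ⟨m, hm, rfl⟩ := exists_expo u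
    have hx : ∀ i, expo (m.map (· % 2)) i ≤ 1 := by
      intro i
      obtain ⟨a, b, c, d, e, rfl⟩ := exists_eq_of_length_eq_five hm
      fin_cases i <;> exact Nat.lt_succ_iff.1 (Nat.mod_lt _ two_pos)
    have he := expo_eq_add (l := m) 2
    rw [he] at h ⊢
    have hy : weight (expo (m.map (· / 2))) = fun k => ws.getD k 0 := by
      funext j
      rw [← weight_add_two_smul_succ hx, h]; rfl
    rcases ih _ hy with ⟨y, hys, hyl, hye⟩ | ⟨d, hd⟩
    · have hmy : y = m.map (· / 2) := by
        obtain ⟨a, b, c, d, e, rfl⟩ := exists_eq_of_length_eq_five hm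
        obtain ⟨a', b', c', d', e', rfl⟩ := exists_eq_of_length_eq_five hyl
        have h0 := DFunLike.congr_fun hye 0
        have h1 := DFunLike.congr_fun hye 1
        have h2 := DFunLike.congr_fun hye 2
        have h3 := DFunLike.congr_fun hye 3
        have h4 := DFunLike.congr_fun hye 4
        simp at h0 h1 h2 h3 h4
        simp [h0, h1, h2, h3, h4]
      have hp : ∀ {α : Type} (f : List ℕ → α),
          withPrepended (m.map (· % 2)) (m.map (· / 2)) f = f m := by
        intro α f
        clear * -
        induction m generalizing f with
        | nil => rfl
        | cons a m ih =>
          rw [List.map_cons, List.map_cons, withPrepended, withValue_eq, ih]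
          congr 2
          exact Nat.mod_add_div a 2
      rcases hb : hasRelation m with _ | _
      · refine Or.inl ⟨m, ?_, hm, he⟩
        refine List.mem_flatMap.2 ⟨y, hys, List.mem_flatMap.2 ⟨m.map (· % 2), ?_, ?_⟩⟩
        · have h1 := mem_binaryLists (l := m.map (· % 2)) (fun a ha => by
            obtain ⟨b, _, rfl⟩ := List.mem_map.1 ha
            exact Nat.lt_succ_iff.1 (Nat.mod_lt _ two_pos))
          have h2 : (m.map (· % 2)).sum = k := by
            rw [← weight_expo_zero hm, he, h]; rfl
          rwa [h2, List.length_map, hm] at h1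
        · rw [hmy, hp, hb]; simp
      · right
        rw [← he]
        exact exists_strictlyInadmissible_of_hasRelation hb
    · exact Or.inr ⟨d + 1, hd.prepend hx⟩

theorem inadmissible_of_not_mem {ws : List ℕ} {B : List (Fin 5 → ℕ)}
    (hc : (survivors ws).all (hasZeroOrMem B) = true) {u : Fin 5 →₀ ℕ}
    (h : weight u = fun k => ws.getD k 0) (hpos : ∀ i, 0 < u i) (hB : ⇑u ∉ B) :
    Inadmissible u := by
  rcases exists_mem_survivors ws u h with ⟨l, hl, h5, rfl⟩ | ⟨d, hd⟩
  · exfalso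
    have := List.all_eq_true.1 hc l hl
    obtain ⟨a, b, c, d, e, rfl⟩ := exists_eq_of_length_eq_five h5
    have h0 := hpos 0; have h1 := hpos 1; have h2 := hpos 2; have h3 := hpos 3; have h4 := hpos 4
    simp only [hasZeroOrMem, Bool.or_eq_true, List.any_eq_true, decide_eq_true_eq] at this
    rcases this with ⟨x, hx, hx0⟩ | ⟨f, hf, hl⟩
    · have := Nat.eq_of_beq_eq_true hx0
      simp at h0 h1 h2 h3 h4 hx
      omega
    · refine hB ?_
      convert hf
      simp only [List.cons.injEq, and_true] at hl
      obtain ⟨e0, e1, e2, e3, e4⟩ := hl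
      funext i
      fin_cases i <;> simp [e0, e1, e2, e3, e4]
  · exact hd.inadmissible

theorem inadmissible_of_not_mem_basisMonomials {j : Fin 3} {u : Fin 5 →₀ ℕ}
    (h : weight u = omega j) (hpos : ∀ i, 0 < u i) (hB : u ∉ basisMonomials j) :
    Inadmissible u := by
  fin_cases j
  · exact inadmissible_of_not_mem survivors_check_one h hpos hB
  · exact inadmissible_of_not_mem survivors_check_two h hpos hB
  · exact inadmissible_of_not_mem survivors_check_three h hpos hB

/-! ### Functionals that vanish on the hit polynomials -/

/-- The sum of the coefficients at the listed exponents. -/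
noncomputable def coeffSum (G : List (List ℕ)) : Poly 5 →ₗ[ZMod 2] ZMod 2 :=
  (G.map fun s => MvPolynomial.lcoeff (ZMod 2) (expo s)).sum

theorem coeffSum_apply (G : List (List ℕ)) (f : Poly 5) :
    coeffSum G f = (G.map fun s => f.coeff (expo s)).sum := by
  induction G with
  | nil => simp [coeffSum]
  | cons s G ih =>
    rw [coeffSum, List.map_cons, List.sum_cons, LinearMap.add_apply, ← coeffSum, ih]
    rfl

/-- The monomials whose image under `Sqᵏ` contains a given monomial. -/
def dualTerms : ℕ → List ℕ → List (List ℕ)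
  | k, [] => bif Nat.beq k 0 then [[]] else []
  | k, s :: ss => (List.range (k + 1)).flatMap fun a =>
      bif Nat.ble a s && Nat.beq (Nat.land a (Nat.sub s a)) a then
        (dualTerms (k - a) ss).map (Nat.sub s a :: ·) else []

theorem count_map_cons (a b : ℕ) (l : List ℕ) (L : List (List ℕ)) :
    (L.map (a :: ·)).count (b :: l) = if a = b then L.count l else 0 := by
  split_ifs with h
  · subst h
    exact List.count_map_of_injective L _ (fun _ _ h => List.cons_injective h) l
  · refine List.count_eq_zero.2 fun hm => ?_
    obtain ⟨_, _, hx⟩ := List.mem_map.1 hm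
    exact h (List.cons.inj hx).1

/-- The two enumerations are transposes of each other, with multiplicities: in each variable the
equation s = u + a, with the digits of a among those of u, is solved for u = s - a. -/
theorem count_dualTerms (s : List ℕ) : ∀ (k : ℕ) (m : List ℕ),
    (dualTerms k s).count m = (sqTerms k m).count s := by
  induction s with
  | nil =>
    intro k m
    cases m with
    | nil => rfl
    | cons u us =>
      have h1 : (sqTerms k (u :: us)).count [] = 0 := List.count_eq_zero.2 fun h => by
        obtain ⟨_, _, _, _, _, h⟩ := mem_sqTerms_cons.1 h
        cases h
      rw [h1]
      rcases k with _ | k <;> rfl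
  | cons s ss ih =>
    intro k m
    cases m with
    | nil =>
      have h1 : (sqTerms k []).count (s :: ss) = 0 := List.count_eq_zero.2 fun h => by
        cases (mem_sqTerms_nil.1 h).2
      rw [h1]
      refine List.count_eq_zero.2 fun h => ?_
      obtain ⟨a, _, h⟩ := List.mem_flatMap.1 h
      rcases hc : (Nat.ble a s && Nat.beq (Nat.land a (Nat.sub s a)) a) with _ | _ <;>
        rw [hc] at h <;> simp at h
    | cons u us =>
      rw [dualTerms, sqTerms, List.count_flatMap, List.count_flatMap]
      congr 1
      refine List.map_congr_left fun a _ => ?_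
      simp only [Function.comp]
      by_cases hu : a ≤ s ∧ s - a = u
      · obtain ⟨has, rfl⟩ := hu
        have e1 : Nat.ble a s = true := Nat.ble_eq.mpr has
        have e2 : Nat.add (s - a) a = s := Nat.sub_add_cancel has
        change (bif (Nat.ble a s && Nat.beq (Nat.land a (s - a)) a) then
          (dualTerms (k - a) ss).map ((s - a) :: ·) else []).count _ = _
        rw [e1, Bool.true_and, e2]
        cases Nat.beq (Nat.land a (s - a)) a
        · rfl
        · rw [cond_true, cond_true, count_map_cons, count_map_cons, if_pos rfl, if_pos rfl, ih]
      · have hr : (bif Nat.beq (Nat.land a u) a then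
            (sqTerms (k - a) us).map (Nat.add u a :: ·) else []).count (s :: ss) = 0 := by
          cases Nat.beq (Nat.land a u) a
          · rfl
          · rw [cond_true, count_map_cons, if_neg]
            change ¬ u + a = s
            omega
        rw [hr]
        rcases hc : Nat.ble a s with _ | _
        · rfl
        · cases Nat.beq (Nat.land a (Nat.sub s a)) a
          · rfl
          · rw [Bool.true_and, cond_true, count_map_cons, if_neg]
            exact fun h => hu ⟨Nat.ble_eq.mp hc, h⟩

theorem expo_injOn {l m : List ℕ} (hl : l.length = 5) (hm : m.length = 5)
    (h : expo l = expo m) : l = m := by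
  obtain ⟨a, b, c, d, e, rfl⟩ := exists_eq_of_length_eq_five hl
  obtain ⟨a', b', c', d', e', rfl⟩ := exists_eq_of_length_eq_five hm
  have h0 := DFunLike.congr_fun h 0
  have h1 := DFunLike.congr_fun h 1
  have h2 := DFunLike.congr_fun h 2
  have h3 := DFunLike.congr_fun h 3
  have h4 := DFunLike.congr_fun h 4
  simp at h0 h1 h2 h3 h4
  simp [h0, h1, h2, h3, h4]

theorem coeff_Sq_mono_expo {m s : List ℕ} (hm : m.length = 5) (hs : s.length = 5) (k : ℕ) :
    (Sq 5 k (mono (expo m))).coeff (expo s) = ((dualTerms k s).count m : ZMod 2) := by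
  rw [Sq_mono_expo hm, count_dualTerms]
  have hlen : ∀ y ∈ sqTerms k m, y.length = 5 := fun y hy => (length_of_mem_sqTerms hy).trans hm
  generalize sqTerms k m = L at hlen
  induction L with
  | nil => simp
  | cons y L ih =>
    rw [List.map_cons, List.sum_cons, MvPolynomial.coeff_add, ih fun z hz => hlen z (by simp [hz]),
      List.count_cons, mono, MvPolynomial.coeff_monomial]
    by_cases h : y = s
    · simp [h, add_comm]
    · rw [if_neg fun he => h (expo_injOn (hlen y (by simp)) hs he)]
      simp [h]

theorem flatMap_range_eq {α : Type} {f : ℕ → List α} {m n : ℕ} (h : m ≤ n)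
    (hf : ∀ a, m ≤ a → f a = []) : (List.range n).flatMap f = (List.range m).flatMap f := by
  induction n, h using Nat.le_induction with
  | base => rfl
  | succ n h ih => rw [List.range_succ, List.flatMap_append, ih]; simp [hf n h]

theorem flatMap_range_eq_of_bound {α : Type} {f : ℕ → List α} {m n : ℕ}
    (hm : ∀ a, m ≤ a → f a = []) (hn : ∀ a, n ≤ a → f a = []) :
    (List.range n).flatMap f = (List.range m).flatMap f := by
  rcases le_total m n with h | h
  · exact flatMap_range_eq h hm
  · exact (flatMap_range_eq h hn).symm

theorem flatMap_range_succ_eq {α : Type} {f : ℕ → List α} {n : ℕ} (hf : ∀ a < n, f a = []) :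
    (List.range (n + 1)).flatMap f = f n := by
  rw [List.range_succ, List.flatMap_append,
    List.flatMap_eq_nil_iff.2 fun a ha => hf a (List.mem_range.1 ha)]
  simp

/-- A version of `dualTerms` for evaluation. -/
def dualTermsFast : List ℕ → ℕ → List (List ℕ)
  | [], k => bif Nat.beq k 0 then [[]] else []
  | [s], k => bif Nat.ble k s && Nat.beq (Nat.land k (Nat.sub s k)) k then [[Nat.sub s k]] else []
  | s :: t :: ss, k => bif Nat.beq k 0 then [s :: t :: ss] else
      (List.range (Nat.succ (Nat.div s 2))).flatMap fun a =>
        bif Nat.ble a k && Nat.beq (Nat.land a (Nat.sub s a)) a then withValue (Nat.sub k a) fun b =>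
          withValue (Nat.sub s a) fun w => (dualTermsFast (t :: ss) b).map (w :: ·) else []

theorem dualTerms_zero (s : List ℕ) : dualTerms 0 s = [s] := by
  induction s with
  | nil => rfl
  | cons a s ih =>
    have h : Nat.beq (Nat.land 0 a) 0 = true := Nat.beq_eq.mpr (Nat.zero_and a)
    rw [dualTerms, zero_add, List.range_one, List.flatMap_cons, List.flatMap_nil,
      Nat.sub_zero, ih]
    change (bif Nat.beq (Nat.land 0 a) 0 then _ else _) ++ [] = _
    rw [h]
    rfl

/-- The digits of a can lie among those of s - a only if a ≤ s - a, so a need not exceed s / 2. The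
last variable has to absorb the whole remaining degree. -/
theorem dualTermsFast_eq (s : List ℕ) : ∀ k, dualTermsFast s k = dualTerms k s := by
  induction s with
  | nil => intro k; rfl
  | cons s ss ih =>
    intro k
    cases ss with
    | nil =>
      rw [dualTerms, flatMap_range_succ_eq]
      · rw [Nat.sub_self]; rfl
      · intro a ha
        obtain ⟨b, hb⟩ : ∃ b, k - a = b + 1 := ⟨k - a - 1, by omega⟩
        have : dualTerms (k - a) [] = [] := by rw [hb]; rfl
        rw [this]
        cases (Nat.ble a s && Nat.beq (Nat.land a (Nat.sub s a)) a) <;> rfl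
    | cons t ss =>
      rcases k with _ | k
      · rw [dualTerms_zero]; rfl
      · have h1 : dualTerms (k + 1) (s :: t :: ss) = (List.range (k + 1 + 1)).flatMap fun a =>
            bif Nat.ble a (k + 1) && (Nat.ble a s && Nat.beq (Nat.land a (Nat.sub s a)) a) then
              (dualTerms (k + 1 - a) (t :: ss)).map (Nat.sub s a :: ·) else [] := by
          rw [dualTerms]
          refine List.flatMap_congr fun a ha => ?_
          rw [Nat.ble_eq.mpr (Nat.lt_succ_iff.1 (List.mem_range.1 ha)), Bool.true_and]
        rw [h1, flatMap_range_eq_of_bound (m := s / 2 + 1)]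
        · change (List.range (s / 2 + 1)).flatMap _ = _
          refine List.flatMap_congr fun a ha => ?_
          have ha : a ≤ s := by have := List.mem_range.1 ha; omega
          rw [withValue_eq, withValue_eq, ih, Nat.ble_eq.mpr ha, Bool.true_and]
          rfl
        · intro a ha
          cases hc : (Nat.ble a (k + 1) && (Nat.ble a s && Nat.beq (Nat.land a (Nat.sub s a)) a))
          · rfl
          · simp only [Bool.and_eq_true] at hc
            have h2 : a ≤ s := Nat.ble_eq.mp hc.2.1
            have h3 : a &&& (s - a) = a := Nat.eq_of_beq_eq_true hc.2.2
            have h4 : a &&& (s - a) ≤ s - a := Nat.and_le_right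
            omega
        · intro a ha
          cases hc : Nat.ble a (k + 1)
          · rfl
          · have := Nat.ble_eq.mp hc
            omega

/-- Decides that a sum of coefficients vanishes on the image of `Sqᵏ`. -/
def checkDual (G : List (List ℕ)) (k : ℕ) : Bool :=
  (oddPart 0 ((G.flatMap fun s => dualTermsFast s k).map orderKey)).isEmpty

theorem mem_sqTerms_of_mem_dualTerms {s m : List ℕ} {k : ℕ} (h : m ∈ dualTerms k s) :
    s ∈ sqTerms k m := by
  rw [← List.count_pos_iff, ← count_dualTerms]
  exact List.count_pos_iff.2 h

theorem le_of_mem_sqTerms {l y : List ℕ} {k N : ℕ} (h : y ∈ sqTerms k l) (hy : ∀ a ∈ y, a < N) :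
    ∀ a ∈ l, a < N := by
  induction l generalizing k y with
  | nil => simp
  | cons u us ih =>
    obtain ⟨a, _, _, z, hz, rfl⟩ := mem_sqTerms_cons.1 h
    intro b hb
    rcases List.mem_cons.1 hb with rfl | hb
    · have := hy (b + a) (by simp)
      omega
    · exact ih hz (fun c hc => hy c (by simp [hc])) b hb

/-- By transposition the value at a monomial m is the parity of the number of times that m occurs
among the dual terms of G, and the check finds all these numbers even. Preimages have exponents
below 32 because the elements of G do, so `orderKey` tells them apart. -/
theorem coeffSum_Sq_eq_zero {G : List (List ℕ)} {k : ℕ} (h5 : ∀ s ∈ G, s.length = 5)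
    (h32 : ∀ s ∈ G, ∀ a ∈ s, a < 32) (hc : checkDual G k = true) (f : Poly 5) :
    coeffSum G (Sq 5 k f) = 0 := by
  have : (coeffSum G).comp (Sq 5 k) = 0 := by
    refine MvPolynomial.linearMap_ext fun u => ?_
    ext
    change coeffSum G (Sq 5 k (mono u)) = 0
    obtain ⟨m, hm, rfl⟩ := exists_expo u
    have h1 : coeffSum G (Sq 5 k (mono (expo m))) =
        (((G.flatMap (dualTerms k)).count m : ℕ) : ZMod 2) := by
      rw [coeffSum_apply, List.count_flatMap, Nat.cast_list_sum, List.map_map]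
      congr 1
      exact List.map_congr_left fun s hs => by
        rw [coeff_Sq_mono_expo hm (h5 s hs)]; rfl
    rw [h1]
    have hc : (oddPart 0 ((G.flatMap (dualTerms k)).map orderKey)).isEmpty = true := by
      simpa only [checkDual, dualTermsFast_eq] using hc
    set f : ℕ → ZMod 2 := fun x => if keyDigits x = m then 1 else 0 with hf
    -- The threshold 0 discards nothing, and the submodule ⊥ turns the congruence into an equality.
    have h2 := sum_map_oddPart_mem f 0 ⊥ ((G.flatMap (dualTerms k)).map orderKey) (by simp)
    rw [List.isEmpty_iff.1 hc, List.map_nil, List.sum_nil, sub_zero, Submodule.mem_bot] at h2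
    rw [← h2, List.map_map]
    have hmem : ∀ y ∈ G.flatMap (dualTerms k), keyDigits (orderKey y) = y := by
      intro y hy
      obtain ⟨s, hs, hy⟩ := List.mem_flatMap.1 hy
      have hy := mem_sqTerms_of_mem_dualTerms hy
      exact keyDigits_orderKey ((length_of_mem_sqTerms hy).symm.trans (h5 s hs))
        (le_of_mem_sqTerms hy (h32 s hs))
    generalize G.flatMap (dualTerms k) = L at hmem
    induction L with
    | nil => simp
    | cons y L ih =>
      rw [List.map_cons, List.sum_cons, ← ih fun z hz => hmem z (by simp [hz]), List.count_cons]
      simp only [hf, Function.comp, hmem y (by simp)]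
      by_cases h : y = m <;> simp [h, add_comm]
  exact LinearMap.congr_fun this f

/-! ### Linear substitutions -/

/-- The linear form with the given coefficients. -/
noncomputable def linearForm {t : ℕ} (c : Fin t → ZMod 2) : Poly t :=
  ∑ j, C (c j) * X j

/-- The substitution of linear forms for the variables. -/
noncomputable def linSubst {t : ℕ} (A : Fin t → Fin t → ZMod 2) : Poly t →ₐ[ZMod 2] Poly t :=
  MvPolynomial.aeval fun i => linearForm (A i)

theorem zmod_two_sq (a : ZMod 2) : a ^ 2 = a := by
  revert a; decide

theorem linearForm_sq {t : ℕ} (c : Fin t → ZMod 2) :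
    linearForm c ^ 2 = ∑ j, C (c j) * X j ^ 2 := by
  rw [linearForm, sum_pow_char]
  exact Finset.sum_congr rfl fun j _ => by rw [mul_pow, ← map_pow, zmod_two_sq]

/-- Both sides are algebra homomorphisms, so the generators suffice. There the claim is that a
linear form ℓ has total square ℓ + ℓ²ξ, which holds because squaring is additive and fixes
coefficients in 𝔽₂. -/
theorem totalSq_linSubst {t : ℕ} (A : Fin t → Fin t → ZMod 2) :
    (totalSq t).comp (linSubst A) = (Polynomial.mapAlgHom (linSubst A)).comp (totalSq t) := by
  refine MvPolynomial.algHom_ext fun i => ?_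
  simp only [AlgHom.comp_apply, linSubst, totalSq, MvPolynomial.aeval_X, map_add, map_mul,
    Polynomial.coe_mapAlgHom, Polynomial.map_C, Polynomial.map_X, RingHom.coe_coe]
  rw [map_pow, MvPolynomial.aeval_X, linearForm_sq]
  simp only [linearForm, map_sum, map_mul, MvPolynomial.aeval_X, MvPolynomial.aeval_C,
    Finset.sum_mul, ← Finset.sum_add_distrib]
  refine Finset.sum_congr rfl fun j _ => ?_
  have : (algebraMap (ZMod 2) (Polynomial (Poly t))) (A i j) = Polynomial.C (C (A i j)) := rfl
  rw [this]
  ring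

theorem Sq_linSubst {t : ℕ} (A : Fin t → Fin t → ZMod 2) (k : ℕ) (f : Poly t) :
    Sq t k (linSubst A f) = linSubst A (Sq t k f) := by
  have := congrArg (fun p => Polynomial.coeff p k) (AlgHom.congr_fun (totalSq_linSubst A) f)
  simpa [Sq] using this

theorem linSubst_mono {t : ℕ} (A : Fin t → Fin t → ZMod 2) (u : Fin t →₀ ℕ) :
    linSubst A (mono u) = ∏ i, linearForm (A i) ^ u i := by
  rw [linSubst, mono, MvPolynomial.aeval_monomial, map_one, one_mul,
    Finsupp.prod_fintype _ _ fun i => pow_zero _]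

theorem isHomogeneous_linSubst_mono {t : ℕ} (A : Fin t → Fin t → ZMod 2) (u : Fin t →₀ ℕ) :
    (linSubst A (mono u)).IsHomogeneous u.degree := by
  rw [linSubst_mono, Finsupp.degree_eq_sum]
  refine MvPolynomial.IsHomogeneous.prod _ _ _ fun i _ => ?_
  have h1 : (linearForm (A i)).IsHomogeneous 1 :=
    MvPolynomial.IsHomogeneous.sum _ _ _ fun j _ => by
      simpa using (MvPolynomial.isHomogeneous_C _ _).mul (MvPolynomial.isHomogeneous_X _ j)
  simpa using h1.pow (u i)

theorem linSubst_mono_add {t : ℕ} (A : Fin t → Fin t → ZMod 2) (x y : Fin t →₀ ℕ) :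
    linSubst A (mono (x + 2 • y)) = linSubst A (mono x) * linSubst A (mono y) ^ 2 := by
  rw [← mono_mul, ← mono_pow, map_mul, map_pow]

theorem eq_of_coeff_mul_sq_ne_zero {t k : ℕ} {P R : Poly t} (hP : P.IsHomogeneous k)
    {a b : Fin t →₀ ℕ} (h : P.coeff a * (R ^ 2).coeff b ≠ 0) :
    a.degree = k ∧ ∃ c, b = 2 • c := by
  refine ⟨by_contra fun hne => h (by rw [hP.coeff_eq_zero hne, zero_mul]), ?_⟩
  have hb : b ∈ (R ^ 2).support := MvPolynomial.mem_support_iff.2 fun h0 => h (by rw [h0, mul_zero])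
  rw [poly_eq_sum_mono R, sum_pow_char] at hb
  obtain ⟨c, _, hc⟩ := Finset.mem_biUnion.1 (MvPolynomial.support_sum hb)
  rw [mono_pow, mono, MvPolynomial.support_monomial, if_neg one_ne_zero,
    Finset.mem_singleton] at hc
  exact ⟨c, hc⟩

theorem weight_zero_le_degree {t : ℕ} (u : Fin t →₀ ℕ) : weight u 0 ≤ u.degree := by
  rw [weight_zero_eq, Finsupp.degree_eq_sum]
  exact Finset.sum_le_sum fun i _ => Nat.mod_le _ _

/-- Terms of R² have even exponents, so s would inherit its odd exponents from a term of P, and a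
monomial of degree k has at most k of them. -/
theorem coeff_mul_sq_eq_zero {t k : ℕ} {P R : Poly t} (hP : P.IsHomogeneous k)
    {s : Fin t →₀ ℕ} (hk : k < weight s 0) : (P * R ^ 2).coeff s = 0 := by
  classical
  rw [MvPolynomial.coeff_mul]
  refine Finset.sum_eq_zero ?_
  rintro ⟨a, b⟩ hab
  rw [Finset.HasAntidiagonal.mem_antidiagonal] at hab
  by_contra hne
  obtain ⟨hd, c, rfl⟩ := eq_of_coeff_mul_sq_ne_zero hP hne
  simp only at hab hd
  rw [← hab, weight_add_two_smul_zero] at hk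
  have := weight_zero_le_degree a
  omega

/-- If x + 2y = a + 2c with a a term of P, then parity forces x ≤ a in every entry and equality of
degrees forces a = x. A single product survives, and over 𝔽₂ the coefficient of R² at 2y is that of
R at y. -/
theorem coeff_mul_sq {t k : ℕ} {P R : Poly t} (hP : P.IsHomogeneous k)
    {x y : Fin t →₀ ℕ} (hx : ∀ i, x i ≤ 1) (hk : k = x.degree) :
    (P * R ^ 2).coeff (x + 2 • y) = P.coeff x * R.coeff y := by
  classical
  rw [MvPolynomial.coeff_mul, Finset.sum_eq_single (x, 2 • y)]
  · rw [← MvPolynomial.expand_zmod, MvPolynomial.coeff_expand_smul 2 two_ne_zero]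
  · rintro ⟨a, b⟩ hab hne
    rw [Finset.HasAntidiagonal.mem_antidiagonal] at hab
    by_contra h0
    obtain ⟨hd, c, rfl⟩ := eq_of_coeff_mul_sq_ne_zero hP h0
    simp only at hab hd
    refine hne ?_
    have hi : ∀ i, a i + 2 * c i = x i + 2 * y i := fun i => DFunLike.congr_fun hab i
    have hle : ∀ i, x i ≤ a i := fun i => by have := hx i; have := hi i; omega
    rw [hk, Finsupp.degree_eq_sum, Finsupp.degree_eq_sum] at hd
    have ha : a = x := by
      ext i
      exact ((Finset.sum_eq_sum_iff_of_le fun i _ => hle i).1 hd.symm i (Finset.mem_univ i)).symm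
    subst ha
    rw [add_left_cancel hab]
  · intro h
    exact absurd (Finset.HasAntidiagonal.mem_antidiagonal.2
      (show (x, 2 • y).1 + (x, 2 • y).2 = x + 2 • y by simp only)) h

/-! ### Splitting off the lowest binary digit -/

/-- The lowest binary digits of the exponents. -/
noncomputable def lowDigits {t : ℕ} (u : Fin t →₀ ℕ) : Fin t →₀ ℕ := u.mapRange (· % 2) rfl

/-- The exponents without their lowest binary digits. -/
noncomputable def highDigits {t : ℕ} (u : Fin t →₀ ℕ) : Fin t →₀ ℕ := u.mapRange (· / 2) rfl

theorem lowDigits_add_highDigits {t : ℕ} (u : Fin t →₀ ℕ) :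
    lowDigits u + 2 • highDigits u = u := by
  ext i; exact Nat.mod_add_div (u i) 2

theorem lowDigits_le {t : ℕ} (u : Fin t →₀ ℕ) (i : Fin t) : lowDigits u i ≤ 1 :=
  Nat.lt_succ_iff.1 (Nat.mod_lt _ two_pos)

theorem degree_lowDigits {t : ℕ} (u : Fin t →₀ ℕ) : (lowDigits u).degree = weight u 0 := by
  rw [weight_zero_eq, Finsupp.degree_eq_sum]; rfl

theorem weight_highDigits {t : ℕ} (u : Fin t →₀ ℕ) (j : ℕ) :
    weight (highDigits u) j = weight u (j + 1) := by
  conv_rhs => rw [← lowDigits_add_highDigits u]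
  rw [weight_add_two_smul_succ (lowDigits_le u)]

/-- Iterated over the places, this writes the coefficient as a product of coefficients at squarefree
monomials, one for each binary digit; each factor expands a product of at most t linear forms. -/
theorem coeff_linSubst_mono {t : ℕ} (A : Fin t → Fin t → ZMod 2) {u s : Fin t →₀ ℕ}
    (h : weight u 0 = weight s 0) : (linSubst A (mono u)).coeff s =
      (linSubst A (mono (lowDigits u))).coeff (lowDigits s) *
        (linSubst A (mono (highDigits u))).coeff (highDigits s) := by
  conv_lhs => rw [← lowDigits_add_highDigits u, ← lowDigits_add_highDigits s, linSubst_mono_add]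
  exact coeff_mul_sq (isHomogeneous_linSubst_mono A _) (lowDigits_le s)
    (by rw [degree_lowDigits, degree_lowDigits, h])

/-- A linear substitution does not produce monomials of larger weight. -/
theorem coeff_linSubst_mono_eq_zero {t : ℕ} (A : Fin t → Fin t → ZMod 2) {u s : Fin t →₀ ℕ}
    (h : toLex (weight u) < toLex (weight s)) : (linSubst A (mono u)).coeff s = 0 := by
  obtain ⟨i, hi, hlt⟩ := toLex_lt_iff.1 h
  clear h
  -- Induction on the first place where the weight vectors differ. Before that place the coefficient
  -- factors; at it there are too few linear forms to provide the odd exponents.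
  induction i generalizing u s with
  | zero =>
    conv_lhs => rw [← lowDigits_add_highDigits u, linSubst_mono_add]
    exact coeff_mul_sq_eq_zero (isHomogeneous_linSubst_mono A _) (by rwa [degree_lowDigits])
  | succ i ih =>
    rw [coeff_linSubst_mono A (hi 0 (Nat.succ_pos i)),
      ih (u := highDigits u) (s := highDigits s), mul_zero]
    · intro j hj
      rw [weight_highDigits, weight_highDigits, hi _ (by omega)]
    · rwa [weight_highDigits, weight_highDigits]

/-! ### Evaluation of many functionals at once -/

/-- A truth value modulo 2. -/
def zbit (b : Bool) : ZMod 2 := if b then 1 else 0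

theorem zbit_xor (a b : Bool) : zbit (a ^^ b) = zbit a + zbit b := by
  cases a <;> cases b <;> decide

theorem zbit_and (a b : Bool) : zbit (a && b) = zbit a * zbit b := by
  cases a <;> cases b <;> decide

/-- Application to an evaluated list. -/
def withValues {α : Type} : List ℕ → (List ℕ → α) → α
  | [], f => f []
  | a :: l, f => withValue a fun b => withValues l fun m => f (b :: m)

theorem withValues_eq {α : Type} (l : List ℕ) (f : List ℕ → α) : withValues l f = f l := by
  induction l generalizing f with
  | nil => rfl
  | cons a l ih => rw [withValues, withValue_eq, ih]

/-- The contribution of a variable to the expansion of a linear form. -/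
def expandVar (m a : ℕ) (F : ℕ → ℕ) : ℕ :=
  bif Nat.beq a 0 then 0 else withValue (Nat.pred a) fun b => Nat.land m (F b)

/-- The expansion of the first linear form in a product. -/
def expandForm : List ℕ → List ℕ → (List ℕ → ℕ) → ℕ
  | [p, q, r, s, t], [a, b, c, d, e], F =>
      Nat.xor (expandVar p a fun x => F [x, b, c, d, e])
      (Nat.xor (expandVar q b fun x => F [a, x, c, d, e])
      (Nat.xor (expandVar r c fun x => F [a, b, x, d, e])
      (Nat.xor (expandVar s d fun x => F [a, b, c, x, e])
      (expandVar t e fun x => F [a, b, c, d, x]))))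
  | _, _, _ => 0

/-- The coefficients at `σ` of the products of the linear forms selected by the second argument. The
`i`-th bits of the entries of the matrix are the coefficients of the `i`-th family of forms. -/
def productMask (full : ℕ) : List (List ℕ) → List ℕ → List ℕ → ℕ
  | [], _, σ => bif Nat.beq (listSum σ) 0 then full else 0
  | _ :: _, [], _ => 0
  | _ :: rs, 0 :: x, σ => productMask full rs x σ
  | r :: rs, (_ + 1) :: x, σ => expandForm r σ (productMask full rs x)

/-- The lists of the binary digits of the exponents, for the lowest `n` places. -/
def digitLists : ℕ → List ℕ → List (List ℕ)
  | 0, _ => []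
  | n + 1, l => l.map (Nat.mod · 2) :: digitLists n (l.map (Nat.div · 2))

/-- The coefficients of the image of a monomial at a monomial of the same weight vector, in terms of
the binary digits of the exponents. -/
def digitMask (full : ℕ) (rows : List (List ℕ)) : List (List ℕ) → List (List ℕ) → ℕ
  | x :: xs, y :: ys => Nat.land (productMask full rows x y) (digitMask full rows xs ys)
  | _, _ => full

/-- The sum of the coefficients at the listed monomials. -/
def digitMaskSum (full : ℕ) (rows : List (List ℕ)) (xs : List (List ℕ)) :
    List (List (List ℕ)) → ℕ
  | [] => 0
  | ys :: L => Nat.xor (digitMask full rows xs ys) (digitMaskSum full rows xs L)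

/-- The `i`-th family of linear forms. -/
noncomputable def formMatrix (rows : List (List ℕ)) (i : ℕ) (a b : Fin 5) : ZMod 2 :=
  zbit (((rows.getD a []).getD b 0).testBit i)

/-- The linear form whose coefficients are the `i`-th bits. -/
noncomputable def bitForm (r : List ℕ) (i : ℕ) : Poly 5 :=
  linearForm fun b => zbit ((r.getD b 0).testBit i)

/-- The product of the linear forms selected by the exponents. -/
noncomputable def bitFormProd (i : ℕ) : List (List ℕ) → List ℕ → Poly 5
  | r :: rs, a :: x => bitForm r i ^ a * bitFormProd i rs x
  | _, _ => 1

theorem linSubst_formMatrix {rows : List (List ℕ)} {x : List ℕ} (hr : rows.length = 5)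
    (hx : x.length = 5) (i : ℕ) :
    linSubst (formMatrix rows i) (mono (expo x)) = bitFormProd i rows x := by
  obtain ⟨a, b, c, d, e, rfl⟩ := exists_eq_of_length_eq_five hx
  match rows, hr with
  | [p, q, r, s, t], _ =>
    rw [linSubst_mono, Fin.prod_univ_five]
    simp only [bitFormProd, mul_one, mul_assoc]
    rfl

theorem coeff_X_mul_expo (F : Poly 5) (j : Fin 5) (l m : List ℕ)
    (h : l.getD j 0 ≠ 0 → expo l = expo m + Finsupp.single j 1) :
    (X j * F).coeff (expo l) = if l.getD j 0 = 0 then 0 else F.coeff (expo m) := by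
  rw [MvPolynomial.coeff_X_mul']
  by_cases h0 : l.getD j 0 = 0
  · rw [if_pos h0, if_neg]
    rw [Finsupp.mem_support_iff, not_not]
    exact h0
  · rw [if_neg h0, if_pos (by rw [Finsupp.mem_support_iff]; exact h0), h h0, add_tsub_cancel_right]

theorem zbit_testBit_expandVar (m a i : ℕ) (F : ℕ → ℕ) : zbit ((expandVar m a F).testBit i) =
    zbit (m.testBit i) * if a = 0 then 0 else zbit ((F (a - 1)).testBit i) := by
  rw [expandVar, withValue_eq]
  rcases a with _ | a
  · simp [zbit]
  · change zbit ((m &&& F a).testBit i) = _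
    rw [Nat.testBit_and, zbit_and]
    simp

theorem coeff_bitForm_mul {r σ : List ℕ} (hr : r.length = 5) (hσ : σ.length = 5) (i : ℕ)
    (F : Poly 5) (M : List ℕ → ℕ)
    (hF : ∀ τ : List ℕ, τ.length = 5 → F.coeff (expo τ) = zbit ((M τ).testBit i)) :
    (bitForm r i * F).coeff (expo σ) = zbit ((expandForm r σ M).testBit i) := by
  obtain ⟨a, b, c, d, e, rfl⟩ := exists_eq_of_length_eq_five hσ
  obtain ⟨p, q, r, s, t, rfl⟩ := exists_eq_of_length_eq_five hr
  have e1 : expandForm [p, q, r, s, t] [a, b, c, d, e] M =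
      (expandVar p a fun x => M [x, b, c, d, e]) ^^^
      ((expandVar q b fun x => M [a, x, c, d, e]) ^^^
      ((expandVar r c fun x => M [a, b, x, d, e]) ^^^
      ((expandVar s d fun x => M [a, b, c, x, e]) ^^^
      (expandVar t e fun x => M [a, b, c, d, x])))) := rfl
  rw [e1]
  simp only [Nat.testBit_xor, zbit_xor, zbit_testBit_expandVar]
  rw [bitForm, linearForm, Finset.sum_mul, MvPolynomial.coeff_sum, Fin.sum_univ_five]
  simp only [mul_assoc, MvPolynomial.coeff_C_mul]
  rw [coeff_X_mul_expo F 0 [a, b, c, d, e] [a - 1, b, c, d, e],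
    coeff_X_mul_expo F 1 [a, b, c, d, e] [a, b - 1, c, d, e],
    coeff_X_mul_expo F 2 [a, b, c, d, e] [a, b, c - 1, d, e],
    coeff_X_mul_expo F 3 [a, b, c, d, e] [a, b, c, d - 1, e],
    coeff_X_mul_expo F 4 [a, b, c, d, e] [a, b, c, d, e - 1]]
  · rw [hF [a - 1, b, c, d, e] rfl, hF [a, b - 1, c, d, e] rfl, hF [a, b, c - 1, d, e] rfl,
      hF [a, b, c, d - 1, e] rfl, hF [a, b, c, d, e - 1] rfl]
    simp only [← add_assoc]
    rfl
  all_goals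
    intro h
    ext k
    simp at h
    fin_cases k <;> simp
    omega

/-- Bitwise conjunction and exclusive or are the operations of 𝔽₂ in all bit positions
simultaneously. Multiplying out one form after another thus gives the coefficient for every family
of forms at once. -/
theorem coeff_bitFormProd {full i : ℕ} (hi : full.testBit i = true) (rows : List (List ℕ)) :
    ∀ (x σ : List ℕ), (∀ r ∈ rows, r.length = 5) → rows.length = x.length → (∀ a ∈ x, a ≤ 1) →
      σ.length = 5 →
      (bitFormProd i rows x).coeff (expo σ) = zbit ((productMask full rows x σ).testBit i) := by
  induction rows with
  | nil =>
    intro x σ _ hx _ hσ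
    obtain rfl : x = [] := List.length_eq_zero_iff.1 hx.symm
    obtain ⟨a, b, c, d, e, rfl⟩ := exists_eq_of_length_eq_five hσ
    rw [bitFormProd, productMask, MvPolynomial.coeff_one, listSum_eq]
    · by_cases h : [a, b, c, d, e].sum = 0
      · have : (0 : Fin 5 →₀ ℕ) = expo [a, b, c, d, e] := by
          simp at h
          ext k
          fin_cases k <;> simp [h]
        rw [if_pos this, h]
        change 1 = zbit (full.testBit i)
        rw [hi]; rfl
      · have : ¬ (0 : Fin 5 →₀ ℕ) = expo [a, b, c, d, e] := by
          intro h'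
          apply h
          rw [← degree_expo rfl, ← h']; rfl
        rw [if_neg this, Bool.eq_false_iff.mpr fun hb => h (Nat.eq_of_beq_eq_true hb)]
        simp [zbit]
    · simp
  | cons r rs ih =>
    intro x σ hr hx h1 hσ
    match x, hx, h1 with
    | 0 :: x, hx, h1 =>
      rw [bitFormProd, pow_zero, one_mul, ih x σ (fun q hq => hr q (by simp [hq]))
        (by simpa using hx) (fun a ha => h1 a (by simp [ha])) hσ]
      rfl
    | 1 :: x, hx, h1 =>
      rw [bitFormProd, pow_one]
      exact coeff_bitForm_mul (hr r (by simp)) hσ i _ _ fun τ hτ =>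
        ih x τ (fun q hq => hr q (by simp [hq])) (by simpa using hx)
          (fun a ha => h1 a (by simp [ha])) hτ
    | (a + 2) :: x, hx, h1 =>
      have := h1 (a + 2) (by simp)
      omega

theorem lowDigits_expo (l : List ℕ) (h : l.length = 5) :
    lowDigits (expo l) = expo (l.map (· % 2)) := by
  obtain ⟨a, b, c, d, e, rfl⟩ := exists_eq_of_length_eq_five h
  ext i
  fin_cases i <;> rfl

theorem highDigits_expo (l : List ℕ) (h : l.length = 5) :
    highDigits (expo l) = expo (l.map (· / 2)) := by
  obtain ⟨a, b, c, d, e, rfl⟩ := exists_eq_of_length_eq_five h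
  ext i
  fin_cases i <;> rfl

/-- Induction on the number of places with `coeff_linSubst_mono`. Equality of the weight vectors,
not only of the degrees, is what permits the splitting at every place. -/
theorem coeff_linSubst_eq_digitMask {full i : ℕ} (hi : full.testBit i = true)
    {rows : List (List ℕ)} (hr : ∀ r ∈ rows, r.length = 5) (hr5 : rows.length = 5) (n : ℕ) :
    ∀ (l s : List ℕ), l.length = 5 → s.length = 5 → (∀ a ∈ l, a < 2 ^ n) → (∀ a ∈ s, a < 2 ^ n) →
      weight (expo l) = weight (expo s) →
      (linSubst (formMatrix rows i) (mono (expo l))).coeff (expo s) =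
        zbit ((digitMask full rows (digitLists n l) (digitLists n s)).testBit i) := by
  induction n with
  | zero =>
    intro l s hl hs hl' hs' _
    have : ∀ {m : List ℕ}, m.length = 5 → (∀ a ∈ m, a < 2 ^ 0) → expo m = 0 := by
      intro m hm hm'
      obtain ⟨a, b, c, d, e, rfl⟩ := exists_eq_of_length_eq_five hm
      simp at hm'
      ext k
      fin_cases k <;> simp [hm']
    have hm : digitMask full rows (digitLists 0 l) (digitLists 0 s) = full := rfl
    rw [this hl hl', this hs hs', hm, hi]
    have : mono (0 : Fin 5 →₀ ℕ) = 1 := rfl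
    rw [this, map_one, MvPolynomial.coeff_one, if_pos rfl]; rfl
  | succ n ih =>
    intro l s hl hs hl' hs' hw
    have hhalf : ∀ {m : List ℕ}, (∀ a ∈ m, a < 2 ^ (n + 1)) → ∀ a ∈ m.map (· / 2), a < 2 ^ n := by
      intro m hm a ha
      obtain ⟨b, hb, rfl⟩ := List.mem_map.1 ha
      have := hm b hb
      rw [pow_succ] at this
      omega
    rw [coeff_linSubst_mono _ (congrFun hw 0), lowDigits_expo l hl, lowDigits_expo s hs,
      highDigits_expo l hl, highDigits_expo s hs,
      ih (l.map (· / 2)) (s.map (· / 2)) (by simpa using hl) (by simpa using hs) (hhalf hl')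
        (hhalf hs') ?_,
      linSubst_formMatrix hr5 (by simpa using hl),
      coeff_bitFormProd hi rows _ _ hr (by simpa [hr5] using hl.symm) ?_ (by simpa using hs)]
    · rw [← zbit_and, ← Nat.testBit_and]
      rfl
    · intro a ha
      obtain ⟨b, hb, rfl⟩ := List.mem_map.1 ha
      omega
    · rw [← highDigits_expo l hl, ← highDigits_expo s hs]
      funext j
      rw [weight_highDigits, weight_highDigits, hw]

theorem testBit_of_testBit_digitMask {full i : ℕ} {rows : List (List ℕ)} :
    ∀ {xs ys : List (List ℕ)}, (digitMask full rows xs ys).testBit i = true → full.testBit i = true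
  | x :: xs, y :: ys, h => by
    change (productMask full rows x y &&& digitMask full rows xs ys).testBit i = true at h
    rw [Nat.testBit_and, Bool.and_eq_true] at h
    exact testBit_of_testBit_digitMask h.2
  | [], _, h => by rwa [digitMask] at h; simp
  | _ :: _, [], h => by rwa [digitMask] at h; simp

theorem zbit_testBit_digitMaskSum (full i : ℕ) (rows xs : List (List ℕ))
    (L : List (List (List ℕ))) : zbit ((digitMaskSum full rows xs L).testBit i) =
      (L.map fun ys => zbit ((digitMask full rows xs ys).testBit i)).sum := by
  induction L with
  | nil => rw [digitMaskSum, Nat.zero_testBit]; rfl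
  | cons ys L ih =>
    change zbit ((digitMask full rows xs ys ^^^ digitMaskSum full rows xs L).testBit i) = _
    rw [Nat.testBit_xor, zbit_xor, ih]
    rfl

/-! ### Gaussian elimination -/

/-- The binary digit at the place `p`. -/
def bitAt (x p : ℕ) : Bool := Nat.beq (Nat.mod (Nat.shiftRight x p) 2) 1

theorem bitAt_eq (x p : ℕ) : bitAt x p = x.testBit p := by
  have h : bitAt x p = Nat.beq (x >>> p % 2) 1 := rfl
  rw [h, Nat.testBit_eq_decide_div_mod_eq, Nat.shiftRight_eq_div_pow]
  rcases Nat.mod_two_eq_zero_or_one (x / 2 ^ p) with h | h <;> rw [h] <;> rfl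

/-- Gaussian elimination modulo 2, with at most `n` steps. -/
def independentRows : ℕ → List ℕ → Bool
  | _, [] => true
  | 0, _ :: _ => false
  | n + 1, r :: rs => withValue (Nat.log2 r) fun p => bitAt r p &&
      withValues (rs.map fun x => bif bitAt x p then Nat.xor x r else x) (independentRows n)

/-- The binary digits as a vector modulo 2. -/
def bitVec (x : ℕ) : ℕ → ZMod 2 := fun i => zbit (x.testBit i)

theorem bitVec_xor (x y : ℕ) : bitVec (x ^^^ y) = bitVec x + bitVec y := by
  funext i
  rw [bitVec, Nat.testBit_xor, zbit_xor]; rfl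

/-- Once the other rows are reduced by the pivot row, they vanish at the pivot bit, so a relation
read there isolates the total coefficient of the pivot row. That coefficient is zero, the reduced
rows satisfy a relation with the old coefficients, and the induction applies to them; the
coefficient of the pivot row then vanishes too. -/
theorem eq_zero_of_independentRows {n : ℕ} {l : List ℕ} (h : independentRows n l = true)
    (g : ℕ → ZMod 2) (hg : ∑ i ∈ Finset.range l.length, g i • bitVec (l.getD i 0) = 0) :
    ∀ i < l.length, g i = 0 := by
  induction n generalizing l g with
  | zero =>
    cases l with
    | nil => intro i hi; simp at hi
    | cons r rs => cases h
  | succ n ih =>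
    cases l with
    | nil => intro i hi; simp at hi
    | cons r rs =>
      rw [independentRows, withValue_eq, withValues_eq, Bool.and_eq_true] at h
      obtain ⟨hp, h⟩ := h
      -- The pivot is the leading bit. For r = 0 the logarithm is 0 and the bit test fails, so zero
      -- rows are rejected.
      set p := Nat.log2 r
      rw [bitAt_eq] at hp
      set red : ℕ → ℕ := fun x => bif bitAt x p then Nat.xor x r else x with hred
      have hz : ∀ x, bitVec (red x) p = 0 := by
        intro x
        simp only [hred, bitAt_eq, bitVec]
        cases hx : x.testBit p
        · rw [cond_false, hx]; rfl
        · change zbit ((x ^^^ r).testBit p) = 0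
          rw [Nat.testBit_xor, hx, hp]; rfl
      have hx : ∀ x, bitVec x = bitVec (red x) + zbit (x.testBit p) • bitVec r := by
        intro x
        simp only [hred, bitAt_eq]
        cases hx : x.testBit p
        · simp [zbit]
        · change _ = bitVec (x ^^^ r) + _
          rw [bitVec_xor, add_assoc]
          funext i
          simp [zbit, CharTwo.add_self_eq_zero]
      rw [List.length_cons, Finset.sum_range_succ'] at hg
      simp only [List.getD_cons_succ, List.getD_cons_zero] at hg
      have hmap : ∀ i < rs.length, (rs.map red).getD i 0 = red (rs.getD i 0) := by
        intro i hi
        rw [List.getD_eq_getElem _ _ hi, List.getD_eq_getElem _ _ (by simpa using hi),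
          List.getElem_map]
      have hsum : ∑ i ∈ Finset.range rs.length, g (i + 1) • bitVec (rs.getD i 0) =
          ∑ i ∈ Finset.range rs.length, g (i + 1) • bitVec (red (rs.getD i 0)) +
          (∑ i ∈ Finset.range rs.length, g (i + 1) * zbit ((rs.getD i 0).testBit p)) • bitVec r := by
        rw [Finset.sum_smul, ← Finset.sum_add_distrib]
        refine Finset.sum_congr rfl fun i _ => ?_
        rw [hx (rs.getD i 0), smul_add, smul_smul]
      rw [hsum, add_assoc, ← add_smul] at hg
      set t := (∑ i ∈ Finset.range rs.length, g (i + 1) * zbit ((rs.getD i 0).testBit p)) + g 0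
        with ht
      have ht0 : t = 0 := by
        have := congrFun hg p
        simp only [Pi.add_apply, Finset.sum_apply, Pi.smul_apply, hz, smul_zero,
          Finset.sum_const_zero, zero_add, Pi.zero_apply] at this
        simpa [bitVec, hp, zbit] using this
      rw [ht0, zero_smul, add_zero] at hg
      have hrs := ih h (fun i => g (i + 1)) (by
        rw [List.length_map, ← hg]
        exact Finset.sum_congr rfl fun i hi => by rw [hmap i (Finset.mem_range.1 hi)])
      rw [List.length_map] at hrs
      have h0 : g 0 = 0 := by
        rw [ht, Finset.sum_eq_zero, zero_add] at ht0
        · exact ht0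
        · intro i hi
          rw [hrs i (Finset.mem_range.1 hi), zero_mul]
      intro i hi
      rcases i with _ | i
      · exact h0
      · exact hrs i (by simpa using hi)

theorem linearIndependent_bitVec {n : ℕ} {l : List ℕ} (h : independentRows n l = true) :
    LinearIndependent (ZMod 2) fun i : Fin l.length => bitVec (l.get i) := by
  rw [Fintype.linearIndependent_iff]
  intro g hg i
  have := eq_zero_of_independentRows h (fun k => if hk : k < l.length then g ⟨k, hk⟩ else 0) ?_
    i.1 i.2
  · simpa using this
  · rw [Finset.sum_range, ← hg]
    refine Finset.sum_congr rfl fun k _ => ?_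
    rw [dif_pos k.2, List.getD_eq_getElem _ _ k.2]
    rfl

/-! ### Linear independence by functionals -/

/-- The exponents as a list. -/
def exponentList (f : Fin 5 → ℕ) : List ℕ := [f 0, f 1, f 2, f 3, f 4]

theorem expo_exponentList (u : Fin 5 →₀ ℕ) : expo (exponentList u) = u := by
  ext i
  fin_cases i <;> rfl

/-- Application to the evaluated lists of digits. -/
def withDigits {α : Type} : ℕ → List ℕ → (List (List ℕ) → α) → α
  | 0, _, f => f []
  | n + 1, l, f => withValues (l.map (Nat.mod · 2)) fun x =>
      withValues (l.map (Nat.div · 2)) fun m => withDigits n m fun xs => f (x :: xs)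

theorem withDigits_eq {α : Type} (n : ℕ) (l : List ℕ) (f : List (List ℕ) → α) :
    withDigits n l f = f (digitLists n l) := by
  induction n generalizing l f with
  | zero => rfl
  | succ n ih => rw [withDigits, withValues_eq, withValues_eq, ih]; rfl

/-- Application to the evaluated lists of digits for a list of monomials. -/
def withDigitLists {α : Type} (n : ℕ) : List (List ℕ) → (List (List (List ℕ)) → α) → α
  | [], f => f []
  | l :: L, f => withDigits n l fun x => withDigitLists n L fun xs => f (x :: xs)

theorem withDigitLists_eq {α : Type} (n : ℕ) (L : List (List ℕ))
    (f : List (List (List ℕ)) → α) : withDigitLists n L f = f (L.map (digitLists n)) := by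
  induction L generalizing f with
  | nil => rfl
  | cons l L ih => rw [withDigitLists, withDigits_eq, ih]; rfl

/-- Decides that `N` sums of coefficients after linear substitutions separate the given monomials. -/
def checkIndependent (N n : ℕ) (rows low : List (List ℕ)) (B : List (Fin 5 → ℕ)) : Bool :=
  withValue (Nat.sub (Nat.pow 2 N) 1) fun full => withDigitLists n low fun L =>
    withValues (B.map fun f => withDigits n (exponentList f) fun x => digitMaskSum full rows x L)
      (independentRows N)

/-- The weight vector of a monomial with exponents less than `32`. -/
def weightList (l : List ℕ) : List ℕ :=
  (List.range 5).map fun j => listSum (l.map fun a => Nat.mod (Nat.div a (Nat.pow 2 j)) 2)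

/-- The lexicographical order. -/
def lexLT : List ℕ → List ℕ → Bool
  | a :: l, b :: m => Nat.blt a b || (Nat.beq a b && lexLT l m)
  | _, _ => false

theorem toLex_lt_of_lexLT {l m : List ℕ} (h : lexLT l m = true) :
    toLex (fun k => l.getD k 0) < toLex (fun k => m.getD k 0) := by
  rw [toLex_lt_iff]
  induction l generalizing m with
  | nil => cases h
  | cons a l ih =>
    cases m with
    | nil => cases h
    | cons b m =>
      rw [lexLT, Bool.or_eq_true, Bool.and_eq_true] at h
      rcases h with h | ⟨h, h'⟩
      · exact ⟨0, by simp, by simpa [Nat.blt_eq] using h⟩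
      · obtain ⟨i, hi, hlt⟩ := ih h'
        obtain rfl : a = b := Nat.eq_of_beq_eq_true h
        refine ⟨i + 1, fun j hj => ?_, hlt⟩
        rcases j with _ | j
        · rfl
        · exact hi j (by omega)

/-- Whether a list has five entries, all of them less than `2 ^ n`. -/
def isExponentList (n : ℕ) (l : List ℕ) : Bool :=
  Nat.beq l.length 5 && l.all fun a => Nat.blt a (Nat.pow 2 n)

theorem isExponentList_iff {n : ℕ} {l : List ℕ} :
    isExponentList n l = true ↔ l.length = 5 ∧ ∀ a ∈ l, a < 2 ^ n := by
  rw [isExponentList, Bool.and_eq_true, List.all_eq_true]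
  exact and_congr (by rw [Nat.beq_eq]) (forall₂_congr fun a _ => by rw [Nat.blt_eq]; rfl)

theorem weight_expo_eq_weightList {l : List ℕ} (h : isExponentList 5 l = true) :
    weight (expo l) = fun k => (weightList l).getD k 0 := by
  obtain ⟨h5, h32⟩ := isExponentList_iff.1 h
  obtain ⟨a, b, c, d, e, rfl⟩ := exists_eq_of_length_eq_five h5
  funext k
  rcases lt_or_ge k 5 with hk | hk
  · rw [weight_expo]
    have : ((weightList [a, b, c, d, e]).getD k 0) =
        listSum ([a, b, c, d, e].map fun a => Nat.mod (Nat.div a (Nat.pow 2 k)) 2) := by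
      rw [weightList, List.getD_eq_getElem _ _ (by simpa using hk), List.getElem_map,
        List.getElem_range]
    rw [this]
    change _ = a / 2 ^ k % 2 + (b / 2 ^ k % 2 + (c / 2 ^ k % 2 + (d / 2 ^ k % 2 +
      (e / 2 ^ k % 2 + 0))))
    omega
  · rw [List.getD_eq_default _ _ (by simpa [weightList] using hk)]
    refine weight_eq_zero_of_lt (d := 5) (fun i => ?_) hk
    simp at h32
    fin_cases i <;> simp [h32]

/-- Decides that the sum of the coefficients at the monomials in two lists vanishes on the hit
polynomials, and that their weight vectors are equal to or larger than the given one. -/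
def checkFunctional (ws : List ℕ) (low high : List (List ℕ)) : Bool :=
  ((low ++ high).all (isExponentList 5) && (low.all (fun s => decide (weightList s = ws)) &&
    high.all fun s => lexLT ws (weightList s))) &&
  (List.range 5).all fun e => checkDual (low ++ high) (Nat.pow 2 e)

/-- The substitution moves past the square, so the value is that of the original functional on an
image of Sq^(2^e); the matrix need not be invertible. In degree below 32 only the squares with e < 5
occur. -/
theorem coeffSum_linSubst_eq_zero_of_mem_hit {G : List (List ℕ)} {n : ℕ} (hn : n < 32)
    (hG : ∀ s ∈ G, isExponentList 5 s = true)
    (hc : ∀ e < 5, checkDual G (2 ^ e) = true) (A : Fin 5 → Fin 5 → ZMod 2) {f : Poly 5}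
    (hf : f ∈ hit 5 n) : coeffSum G (linSubst A f) = 0 := by
  have : hit 5 n ≤ LinearMap.ker ((coeffSum G).comp (linSubst A).toLinearMap) := by
    refine iSup_le fun e => iSup_le fun m => iSup_le fun h => ?_
    rintro _ ⟨g, _, rfl⟩
    have he : e < 5 := (Nat.pow_lt_pow_iff_right one_lt_two).1 (by omega : 2 ^ e < 2 ^ 5)
    change coeffSum G (linSubst A (Sq 5 (2 ^ e) g)) = 0
    rw [← Sq_linSubst]
    exact coeffSum_Sq_eq_zero (fun s hs => (isExponentList_iff.1 (hG s hs)).1)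
      (fun s hs => (isExponentList_iff.1 (hG s hs)).2) (hc e he) _
  exact this hf

/-- A monomial of weight vector below ω cannot acquire, by a linear substitution, a term whose
weight vector is at least ω. -/
theorem coeffSum_linSubst_eq_zero_of_mem_polyLt {G : List (List ℕ)} {n : ℕ} {ω : ℕ → ℕ}
    (hG : ∀ s ∈ G, toLex ω ≤ toLex (weight (expo s))) (A : Fin 5 → Fin 5 → ZMod 2) {f : Poly 5}
    (hf : f ∈ polyLt 5 n ω) : coeffSum G (linSubst A f) = 0 := by
  have : polyLt 5 n ω ≤ LinearMap.ker ((coeffSum G).comp (linSubst A).toLinearMap) := by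
    refine Submodule.span_le.2 ?_
    rintro _ ⟨u, _, hu, rfl⟩
    change coeffSum G (linSubst A (mono u)) = 0
    rw [coeffSum_apply]
    refine List.sum_eq_zero fun x hx => ?_
    obtain ⟨s, hs, rfl⟩ := List.mem_map.1 hx
    exact coeff_linSubst_mono_eq_zero A (hu.trans_le (hG s hs))
  exact this hf

/-- The family of the sums of coefficients after the given linear substitutions. -/
noncomputable def functionals (rows low high : List (List ℕ)) (N : ℕ) :
    Poly 5 →ₗ[ZMod 2] ℕ → ZMod 2 :=
  LinearMap.pi fun i => if i < N then
    (coeffSum (low ++ high)).comp (linSubst (formMatrix rows i)).toLinearMap else 0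

/-- The exponents in `high` are needed for vanishing on the hit polynomials, but they contribute
nothing at a monomial of weight vector `ws`, because a substitution yields no term of larger weight
vector. Only `low` enters the computation. -/
theorem functionals_mono {ws : List ℕ} {rows low high : List (List ℕ)} {N n : ℕ} {f : Fin 5 → ℕ}
    (hc : checkFunctional ws low high = true) (hr5 : rows.length = 5)
    (hr : ∀ r ∈ rows, r.length = 5) (hlow : ∀ s ∈ low, ∀ a ∈ s, a < 2 ^ n)
    (hf : ∀ i, f i < 2 ^ n) (hw : weight (expo (exponentList f)) = fun k => ws.getD k 0) :
    functionals rows low high N (mono (expo (exponentList f))) =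
      bitVec (digitMaskSum (2 ^ N - 1) rows (digitLists n (exponentList f))
        (low.map (digitLists n))) := by
  simp only [checkFunctional, Bool.and_eq_true, List.all_eq_true, decide_eq_true_eq] at hc
  obtain ⟨⟨hexp, hlw, hhw⟩, _⟩ := hc
  funext i
  rw [functionals, LinearMap.pi_apply, bitVec, zbit_testBit_digitMaskSum]
  split_ifs with hi
  · have hfull : (2 ^ N - 1).testBit i = true := by
      rw [Nat.testBit_two_pow_sub_one]; exact decide_eq_true hi
    change coeffSum (low ++ high) (linSubst (formMatrix rows i) _) = _
    rw [coeffSum_apply, List.map_append, List.sum_append, List.map_map]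
    have hz : (high.map fun s => (linSubst (formMatrix rows i)
        (mono (expo (exponentList f)))).coeff (expo s)).sum = 0 := by
      refine List.sum_eq_zero fun x hx => ?_
      obtain ⟨s, hs, rfl⟩ := List.mem_map.1 hx
      refine coeff_linSubst_mono_eq_zero _ ?_
      rw [hw, weight_expo_eq_weightList (hexp s (List.mem_append_right _ hs))]
      exact toLex_lt_of_lexLT (hhw s hs)
    rw [hz, add_zero]
    refine congrArg List.sum (List.map_congr_left fun s hs => ?_)
    have hs5 := hexp s (List.mem_append_left _ hs)
    refine coeff_linSubst_eq_digitMask hfull hr hr5 n _ _ rfl (isExponentList_iff.1 hs5).1 ?_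
      (hlow s hs) ?_
    · intro a ha
      simp only [exponentList, List.mem_cons, List.not_mem_nil, or_false] at ha
      rcases ha with rfl | rfl | rfl | rfl | rfl <;> exact hf _
    · rw [hw, weight_expo_eq_weightList hs5, hlw s hs]
  -- The mask 2^N - 1 has no bits from the place N on, so both sides are zero there.
  · symm
    refine List.sum_eq_zero fun x hx => ?_
    obtain ⟨ys, _, rfl⟩ := List.mem_map.1 hx
    have h0 : (digitMask (2 ^ N - 1) rows (digitLists n (exponentList f)) ys).testBit i = false := by
      refine Bool.eq_false_iff.mpr fun h => ?_
      have := testBit_of_testBit_digitMask h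
      rw [Nat.testBit_two_pow_sub_one] at this
      exact hi (of_decide_eq_true this)
    simp only [h0]
    rfl

theorem functionals_eq_zero {ws : List ℕ} {rows low high : List (List ℕ)} {N d : ℕ} {f : Poly 5}
    (hd : d < 32) (hc : checkFunctional ws low high = true)
    (hf : f ∈ hit 5 d ⊔ polyLt 5 d fun k => ws.getD k 0) :
    functionals rows low high N f = 0 := by
  simp only [checkFunctional, Bool.and_eq_true, List.all_eq_true, decide_eq_true_eq] at hc
  obtain ⟨⟨hexp, hlw, hhw⟩, hdual⟩ := hc
  funext i
  rw [functionals, LinearMap.pi_apply]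
  split_ifs with hi
  · obtain ⟨g, hg, h, hh, rfl⟩ := Submodule.mem_sup.1 hf
    change coeffSum (low ++ high) (linSubst (formMatrix rows i) (g + h)) = 0
    rw [map_add, map_add, coeffSum_linSubst_eq_zero_of_mem_hit hd hexp
      (fun e he => hdual e (List.mem_range.2 he)) _ hg, zero_add]
    refine coeffSum_linSubst_eq_zero_of_mem_polyLt (fun s hs => ?_) _ hh
    rw [weight_expo_eq_weightList (hexp s hs)]
    rcases List.mem_append.1 hs with hs | hs
    · rw [hlw s hs]
    · exact (toLex_lt_of_lexLT (hhw s hs)).le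
  · rfl

/-- Monomials that are separated by the functionals are linearly independent. -/
theorem eq_zero_of_sum_mem {ws : List ℕ} {rows low high : List (List ℕ)} {N n d : ℕ}
    {B : List (Fin 5 → ℕ)} (hd : d < 32) (hc : checkFunctional ws low high = true)
    (hr : rows.all (fun r => Nat.beq r.length 5) = true) (hr5 : rows.length = 5)
    (hlow : low.all (isExponentList n) = true)
    (hB : ∀ f ∈ B, (∀ i, f i < 2 ^ n) ∧ weightList (exponentList f) = ws) (hn : n ≤ 5)
    (hi : checkIndependent N n rows low B = true) (g : Fin B.length → ZMod 2)
    (hg : ∑ i, g i • mono (expo (exponentList (B.get i))) ∈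
      hit 5 d ⊔ polyLt 5 d fun k => ws.getD k 0) : g = 0 := by
  have h0 := functionals_eq_zero (rows := rows) (N := N) hd hc hg
  rw [map_sum] at h0
  rw [checkIndependent, withValue_eq, withDigitLists_eq, withValues_eq] at hi
  have hli := linearIndependent_bitVec hi
  set L := B.map fun f => withDigits n (exponentList f) fun x =>
    digitMaskSum (Nat.sub (Nat.pow 2 N) 1) rows x (low.map (digitLists n)) with hL
  have hlen : L.length = B.length := List.length_map _
  have hli := hli.comp (Fin.cast hlen.symm) (Fin.cast_injective _)
  rw [Fintype.linearIndependent_iff] at hli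
  funext i
  refine hli g ?_ i
  rw [← h0]
  refine Finset.sum_congr rfl fun k _ => ?_
  obtain ⟨hf, hw⟩ := hB (B.get k) (List.get_mem _ _)
  have h32 : isExponentList 5 (exponentList (B.get k)) = true := by
    refine isExponentList_iff.2 ⟨rfl, fun a ha => ?_⟩
    simp only [exponentList, List.mem_cons, List.not_mem_nil, or_false] at ha
    have h2 : 2 ^ n ≤ 2 ^ 5 := Nat.pow_le_pow_right two_pos hn
    rcases ha with rfl | rfl | rfl | rfl | rfl <;> exact (hf _).trans_le h2
  rw [map_smul, functionals_mono hc hr5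
    (fun r h => Nat.eq_of_beq_eq_true (List.all_eq_true.1 hr r h))
    (fun s h => (isExponentList_iff.1 (List.all_eq_true.1 hlow s h)).2) hf
    (by rw [weight_expo_eq_weightList h32, hw])]
  simp only [Function.comp_apply, hL, List.get_eq_getElem, List.getElem_map, withDigits_eq,
    Fin.val_cast]
  rfl

/-! ### The functionals -/

/-- The exponents of weight vector `(3,2,2,2)` in a functional that vanishes on the hit polynomials. -/
def dualLowTwo : List (List ℕ) := [
    [1, 2, 1, 13, 14], [1, 2, 2, 13, 13], [1, 2, 4, 13, 11], [1, 2, 8, 13, 7], [1, 2, 12, 3,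
    13], [1, 2, 12, 5, 11], [1, 2, 12, 9, 7], [1, 3, 4, 9, 14], [1, 3, 4, 10, 13], [1, 3, 4, 12,
    11], [1, 3, 8, 5, 14], [1, 3, 8, 6, 13], [1, 3, 8, 12, 7], [1, 4, 1, 11, 14], [1, 4, 2, 11,
    13], [1, 4, 4, 11, 11], [1, 4, 8, 11, 7], [1, 4, 10, 3, 13], [1, 4, 10, 5, 11], [1, 4, 10,
    9, 7], [1, 5, 2, 9, 14], [1, 5, 2, 10, 13], [1, 5, 2, 12, 11], [1, 5, 8, 3, 14], [1, 5, 8,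
    6, 11], [1, 5, 8, 10, 7], [1, 6, 1, 9, 14], [1, 6, 1, 10, 13], [1, 6, 1, 12, 11], [1, 6, 8,
    3, 13], [1, 6, 8, 5, 11], [1, 6, 8, 9, 7], [1, 8, 1, 7, 14], [1, 8, 2, 7, 13], [1, 8, 4, 7,
    11], [1, 8, 6, 3, 13], [1, 8, 6, 5, 11], [1, 8, 6, 9, 7], [1, 8, 8, 7, 7], [1, 9, 2, 5, 14],
    [1, 9, 2, 6, 13], [1, 9, 2, 12, 7], [1, 9, 4, 3, 14], [1, 9, 4, 6, 11], [1, 9, 4, 10, 7],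
    [1, 10, 1, 5, 14], [1, 10, 1, 6, 13], [1, 10, 1, 12, 7], [1, 10, 4, 3, 13], [1, 10, 4, 5,
    11], [1, 10, 4, 9, 7], [1, 12, 1, 3, 14], [1, 12, 1, 6, 11], [1, 12, 1, 10, 7], [1, 12, 2,
    3, 13], [1, 12, 2, 5, 11], [1, 12, 2, 9, 7], [2, 1, 1, 13, 14], [2, 1, 2, 13, 13], [2, 1, 4,
    13, 11], [2, 1, 8, 13, 7], [2, 1, 12, 3, 13], [2, 1, 12, 5, 11], [2, 1, 12, 9, 7], [2, 4, 9,
    3, 13], [2, 4, 9, 5, 11], [2, 4, 9, 9, 7], [2, 8, 5, 3, 13], [2, 8, 5, 5, 11], [2, 8, 5, 9,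
    7], [3, 1, 4, 9, 14], [3, 1, 4, 10, 13], [3, 1, 4, 12, 11], [3, 1, 8, 5, 14], [3, 1, 8, 6,
    13], [3, 1, 8, 12, 7], [4, 1, 1, 11, 14], [4, 1, 2, 11, 13], [4, 1, 4, 11, 11], [4, 1, 8,
    11, 7], [4, 1, 10, 3, 13], [4, 1, 10, 5, 11], [4, 1, 10, 9, 7], [4, 2, 9, 3, 13], [4, 2, 9,
    5, 11], [4, 2, 9, 9, 7], [4, 8, 3, 3, 13], [4, 8, 3, 5, 11], [4, 8, 3, 9, 7], [5, 1, 2, 9,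
    14], [5, 1, 2, 10, 13], [5, 1, 2, 12, 11], [5, 1, 8, 3, 14], [5, 1, 8, 6, 11], [5, 1, 8, 10,
    7], [6, 1, 1, 9, 14], [6, 1, 1, 10, 13], [6, 1, 1, 12, 11], [6, 1, 8, 3, 13], [6, 1, 8, 5,
    11], [6, 1, 8, 9, 7], [8, 1, 1, 7, 14], [8, 1, 2, 7, 13], [8, 1, 4, 7, 11], [8, 1, 6, 3,
    13], [8, 1, 6, 5, 11], [8, 1, 6, 9, 7], [8, 1, 8, 7, 7], [8, 2, 5, 3, 13], [8, 2, 5, 5, 11],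
    [8, 2, 5, 9, 7], [8, 4, 3, 3, 13], [8, 4, 3, 5, 11], [8, 4, 3, 9, 7], [9, 1, 2, 5, 14], [9,
    1, 2, 6, 13], [9, 1, 2, 12, 7], [9, 1, 4, 3, 14], [9, 1, 4, 6, 11], [9, 1, 4, 10, 7], [10,
    1, 1, 5, 14], [10, 1, 1, 6, 13], [10, 1, 1, 12, 7], [10, 1, 4, 3, 13], [10, 1, 4, 5, 11],
    [10, 1, 4, 9, 7], [12, 1, 1, 3, 14], [12, 1, 1, 6, 11], [12, 1, 1, 10, 7], [12, 1, 2, 3,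
    13], [12, 1, 2, 5, 11], [12, 1, 2, 9, 7], [15, 15, 1, 0, 0]]

/-- The remaining exponents in this functional. -/
def dualHighTwo : List (List ℕ) := [
    [1, 1, 3, 13, 13], [1, 1, 5, 11, 13], [1, 1, 7, 11, 11], [1, 1, 9, 7, 13], [1, 1, 11, 11,
    7], [1, 1, 13, 3, 13], [1, 1, 13, 5, 11], [1, 1, 13, 9, 7], [1, 2, 6, 11, 11], [1, 2, 7, 7,
    14], [1, 2, 7, 14, 7], [1, 2, 10, 7, 11], [1, 2, 14, 7, 7], [1, 3, 1, 13, 13], [1, 3, 2, 11,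
    14], [1, 3, 6, 14, 7], [1, 3, 10, 3, 14], [1, 3, 10, 6, 11], [1, 3, 10, 10, 7], [1, 4, 6,
    13, 7], [1, 4, 12, 7, 7], [1, 5, 1, 13, 11], [1, 5, 4, 7, 14], [1, 5, 6, 5, 14], [1, 5, 6,
    6, 13], [1, 5, 6, 12, 7], [1, 5, 11, 7, 7], [1, 6, 2, 11, 11], [1, 6, 4, 7, 13], [1, 6, 6,
    11, 7], [1, 7, 1, 11, 11], [1, 7, 2, 14, 7], [1, 7, 4, 5, 14], [1, 7, 4, 6, 13], [1, 7, 4,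
    12, 7], [1, 7, 5, 7, 11], [1, 7, 5, 11, 7], [1, 7, 6, 3, 14], [1, 7, 6, 6, 11], [1, 7, 6,
    10, 7], [1, 9, 1, 13, 7], [1, 9, 7, 7, 7], [1, 10, 2, 11, 7], [1, 11, 1, 7, 11], [1, 11, 2,
    3, 14], [1, 11, 2, 6, 11], [1, 11, 2, 10, 7], [1, 12, 4, 7, 7], [1, 13, 1, 3, 13], [1, 13,
    1, 5, 11], [1, 13, 1, 9, 7], [1, 13, 3, 7, 7], [1, 14, 2, 7, 7], [2, 1, 6, 11, 11], [2, 1,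
    7, 7, 14], [2, 1, 7, 14, 7], [2, 1, 10, 7, 11], [2, 1, 14, 7, 7], [2, 2, 3, 13, 11], [2, 2,
    5, 11, 11], [2, 2, 7, 7, 13], [2, 2, 9, 7, 11], [2, 2, 11, 3, 13], [2, 2, 11, 5, 11], [2, 2,
    11, 9, 7], [2, 2, 13, 7, 7], [2, 3, 3, 9, 14], [2, 3, 3, 10, 13], [2, 3, 3, 12, 11], [2, 3,
    5, 14, 7], [2, 3, 7, 5, 14], [2, 3, 7, 6, 13], [2, 3, 7, 12, 7], [2, 3, 9, 3, 14], [2, 3, 9,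
    6, 11], [2, 3, 9, 10, 7], [2, 3, 12, 7, 7], [2, 4, 3, 11, 11], [2, 4, 5, 13, 7], [2, 4, 7,
    11, 7], [2, 4, 11, 7, 7], [2, 5, 3, 7, 14], [2, 5, 5, 5, 14], [2, 5, 5, 6, 13], [2, 5, 5,
    12, 7], [2, 5, 7, 3, 14], [2, 5, 7, 6, 11], [2, 5, 7, 10, 7], [2, 6, 3, 7, 13], [2, 6, 5,
    11, 7], [2, 6, 7, 3, 13], [2, 6, 7, 5, 11], [2, 6, 7, 9, 7], [2, 7, 1, 7, 14], [2, 7, 1, 14,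
    7], [2, 7, 2, 7, 13], [2, 7, 2, 13, 7], [2, 7, 3, 5, 14], [2, 7, 3, 6, 13], [2, 7, 3, 12,
    7], [2, 7, 4, 7, 11], [2, 7, 4, 11, 7], [2, 7, 5, 3, 14], [2, 7, 5, 6, 11], [2, 7, 5, 10,
    7], [2, 7, 8, 7, 7], [2, 8, 3, 7, 11], [2, 8, 7, 7, 7], [2, 9, 3, 3, 14], [2, 9, 3, 6, 11],
    [2, 9, 3, 10, 7], [2, 10, 3, 3, 13], [2, 10, 3, 5, 11], [2, 10, 3, 9, 7], [2, 11, 4, 7, 7],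
    [2, 12, 3, 7, 7], [2, 13, 2, 7, 7], [2, 14, 1, 7, 7], [3, 1, 1, 13, 13], [3, 1, 2, 11, 14],
    [3, 1, 6, 14, 7], [3, 1, 10, 3, 14], [3, 1, 10, 6, 11], [3, 1, 10, 10, 7], [3, 1, 13, 7, 7],
    [3, 2, 3, 9, 14], [3, 2, 3, 10, 13], [3, 2, 3, 12, 11], [3, 2, 5, 14, 7], [3, 2, 7, 5, 14],
    [3, 2, 7, 6, 13], [3, 2, 7, 12, 7], [3, 2, 9, 3, 14], [3, 2, 9, 6, 11], [3, 2, 9, 10, 7],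
    [3, 2, 12, 7, 7], [3, 4, 3, 14, 7], [3, 4, 5, 5, 14], [3, 4, 5, 6, 13], [3, 4, 5, 12, 7],
    [3, 4, 7, 3, 14], [3, 4, 7, 6, 11], [3, 4, 7, 10, 7], [3, 4, 10, 7, 7], [3, 5, 5, 11, 7],
    [3, 5, 6, 3, 14], [3, 5, 6, 6, 11], [3, 5, 6, 10, 7], [3, 5, 7, 3, 13], [3, 5, 7, 5, 11],
    [3, 5, 7, 9, 7], [3, 5, 9, 7, 7], [3, 6, 3, 5, 14], [3, 6, 3, 6, 13], [3, 6, 3, 12, 7], [3,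
    6, 6, 3, 13], [3, 6, 6, 5, 11], [3, 6, 6, 9, 7], [3, 8, 3, 3, 14], [3, 8, 3, 6, 11], [3, 8,
    3, 10, 7], [3, 8, 6, 7, 7], [4, 1, 6, 13, 7], [4, 1, 12, 7, 7], [4, 2, 3, 11, 11], [4, 2, 5,
    13, 7], [4, 2, 7, 11, 7], [4, 2, 11, 7, 7], [4, 3, 3, 14, 7], [4, 3, 5, 5, 14], [4, 3, 5, 6,
    13], [4, 3, 5, 12, 7], [4, 3, 7, 3, 14], [4, 3, 7, 6, 11], [4, 3, 7, 10, 7], [4, 3, 10, 7,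
    7], [4, 4, 3, 13, 7], [4, 4, 5, 11, 7], [4, 4, 7, 3, 13], [4, 4, 7, 5, 11], [4, 4, 7, 9, 7],
    [4, 4, 9, 7, 7], [4, 5, 3, 5, 14], [4, 5, 3, 6, 13], [4, 5, 3, 12, 7], [4, 5, 5, 3, 14], [4,
    5, 5, 6, 11], [4, 5, 5, 10, 7], [4, 6, 3, 11, 7], [4, 6, 5, 3, 13], [4, 6, 5, 5, 11], [4, 6,
    5, 9, 7], [4, 7, 3, 3, 14], [4, 7, 3, 6, 11], [4, 7, 3, 10, 7], [4, 7, 6, 7, 7], [4, 8, 5,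
    7, 7], [5, 1, 1, 13, 11], [5, 1, 4, 7, 14], [5, 1, 6, 5, 14], [5, 1, 6, 6, 13], [5, 1, 6,
    12, 7], [5, 2, 3, 7, 14], [5, 2, 5, 5, 14], [5, 2, 5, 6, 13], [5, 2, 5, 12, 7], [5, 2, 7, 3,
    14], [5, 2, 7, 6, 11], [5, 2, 7, 10, 7], [5, 3, 3, 13, 7], [5, 3, 6, 3, 14], [5, 3, 6, 6,
    11], [5, 3, 6, 10, 7], [5, 4, 3, 5, 14], [5, 4, 3, 6, 13], [5, 4, 3, 12, 7], [5, 4, 5, 3,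
    14], [5, 4, 5, 6, 11], [5, 4, 5, 10, 7], [5, 7, 3, 3, 13], [5, 7, 3, 5, 11], [5, 7, 3, 9,
    7], [5, 7, 5, 7, 7], [6, 1, 2, 11, 11], [6, 1, 4, 7, 13], [6, 1, 6, 11, 7], [6, 2, 3, 7,
    13], [6, 2, 5, 11, 7], [6, 2, 7, 3, 13], [6, 2, 7, 5, 11], [6, 2, 7, 9, 7], [6, 3, 3, 5,
    14], [6, 3, 3, 6, 13], [6, 3, 3, 12, 7], [6, 3, 6, 3, 13], [6, 3, 6, 5, 11], [6, 3, 6, 9,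
    7], [6, 4, 3, 11, 7], [6, 4, 5, 3, 13], [6, 4, 5, 5, 11], [6, 4, 5, 9, 7], [7, 1, 1, 11,
    11], [7, 1, 2, 14, 7], [7, 1, 3, 7, 13], [7, 1, 4, 5, 14], [7, 1, 4, 6, 13], [7, 1, 4, 12,
    7], [7, 1, 5, 11, 7], [7, 1, 6, 3, 14], [7, 1, 6, 6, 11], [7, 1, 6, 10, 7], [7, 1, 9, 7, 7],
    [7, 2, 1, 7, 14], [7, 2, 1, 14, 7], [7, 2, 2, 7, 13], [7, 2, 2, 13, 7], [7, 2, 3, 5, 14],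
    [7, 2, 3, 6, 13], [7, 2, 3, 12, 7], [7, 2, 4, 7, 11], [7, 2, 4, 11, 7], [7, 2, 5, 3, 14],
    [7, 2, 5, 6, 11], [7, 2, 5, 10, 7], [7, 2, 8, 7, 7], [7, 3, 5, 3, 13], [7, 3, 5, 5, 11], [7,
    3, 5, 9, 7], [7, 4, 3, 3, 14], [7, 4, 3, 6, 11], [7, 4, 3, 10, 7], [7, 4, 6, 7, 7], [8, 2,
    3, 7, 11], [8, 2, 7, 7, 7], [8, 3, 3, 3, 14], [8, 3, 3, 6, 11], [8, 3, 3, 10, 7], [8, 3, 6,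
    7, 7], [8, 4, 5, 7, 7], [9, 1, 1, 13, 7], [9, 2, 3, 3, 14], [9, 2, 3, 6, 11], [9, 2, 3, 10,
    7], [10, 1, 2, 11, 7], [10, 2, 3, 3, 13], [10, 2, 3, 5, 11], [10, 2, 3, 9, 7], [11, 1, 1, 7,
    11], [11, 1, 2, 3, 14], [11, 1, 2, 6, 11], [11, 1, 2, 10, 7], [11, 2, 4, 7, 7], [11, 3, 3,
    7, 7], [12, 1, 4, 7, 7], [12, 2, 3, 7, 7], [13, 1, 1, 3, 13], [13, 1, 1, 5, 11], [13, 1, 1,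
    9, 7], [13, 1, 3, 7, 7], [13, 2, 2, 7, 7], [14, 1, 2, 7, 7], [14, 2, 1, 7, 7]]

/-- Linear substitutions for the weight vector `(3,2,2,2)`: the `i`-th bits of the entries form the
matrix of the `i`-th one. -/
def substitutionsTwo : List (List ℕ) := [
    [0x5a5dced54e57af4a4edf51137b943a24b646da531480c243bb874d,
      0x4852a357f6055b71f8f8e25bc6fb791bfeffb9c4fbcf88acab0a09,
      0x6c8bbe00c3f49dff2a096c4ede1fc319e9f8360dc2183f597330cd,
      0x2ef0ed2a16edbff55a070783fb4717e9021060e123fcf29c611d72,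
      0x49ea791bac6b73886f7d6360e1f51586badd32032964034444f58f],
    [0x7d38de416bbcce999ea9734565089375271bf44dade34b75dcaaac,
      0x24c95733833f988afce9fa7dbb33e5e2a86ebfb76b8db4f08fb517,
      0x2dfcb5cd945ffc29e35877387c8ed51b6dfe6b1369e3aceea39bf9,
      0x64bd116fa67b5522852fda15646a9ecbc8cf8e58b8733beb0671cb,
      0x2797105111f163fd82c0bcb37d1ce61db446a4fd95768b6d41fb6d],
    [0x3d217cf7bfaaa015f430a32e43b7d83a4dd4257706d8d7630ff73c,
      0x47af0faa7dec5f4d9d197e9e9e6d5bf0f8abf42c487aef4ba625b8,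
      0x1a064edba8b393ee35d87e1fe573ac87474401edc95b64e9f6c7d0,
      0x2382cc3ac8acc1c19f342feb615dca1b898eb71296b57ad17bf4d3,
      0x1477536f042fb402643b15168c90eebb37063fee7c12ea8626cc3f],
    [0x14aa541abc678c4cc9ad9edd9dc5758e9e915562cd44fd574d5f4a,
      0x241b91f5204911006fdc6fd0e6960c5e3783798f3551150bdb6c97,
      0x3d0eea47d363efd4c6e10bf19fe2e7d73edbf8b9f225be04859b2,
      0x7b664b5854c7e40b13124dede25b960d8d9bbd6dc2dcbdd263fd20,
      0x40c5ce98aa36856819c46c4b086f60cab01658b1cadd9c901b19f0],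
    [0x189f774da03916e5593fa3dab465f7c424b0fcb6549b03d9edb9d8,
      0x37ab4d4c8dd53f5a6cfe646c0a0900c73cb5526ea1693fa1655dfb,
      0x24a99208b98f2ca5cc41afbbbef4462ff74ac7a9e63e256cf27f87,
      0x40a8b9cfc36aa130f9afc675f7c74ff2dc4caef3ec73c85e005152,
      0x70f89a72e3bec2bdcaaa1edb7b985379742cd6e0d542c6b7957d76]]

/-- The exponents of weight vector `(3,4,3,1)` in a functional that vanishes on the hit polynomials. -/
def dualLowThree : List (List ℕ) := [
    [3, 5, 6, 3, 14], [3, 5, 6, 6, 11], [3, 5, 6, 10, 7], [3, 6, 5, 3, 14], [3, 6, 5, 6, 11],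
    [3, 6, 5, 10, 7], [3, 6, 6, 3, 13], [3, 6, 6, 5, 11], [3, 6, 6, 9, 7], [5, 3, 6, 3, 14], [5,
    3, 6, 6, 11], [5, 3, 6, 10, 7], [5, 6, 3, 3, 14], [5, 6, 3, 6, 11], [5, 6, 3, 10, 7], [6, 3,
    5, 3, 14], [6, 3, 5, 6, 11], [6, 3, 5, 10, 7], [6, 3, 6, 3, 13], [6, 3, 6, 5, 11], [6, 3, 6,
    9, 7], [6, 5, 3, 3, 14], [6, 5, 3, 6, 11], [6, 5, 3, 10, 7], [6, 6, 3, 3, 13], [6, 6, 3, 5,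
    11], [6, 6, 3, 9, 7]]

/-- The remaining exponents in this functional. -/
def dualHighThree : List (List ℕ) := [
    [3, 3, 3, 11, 11], [3, 3, 5, 7, 13], [3, 3, 9, 3, 13], [3, 3, 9, 5, 11], [3, 3, 9, 9, 7],
    [3, 5, 5, 11, 7], [3, 5, 9, 7, 7], [3, 7, 5, 3, 13], [3, 7, 5, 5, 11], [3, 7, 5, 9, 7], [3,
    9, 3, 3, 13], [3, 9, 3, 5, 11], [3, 9, 3, 9, 7], [3, 9, 5, 7, 7], [3, 11, 3, 7, 7], [5, 3,
    3, 7, 13], [5, 3, 5, 7, 11], [5, 3, 5, 11, 7], [5, 3, 7, 3, 13], [5, 3, 7, 5, 11], [5, 3, 7,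
    9, 7], [5, 5, 3, 11, 7], [5, 5, 5, 3, 13], [5, 5, 5, 5, 11], [5, 5, 5, 9, 7], [5, 5, 7, 7,
    7], [5, 6, 6, 7, 7], [6, 5, 6, 7, 7], [6, 6, 5, 7, 7], [7, 3, 3, 11, 7], [7, 3, 5, 3, 13],
    [7, 3, 5, 5, 11], [7, 3, 5, 9, 7], [9, 3, 3, 3, 13], [9, 3, 3, 5, 11], [9, 3, 3, 9, 7], [9,
    3, 5, 7, 7]]

/-- Linear substitutions for the weight vector `(3,4,3,1)`: the `i`-th bits of the entries form the
matrix of the `i`-th one. -/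
def substitutionsThree : List (List ℕ) := [
    [0x1be8f28957a4920171,
      0x2f315f40fd6b741c61,
      0x3573c3e8e99a49eb65,
      0x28c1e8df86617b8e22,
      0x1f753ed45d8520269d],
    [0x117a212b873bb63795,
      0x1d7fe67749cd75d0f2,
      0x3f3c91b0aa85355c77,
      0x21ea0d3ee8b30db8cd,
      0x301ca3b8d07aa83e39],
    [0xe1676e1282cdaf0fb,
      0x137bcdcf7b180b68c7,
      0x373b2e74a47a2f5bde,
      0x2142be8c986df837e,
      0xfcb123d95fd8b04db],
    [0x194bb8d45f26a3e6a9,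
      0xf315292175daceb6e,
      0x398ebf9bb5d6e2b20e,
      0x12a74b78c93a59e278,
      0x30300dc653425cc166],
    [0x2bd18cfe034c9c2ab7,
      0x1fb641469bbf25f2af,
      0x2855de99f6d3c97f4c,
      0x2de7f8df78e78e0c0a,
      0x3988f30bb3e2a255aa]]

/-- The entry (15,15,1,0,0) is a spike: all exponents have the form 2^k - 1. Such a monomial occurs
in no image of a positive square, so its coefficient alone kills the hit polynomials and can be
added to a functional without affecting this. -/
theorem checkFunctional_two :
    checkFunctional [3, 2, 2, 2, 0] dualLowTwo dualHighTwo = true := by decide +kernel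

theorem checkFunctional_three :
    checkFunctional [3, 4, 3, 1, 0] dualLowThree dualHighThree = true := by decide +kernel

/-- There are as many substitutions as monomials, so the matrix of values is square; four binary
places suffice as the exponents are below 16. -/
theorem checkIndependent_two :
    checkIndependent 215 4 substitutionsTwo dualLowTwo exponents2 = true := by decide +kernel

theorem checkIndependent_three :
    checkIndependent 70 4 substitutionsThree dualLowThree exponents3 = true := by decide +kernel

/-- The coefficient of the spike x₁³¹ vanishes on the hit polynomials, and the substitution of x₁
for every variable maps x₁ x₂² x₃⁴ x₄⁸ x₅¹⁶ to this spike. -/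
theorem checkFunctional_one :
    checkFunctional [1, 1, 1, 1, 1] [[31, 0, 0, 0, 0]] [] = true := by decide +kernel

theorem checkIndependent_one :
    checkIndependent 1 5 [[1, 0, 0, 0, 0], [1, 0, 0, 0, 0], [1, 0, 0, 0, 0], [1, 0, 0, 0, 0],
      [1, 0, 0, 0, 0]] [[31, 0, 0, 0, 0]] exponents1 = true := by decide +kernel

/-! ### The positive part -/

open Classical in
/-- The projection onto the monomials in which every variable occurs. -/
noncomputable def posPart (t : ℕ) : Poly t →ₗ[ZMod 2] Poly t :=
  (MvPolynomial.basisMonomials (Fin t) (ZMod 2)).constr (ZMod 2) fun u =>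
    if ∀ i, 0 < u i then mono u else 0

open Classical in
theorem posPart_mono {t : ℕ} (u : Fin t →₀ ℕ) :
    posPart t (mono u) = if ∀ i, 0 < u i then mono u else 0 := by
  have h : mono u = MvPolynomial.basisMonomials (Fin t) (ZMod 2) u := by
    rw [MvPolynomial.coe_basisMonomials]; rfl
  conv_lhs => rw [h, posPart, Module.Basis.constr_basis]

/-- Every term of a square of a monomial involves the same variables as the monomial, so the squares
preserve both the span of the positive monomials and the span of the others. -/
theorem Sq_posPart (k : ℕ) (f : Poly 5) : Sq 5 k (posPart 5 f) = posPart 5 (Sq 5 k f) := by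
  have : (Sq 5 k).comp (posPart 5) = (posPart 5).comp (Sq 5 k) := by
    refine MvPolynomial.linearMap_ext fun u => ?_
    ext1
    change Sq 5 k (posPart 5 (mono u)) = posPart 5 (Sq 5 k (mono u))
    obtain ⟨l, hl, rfl⟩ := exists_expo u
    have hpos : ∀ y ∈ sqTerms k l, (∀ i, 0 < expo y i) ↔ ∀ i, 0 < expo l i := by
      intro y hy
      refine forall_congr' fun i => ?_
      rw [expo_apply, expo_apply, Nat.pos_iff_ne_zero, Nat.pos_iff_ne_zero, ne_eq, ne_eq,
        zero_iff_of_mem_sqTerms hy]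
    rw [Sq_mono_expo hl, map_list_sum, List.map_map, posPart_mono]
    split_ifs with h
    · rw [Sq_mono_expo hl]
      refine congrArg List.sum (List.map_congr_left fun y hy => ?_)
      rw [Function.comp_apply, posPart_mono, if_pos ((hpos y hy).2 h)]
    · rw [map_zero, eq_comm]
      refine List.sum_eq_zero fun x hx => ?_
      obtain ⟨y, hy, rfl⟩ := List.mem_map.1 hx
      rw [Function.comp_apply, posPart_mono, if_neg fun h' => h ((hpos y hy).1 h')]
  exact LinearMap.congr_fun this f

theorem isHomogeneous_posPart {t n : ℕ} {f : Poly t} (hf : f.IsHomogeneous n) :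
    (posPart t f).IsHomogeneous n := by
  rw [poly_eq_sum_mono f, map_sum]
  refine MvPolynomial.IsHomogeneous.sum _ _ _ fun u hu => ?_
  rw [posPart_mono]
  split_ifs
  · have hn : u.degree = n :=
      by_contra fun hne => MvPolynomial.mem_support_iff.1 hu (hf.coeff_eq_zero hne)
    exact hn ▸ isHomogeneous_mono u
  · exact MvPolynomial.isHomogeneous_zero _ _ _

theorem posPart_mem_hit {n : ℕ} {f : Poly 5} (hf : f ∈ hit 5 n) : posPart 5 f ∈ hit 5 n := by
  have : hit 5 n ≤ (hit 5 n).comap (posPart 5) := by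
    refine iSup_le fun e => iSup_le fun m => iSup_le fun h => ?_
    rintro _ ⟨g, hg, rfl⟩
    rw [Submodule.mem_comap, ← Sq_posPart]
    exact Submodule.mem_iSup_of_mem e (Submodule.mem_iSup_of_mem m
      (Submodule.mem_iSup_of_mem h (Submodule.mem_map_of_mem (isHomogeneous_posPart hg))))
  exact this hf

/-! ### The order on the monomials -/

theorem monoLT_iff {t : ℕ} {u v : Fin t →₀ ℕ} : MonoLT u v ↔
    toLex (toLex (weight u), toLex ⇑u) < toLex (toLex (weight v), toLex ⇑v) := by
  rw [Prod.Lex.toLex_lt_toLex]; rfl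

theorem MonoLT.trans {t : ℕ} {u v w : Fin t →₀ ℕ} (h : MonoLT u v) (h' : MonoLT v w) :
    MonoLT u w :=
  monoLT_iff.2 ((monoLT_iff.1 h).trans (monoLT_iff.1 h'))

theorem MonoLT.irrefl {t : ℕ} (u : Fin t →₀ ℕ) : ¬ MonoLT u u :=
  fun h => lt_irrefl _ (monoLT_iff.1 h)

theorem finite_degree_eq (t n : ℕ) : Finite {u : Fin t →₀ ℕ // u.degree = n} := by
  refine (Set.finite_Iic (Finsupp.equivFunOnFinite.symm fun _ : Fin t => n)).subset ?_
  intro u hu i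
  exact (Finsupp.le_degree i u).trans hu.le

/-- A fixed degree has finitely many monomials, and on a finite set a transitive irreflexive
relation is well founded. -/
theorem monoLT_induction {t n : ℕ} {P : (Fin t →₀ ℕ) → Prop}
    (h : ∀ u, u.degree = n → (∀ v, v.degree = n → MonoLT v u → P v) → P u) (u : Fin t →₀ ℕ)
    (hu : u.degree = n) : P u := by
  have := finite_degree_eq t n
  have hwf : WellFounded fun u v : {u : Fin t →₀ ℕ // u.degree = n} => MonoLT u.1 v.1 :=
    @Finite.wellFounded_of_trans_of_irrefl _ _ _ ⟨fun _ _ _ => MonoLT.trans⟩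
      ⟨fun u => MonoLT.irrefl u.1⟩
  exact hwf.induction (C := fun u => P u.1) ⟨u, hu⟩ fun x hx =>
    h x.1 x.2 fun v hv hlt => hx ⟨v, hv⟩ hlt

/-! ### Bases of the positive part from admissible monomials -/

/-- Projecting the given relation to the positive monomials removes the smaller monomials with a
zero exponent and keeps the hit element hit. Of the remaining ones, those with another weight vector
have a smaller one and lie in `polyLt`, so only smaller positive monomials of weight vector ω have
to be dealt with. -/
theorem mono_mem_of_inadmissible {n : ℕ} {ω : ℕ → ℕ} {u : Fin 5 →₀ ℕ}
    {M : Submodule (ZMod 2) (Poly 5)} (hM : hit 5 n ⊔ polyLt 5 n ω ≤ M) (hn : u.degree = n)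
    (hpos : ∀ i, 0 < u i) (hw : weight u = ω) (hu : Inadmissible u)
    (h : ∀ v : Fin 5 →₀ ℕ, v.degree = n → MonoLT v u → (∀ i, 0 < v i) → weight v = ω →
      mono v ∈ M) : mono u ∈ M := by
  obtain ⟨S, hS, hmem⟩ := hu
  rw [hn] at hmem
  have h1 := hM (Submodule.mem_sup_left (posPart_mem_hit hmem))
  rw [map_sub, posPart_mono, if_pos hpos, map_sum] at h1
  refine (Submodule.sub_mem_iff_left _ (Submodule.sum_mem _ fun v hv => ?_)).1 h1
  obtain ⟨hd, hlt⟩ := hS v hv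
  rw [hn] at hd
  rw [posPart_mono]
  split_ifs with hv0
  · by_cases hvw : weight v = ω
    · exact h v hd hlt hv0 hvw
    · refine hM (Submodule.mem_sup_right (Submodule.subset_span ⟨v, hd, ?_, rfl⟩))
      rcases hlt with hlt | ⟨he, _⟩
      · rwa [hw] at hlt
      · exact absurd (he.trans hw) hvw
  · exact Submodule.zero_mem _

/-- The subspace that is spanned modulo the hit polynomials and the smaller weight vectors by the
monomials in a set. -/
noncomputable def spanMod (n : ℕ) (ω : ℕ → ℕ) (S : Set (Fin 5 →₀ ℕ)) :
    Submodule (ZMod 2) (Poly 5) :=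
  hit 5 n ⊔ polyLt 5 n ω ⊔ Submodule.span (ZMod 2) (mono '' S)

theorem spanMod_mono {n : ℕ} {ω : ℕ → ℕ} {S T : Set (Fin 5 →₀ ℕ)} (h : S ⊆ T) :
    spanMod n ω S ≤ spanMod n ω T :=
  sup_le_sup_left (Submodule.span_mono (Set.image_mono h)) _

/-- Descent along the monomial order. The bound on the elements of B is recorded because
`admissible_of_linearIndependent` has to know that only elements strictly below a given one are
used. -/
theorem mono_mem_spanMod {n : ℕ} {ω : ℕ → ℕ} {B : Set (Fin 5 →₀ ℕ)}
    (hB : ∀ u : Fin 5 →₀ ℕ, weight u = ω → (∀ i, 0 < u i) → u ∉ B → Inadmissible u)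
    (u : Fin 5 →₀ ℕ) (hn : u.degree = n) : (∀ i, 0 < u i) → weight u = ω →
      mono u ∈ spanMod n ω {b | b ∈ B ∧ (b = u ∨ MonoLT b u)} := by
  refine monoLT_induction (n := n) (P := fun u => (∀ i, 0 < u i) → weight u = ω →
    mono u ∈ spanMod n ω {b | b ∈ B ∧ (b = u ∨ MonoLT b u)}) (fun u hn ih hpos hw => ?_) u hn
  by_cases hu : u ∈ B
  · exact Submodule.mem_sup_right (Submodule.subset_span ⟨u, ⟨hu, Or.inl rfl⟩, rfl⟩)
  · refine mono_mem_of_inadmissible le_sup_left hn hpos hw (hB u hw hpos hu)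
      fun v hv hlt hv0 hvw => spanMod_mono ?_ (ih v hv hlt hv0 hvw)
    rintro b ⟨hb, rfl | hb'⟩
    · exact ⟨hb, Or.inr hlt⟩
    · exact ⟨hb, Or.inr (hb'.trans hlt)⟩

/-- An inadmissible element of B would be congruent to a combination of strictly smaller elements of
B, against linear independence. -/
theorem admissible_of_linearIndependent {n : ℕ} {ω : ℕ → ℕ} {B : Set (Fin 5 →₀ ℕ)}
    (hB : ∀ u : Fin 5 →₀ ℕ, weight u = ω → (∀ i, 0 < u i) → u ∉ B → Inadmissible u)
    (hli : LinearIndependent (ZMod 2) fun u : B => (hit 5 n ⊔ polyLt 5 n ω).mkQ (mono u.1))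
    {u : Fin 5 →₀ ℕ} (hu : u ∈ B) (hn : u.degree = n) (hpos : ∀ i, 0 < u i)
    (hw : weight u = ω) : Admissible u := by
  intro hin
  have h : mono u ∈ spanMod n ω {b | b ∈ B ∧ MonoLT b u} := by
    refine mono_mem_of_inadmissible le_sup_left hn hpos hw hin
      fun v hv hlt hv0 hvw => spanMod_mono ?_ (mono_mem_spanMod hB v hv hv0 hvw)
    rintro b ⟨hb, rfl | hb'⟩
    · exact ⟨hb, hlt⟩
    · exact ⟨hb, hb'.trans hlt⟩
  obtain ⟨k, hk, s, hs, hks⟩ := Submodule.mem_sup.1 h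
  refine hli.notMem_span_image (s := {b : B | MonoLT b.1 u}) (x := ⟨u, hu⟩) (MonoLT.irrefl u) ?_
  have : (hit 5 n ⊔ polyLt 5 n ω).mkQ (mono u) = (hit 5 n ⊔ polyLt 5 n ω).mkQ s := by
    rw [← hks, map_add, (Submodule.mkQ_apply _ k).trans ((Submodule.Quotient.mk_eq_zero _).2 hk),
      zero_add]
  rw [this]
  have h2 := Submodule.mem_map_of_mem (f := (hit 5 n ⊔ polyLt 5 n ω).mkQ) hs
  rw [Submodule.map_span] at h2
  refine Submodule.span_mono ?_ h2
  rintro _ ⟨_, ⟨b, ⟨hb, hlt⟩, rfl⟩, rfl⟩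
  exact ⟨⟨b, hb⟩, hlt, rfl⟩

/-! ### The quotients of the weight filtration -/

theorem mono_mem_polyLe {t n : ℕ} {ω : ℕ → ℕ} {u : Fin t →₀ ℕ} (hn : u.degree = n)
    (hw : weight u = ω) : mono u ∈ polyLe t n ω :=
  Submodule.subset_span ⟨u, hn, by rw [hw], rfl⟩

theorem polyLt_le_polyLe (t n : ℕ) (ω : ℕ → ℕ) : polyLt t n ω ≤ polyLe t n ω := by
  refine Submodule.span_mono ?_
  rintro _ ⟨u, hn, hw, rfl⟩
  exact ⟨u, hn, hw.le, rfl⟩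

/-- This is the modular law: the smaller weight vectors already lie in `polyLe`, so in a
decomposition of an element of `polyLe` the hit summand lies there too. Classes can therefore be
tested without intersecting the hit polynomials with `polyLe`. -/
theorem weightClass_eq_zero_iff {t n : ℕ} {ω : ℕ → ℕ} {f : polyLe t n ω} :
    weightClass t n ω f = 0 ↔ f.1 ∈ hit t n ⊔ polyLt t n ω := by
  rw [weightClass, Submodule.mkQ_apply, Submodule.Quotient.mk_eq_zero, weightHit]
  change f.1 ∈ hit t n ⊓ polyLe t n ω ⊔ polyLt t n ω ↔ _
  refine ⟨fun h => (sup_le_sup_right inf_le_left (polyLt t n ω) :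
    hit t n ⊓ polyLe t n ω ⊔ polyLt t n ω ≤ _) h, fun h => ?_⟩
  obtain ⟨g, hg, l, hl, he⟩ := Submodule.mem_sup.1 h
  refine Submodule.mem_sup.2 ⟨g, ⟨hg, ?_⟩, l, hl, he⟩
  rw [← add_sub_cancel_right g l, he]
  exact Submodule.sub_mem _ f.2 (polyLt_le_polyLe t n ω hl)

theorem linearIndependent_weightClass {t n : ℕ} {ω : ℕ → ℕ} {ι : Type*} {v : ι → polyLe t n ω}
    (h : LinearIndependent (ZMod 2) fun i => (hit t n ⊔ polyLt t n ω).mkQ (v i).1) :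
    LinearIndependent (ZMod 2) fun i => weightClass t n ω (v i) := by
  refine LinearIndependent.of_comp ((weightHit t n ω).liftQ
    ((hit t n ⊔ polyLt t n ω).mkQ.comp (polyLe t n ω).subtype) fun f hf => ?_) h
  have : weightClass t n ω f = 0 := (Submodule.Quotient.mk_eq_zero _).2 hf
  exact (Submodule.Quotient.mk_eq_zero _).2 (weightClass_eq_zero_iff.1 this)

theorem span_weightClass {n : ℕ} {ω : ℕ → ℕ} {B : Set (Fin 5 →₀ ℕ)}
    (hB : ∀ u : Fin 5 →₀ ℕ, weight u = ω → (∀ i, 0 < u i) → u ∉ B → Inadmissible u)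
    (hB' : ∀ u ∈ B, u.degree = n ∧ (∀ i, 0 < u i) ∧ weight u = ω) :
    Submodule.span (ZMod 2) (Set.range fun u : B => weightClass 5 n ω
      ⟨mono u.1, mono_mem_polyLe (hB' u.1 u.2).1 (hB' u.1 u.2).2.2⟩) = QWeightPos 5 n ω := by
  refine le_antisymm (Submodule.span_le.2 ?_) ?_
  · rintro _ ⟨u, rfl⟩
    exact Submodule.mem_map_of_mem
      (Submodule.subset_span ⟨u.1, (hB' u.1 u.2).1, (hB' u.1 u.2).2.1, rfl⟩)
  · rintro _ ⟨f, hf, rfl⟩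
    have hsp : f.1 ∈ spanMod n ω B := by
      have h1 : ∀ v ∈ f.1.support, v.degree = n ∧ ∀ i, 0 < v i := by
        refine support_subset_of_mem_span (S := {v | v.degree = n ∧ ∀ i, 0 < v i}).1 ?_
        refine Submodule.span_mono ?_ hf
        rintro _ ⟨v, hv, hv', rfl⟩
        exact ⟨v, ⟨hv, hv'⟩, rfl⟩
      have h2 : ∀ v ∈ f.1.support, v.degree = n ∧ toLex (weight v) ≤ toLex ω := by
        refine support_subset_of_mem_span
          (S := {v | v.degree = n ∧ toLex (weight v) ≤ toLex ω}).1 ?_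
        refine Submodule.span_mono ?_ f.2
        rintro _ ⟨v, hv, hv', rfl⟩
        exact ⟨v, ⟨hv, hv'⟩, rfl⟩
      rw [poly_eq_sum_mono f.1]
      refine Submodule.sum_mem _ fun v hv => ?_
      obtain ⟨hd, hpos⟩ := h1 v hv
      -- Monomials of smaller weight vector vanish in the quotient; those of weight vector ω reduce
      -- to B.
      rcases (h2 v hv).2.lt_or_eq with hlt | heq
      · exact Submodule.mem_sup_left (Submodule.mem_sup_right
          (Submodule.subset_span ⟨v, hd, hlt, rfl⟩))
      · exact spanMod_mono (fun b hb => hb.1) (mono_mem_spanMod hB v hd hpos heq)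
    obtain ⟨k, hk, s, hs, hks⟩ := Submodule.mem_sup.1 hsp
    set w : B → polyLe 5 n ω := fun u =>
      ⟨mono u.1, mono_mem_polyLe (hB' u.1 u.2).1 (hB' u.1 u.2).2.2⟩
    have hs' : s ∈ (Submodule.span (ZMod 2) (Set.range w)).map (polyLe 5 n ω).subtype := by
      rw [Submodule.map_span]
      refine Submodule.span_mono ?_ hs
      rintro _ ⟨b, hb, rfl⟩
      exact ⟨w ⟨b, hb⟩, ⟨_, rfl⟩, rfl⟩
    obtain ⟨s', hs', rfl⟩ := hs'
    have he : weightClass 5 n ω f = weightClass 5 n ω s' := by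
      rw [← sub_eq_zero, ← map_sub, weightClass_eq_zero_iff]
      have : (f - s').1 = k := by
        change f.1 - s'.1 = k
        rw [← hks]
        exact add_sub_cancel_right _ _
      rwa [this]
    rw [he]
    have := Submodule.mem_map_of_mem (f := weightClass 5 n ω) hs'
    rwa [Submodule.map_span, ← Set.range_comp] at this

/-! ### Assembly for the three weight vectors -/

theorem linearIndependent_mkQ_mono {ws : List ℕ} {rows low high : List (List ℕ)} {N n d : ℕ}
    {B : List (Fin 5 → ℕ)} (hd : d < 32) (hc : checkFunctional ws low high = true)
    (hr : rows.all (fun r => Nat.beq r.length 5) = true) (hr5 : rows.length = 5)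
    (hlow : low.all (isExponentList n) = true)
    (hB : ∀ f ∈ B, (∀ i, f i < 2 ^ n) ∧ weightList (exponentList f) = ws) (hn : n ≤ 5)
    (hi : checkIndependent N n rows low B = true) :
    LinearIndependent (ZMod 2) fun i : Fin B.length =>
      (hit 5 d ⊔ polyLt 5 d fun k => ws.getD k 0).mkQ (mono (expo (exponentList (B.get i)))) := by
  rw [Fintype.linearIndependent_iff]
  intro g hg i
  refine congrFun (eq_zero_of_sum_mem (d := d) hd hc hr hr5 hlow hB hn hi g ?_) i
  rw [← Submodule.Quotient.mk_eq_zero, ← Submodule.mkQ_apply, map_sum, ← hg]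
  exact Finset.sum_congr rfl fun k _ => map_smul _ _ _

theorem linearIndependent_basis (j : Fin 3) :
    LinearIndependent (ZMod 2) fun i : Fin (![exponents1, exponents2, exponents3] j).length =>
      (hit 5 31 ⊔ polyLt 5 31 (omega j)).mkQ
        (mono (expo (exponentList ((![exponents1, exponents2, exponents3] j).get i)))) := by
  -- `weightList` always has five entries, so the shorter lists are padded by zeros; the weight
  -- vectors are unchanged because missing entries count as zero.
  have h : ∀ j : Fin 3, omega j =
      fun k => (![[1, 1, 1, 1, 1], [3, 2, 2, 2, 0], [3, 4, 3, 1, 0]] j).getD k 0 := by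
    intro j
    funext k
    rcases lt_or_ge k 5 with hk | hk
    · interval_cases k <;> fin_cases j <;> rfl
    · fin_cases j <;> rw [omega, List.getD_eq_default _ _ (by simp; omega),
        List.getD_eq_default _ _ (by simpa using hk)]
  rw [h]
  fin_cases j
  · exact linearIndependent_mkQ_mono (by norm_num) checkFunctional_one (by decide) rfl (by decide)
      (by decide +kernel) (by norm_num) checkIndependent_one
  · exact linearIndependent_mkQ_mono (by norm_num) checkFunctional_two (by decide +kernel) rfl
      (by decide +kernel) (by decide +kernel) (by norm_num) checkIndependent_two
  · exact linearIndependent_mkQ_mono (by norm_num) checkFunctional_three (by decide +kernel) rfl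
      (by decide +kernel) (by decide +kernel) (by norm_num) checkIndependent_three

theorem expo_exponentList_get_mem (j : Fin 3)
    (i : Fin (![exponents1, exponents2, exponents3] j).length) :
    expo (exponentList ((![exponents1, exponents2, exponents3] j).get i)) ∈ basisMonomials j := by
  have : ⇑(expo (exponentList ((![exponents1, exponents2, exponents3] j).get i))) =
      (![exponents1, exponents2, exponents3] j).get i := by
    funext k
    fin_cases k <;> rfl
  rw [basisMonomials, Set.mem_ofPred_eq, this]
  exact List.get_mem _ _

/-- The enumeration of the basis monomials. -/
noncomputable def basisEquiv (j : Fin 3) :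
    Fin (![exponents1, exponents2, exponents3] j).length ≃ basisMonomials j :=
  Equiv.ofBijective (fun i => ⟨_, expo_exponentList_get_mem j i⟩) <| by
    constructor
    · intro i k h
      -- Different positions in the list have independent, hence different, classes; so the list has
      -- no repetitions and its length counts the monomials.
      refine (linearIndependent_basis j).injective ?_
      exact congrArg (fun v => Submodule.mkQ _ (mono v)) (Subtype.mk.inj h)
    · rintro ⟨u, hu⟩
      obtain ⟨i, hi⟩ := List.mem_iff_get.1 hu
      exact ⟨i, Subtype.ext (by simp only; rw [hi, expo_exponentList])⟩

theorem exponents_check (j : Fin 3) : ∀ f ∈ ![exponents1, exponents2, exponents3] j,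
    isExponentList 5 (exponentList f) = true ∧ listSum (exponentList f) = 31 ∧
      (∀ i, 0 < f i) ∧ ∀ k < 5, (weightList (exponentList f)).getD k 0 = omega j k := by
  revert j
  decide +kernel

theorem basisMonomials_spec {j : Fin 3} {u : Fin 5 →₀ ℕ} (hu : u ∈ basisMonomials j) :
    u.degree = 31 ∧ (∀ i, 0 < u i) ∧ weight u = omega j := by
  obtain ⟨h5, hs, hpos, hw⟩ := exponents_check j _ hu
  refine ⟨?_, hpos, ?_⟩
  · rw [listSum_eq] at hs
    rw [← hs, ← degree_expo rfl, expo_exponentList]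
  · rw [← expo_exponentList u, weight_expo_eq_weightList h5]
    funext k
    rcases lt_or_ge k 5 with hk | hk
    · exact hw k hk
    · rw [List.getD_eq_default _ _ (by simpa [weightList] using hk)]
      fin_cases j <;> rw [omega, List.getD_eq_default _ _ (by simp; omega)]

theorem linearIndependent_basisMonomials (j : Fin 3) :
    LinearIndependent (ZMod 2) fun u : basisMonomials j =>
      (hit 5 31 ⊔ polyLt 5 31 (omega j)).mkQ (mono u.1) :=
  (linearIndependent_equiv (basisEquiv j)).1 (linearIndependent_basis j)

theorem card_basisMonomials (j : Fin 3) : Nat.card (basisMonomials j) = ![1, 215, 70] j := by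
  rw [← Nat.card_congr (basisEquiv j), Nat.card_eq_fintype_card, Fintype.card_fin]
  fin_cases j <;> decide +kernel

theorem mem_basisMonomials_iff (j : Fin 3) (u : Fin 5 →₀ ℕ) : u ∈ basisMonomials j ↔
    u.degree = 31 ∧ (∀ i, 0 < u i) ∧ weight u = omega j ∧ Admissible u := by
  refine ⟨fun hu => ?_, fun h => ?_⟩
  · obtain ⟨hn, hpos, hw⟩ := basisMonomials_spec hu
    exact ⟨hn, hpos, hw, admissible_of_linearIndependent
      (fun _ => inadmissible_of_not_mem_basisMonomials) (linearIndependent_basisMonomials j)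
      hu hn hpos hw⟩
  · obtain ⟨_, hpos, hw, hadm⟩ := h
    exact by_contra fun hu => hadm (inadmissible_of_not_mem_basisMonomials hw hpos hu)

theorem exists_basis_QWeightPos (j : Fin 3) :
    ∃ b : Module.Basis (basisMonomials j) (ZMod 2) (QWeightPos 5 31 (omega j)),
      ∀ u : basisMonomials j, ∃ h : mono u.1 ∈ polyLe 5 31 (omega j),
        (b u : QWeight 5 31 (omega j)) = weightClass 5 31 (omega j) ⟨mono u.1, h⟩ := by
  have hspec := fun (u : Fin 5 →₀ ℕ) (hu : u ∈ basisMonomials j) => basisMonomials_spec hu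
  have hli := linearIndependent_weightClass (v := fun u : basisMonomials j =>
    ⟨mono u.1, mono_mem_polyLe (hspec u.1 u.2).1 (hspec u.1 u.2).2.2⟩)
      (linearIndependent_basisMonomials j)
  refine ⟨(Module.Basis.span hli).map (LinearEquiv.ofEq _ _
    (span_weightClass (fun _ => inadmissible_of_not_mem_basisMonomials) hspec)),
    fun u => ⟨mono_mem_polyLe (hspec u.1 u.2).1 (hspec u.1 u.2).2.2, ?_⟩⟩
  rw [Module.Basis.map_apply]
  exact congrArg Subtype.val (Module.Basis.span_apply hli u)

end HitProblem

theorem mainTheorem4 (j : Fin 3) :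
    -- the dimension of the positive-variable part
    Module.finrank (ZMod 2) (HitProblem.QWeightPos 5 31 (HitProblem.omega j)) = ![1, 215, 70] j ∧
    -- the listed monomials are the admissible ones with all exponents positive and this weight
    (∀ u : Fin 5 →₀ ℕ, u ∈ HitProblem.basisMonomials j ↔
      u.degree = 31 ∧ (∀ i, 0 < u i) ∧ HitProblem.weight u = HitProblem.omega j ∧
        HitProblem.Admissible u) ∧
    -- their classes are a basis
    (∃ b : Module.Basis (HitProblem.basisMonomials j) (ZMod 2)
        (HitProblem.QWeightPos 5 31 (HitProblem.omega j)),
      ∀ u : HitProblem.basisMonomials j,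
        ∃ h : HitProblem.mono u.1 ∈ HitProblem.polyLe 5 31 (HitProblem.omega j),
          (b u : HitProblem.QWeight 5 31 (HitProblem.omega j)) =
            HitProblem.weightClass 5 31 (HitProblem.omega j) ⟨HitProblem.mono u.1, h⟩) := by
  obtain ⟨b, hb⟩ := HitProblem.exists_basis_QWeightPos j
  refine ⟨?_, fun u => HitProblem.mem_basisMonomials_iff j u, b, hb⟩
  rw [Module.finrank_eq_nat_card_basis b, HitProblem.card_basisMonomials]
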